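/- All algebras are over $\mathbb{Z}/2$ and gradings are cohomological. Let $\Lambda=\Lambda_{2,2,2}\subset J^1(\mathbb{R}^2)$ be the link of five Legendrian unknotted spheres $\Lambda_A,\Lambda_B,\Lambda_P,\Lambda_Q,\Lambda_R$, where the front of $\Lambda_X$ consists of an upper sheet $X^+$ and a lower sheet $X^-$ that meet in a cusp edge over a circle, with Maslov potential $\mu(B^+)=1$, $\mu(B^-)=\mu(R^+)=\mu(P^+)=\mu(Q^+)=0$, $\mu(R^-)=\mu(P^-)=\mu(Q^-)=\mu(A^+)=-1$, $\mu(A^-)=-2$. Its front lies over a disc with the following polygonal decomposition. 2-cells $e^2_i$ and the sheets over them from top to bottom: $e_1^2$: $B^+B^-R^+R^-A^+A^-$; $e_2^2$: $B^+B^-R^+A^+R^-A^-$; $e_3^2$: $B^+R^+B^-A^+R^-A^-$; $e^2_4,e^2_5,e^2_6,e^2_7$ (for $X=P$) and $e^2_8,e^2_9,e^2_{10},e^2_{11}$ (for $X=Q$): $B^+R^+B^-X^+X^-A^+R^-A^-$, $B^+R^+B^-X^+A^+X^-R^-A^-$, $B^+R^+X^+B^-A^+X^-R^-A^-$, $B^+R^+X^+A^+B^-X^-R^-A^-$.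 1-cells: the outer circle $e^1_0$ based at $e_1^0$, over which lie only the cusp edges of $\Lambda_A,\Lambda_B,\Lambda_R$; a circle $e^1_{21}$ based at $e_2^0$ (crossing of $A^+,R^-$); a circle made of $e^1_{19}:e_3^0\to e_8^0$ and $e_{20}^1:e_8^0\to e_3^0$ (crossing of $B^-,R^+$); circles $e^1_{15},e^1_{14},e^1_{13},e^1_1$ based at $e^0_4,\dots,e^0_7$ (cusp edge of $\Lambda_P$; crossings of $A^+,P^-$; of $B^-,P^+$; of $A^+,B^-$); circles $e^1_{18},e^1_{17},e^1_{16},e^1_8$ based at $e_9^0,\dots,e_{12}^0$ (the same with $Q$); and the crossing-free and cusp-free edges $e^1_j:e^0_{j-1}\to e^0_j$ for $2\le j\le 7$ and $9\le j\le 12$. The sheets over $e^1_2,e^1_3$ are those over $e_1^2,e_2^2$; over $e_4^1,e_9^1$ those over $e_3^2$; over $e^1_5,e^1_6,e^1_7,e^1_{10},e^1_{11},e^1_{12}$ those over $e^2_4,e^2_5,e^2_6,e^2_8,e^2_9,e^2_{10}$. Over a 0-cell on one of the circles the front is as over that circle. For $k=1,2,4,5,6,8,9,10$ the 2-cell $e^2_k$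 is the annulus between two consecutive circles, cut open along the edge $e^1_j$ joining them, with initial and terminal vertices those of $e^1_j$ and with boundary arcs "$e^1_j$, then the inner circle" and "the outer circle, then $e_j^1$" (the inner circle of $e_2^2$ being $e^1_{19}$ followed by $e^1_{20}$); $e_7^2,e^2_{11}$ are discs with initial and terminal vertex $e_7^0$, resp. $e_{12}^0$, and boundary arcs $e_1^1$, resp. $e_8^1$, and the constant arc; $e^2_3$ has initial vertex $e^0_4$, terminal vertex $e_9^0$ and boundary arcs $e^1_{15},(e^1_4)^{-1},e^1_{19},e^1_9$ and $(e^1_4)^{-1},(e^1_{20})^{-1},e_9^1,e^1_{18}$. The cellular dg algebra $\mathcal{C}(\Lambda)$ has one generator for each cell and each pair of sheets $s\prec t$ over it ($s$ strictly above $t$), denoted $a_i^{s,t},b_i^{s,t},c_i^{s,t}$ for cells $e_i^0,e_i^1,e_i^2$, of degree $\mu(t)-\mu(s)+1$, $\mu(t)-\mu(s)$, $\mu(t)-\mu(s)-1$; it is free over $\Bbbk=\bigoplus_{v\in\{A,B,P,Q,R\}}(\mathbb{Z}/2)e_v$, a generator for $(s,t)$ with $s\subset\Lambda_v$, $t\subset\Lambda_w$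 lying in $e_v\,\mathcal{C}(\Lambda)\,e_w$. With $A,B,C$ the strictly upper triangular matrices of generators, its differential is given by $dA=A^2$, $dB=A_+(E+B)+(E+B)A_-$ and $dC=A_+C+CA_-+(E+B_{n})^{\pm1}\cdots(E+B_{1})^{\pm1}+(E+B'_{m})^{\pm1}\cdots(E+B'_{1})^{\pm1}$, where $A_-,A_+$ belong to the initial and terminal vertices, the two products run along the two boundary arcs of the 2-cell with sign $-1$ for edges passed backwards, and for two sheets of $\Lambda_v$ meeting in a cusp over a vertex (resp. an edge) the matrix of that cell gets a diagonal block $\begin{bmatrix}0&e_v\\0&0\end{bmatrix}$ (resp. $0$). When the sheets over a cell are totally ordered, $b_i^{m,n},c_i^{m,n}$ denotes the generator for the $m$-th and $n$-th sheet from the top. Then $\mathcal{C}(\Lambda)$ is a semi-free dg algebra over $\Bbbk$, and it is quasi-isomorphic, and stable tame isomorphic, to the semi-free dg algebra $\mathcal{C}'(\Lambda)$ over $\Bbbk$ with the 21 generators $$b_2^{4,5},b_3^{2,3},b_5^{5,6},b_6^{3,4},b_7^{4,5},b_{10}^{5,6},b_{11}^{3,4},b_{12}^{4,5};\quad c_7^{4,5},c_{11}^{4,5},c_7^{3,5},c_{11}^{3,5},c_7^{2,5}+c_{11}^{2,5},c_7^{4,6},c_{11}^{4,6},c_7^{4,7}+c_{11}^{4,7};$$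 $$c_7^{4,8}+c_{11}^{4,8},c_7^{1,5}+c_{11}^{1,5},c_7^{3,6},c_{11}^{3,6},c_7^{2,7}+c_{11}^{2,7},$$ (each starting and ending at the components of the corresponding sheets), with degrees $|b_2^{4,5}|=|b_3^{2,3}|=|b_5^{5,6}|=|b_6^{3,4}|=|c_7^{4,5}|=|b_{10}^{5,6}|=|b_{11}^{3,4}|=|c_{11}^{4,5}|=0$, $|b_7^{4,5}|=|b_{12}^{4,5}|=|c_7^{3,5}|=|c_{11}^{3,5}|=|c_7^{2,5}+c_{11}^{2,5}|=|c_7^{4,6}|=|c_{11}^{4,6}|=|c_7^{4,7}+c_{11}^{4,7}|=-1$, $|c_7^{4,8}+c_{11}^{4,8}|=|c_7^{1,5}+c_{11}^{1,5}|=|c_7^{3,6}|=|c_{11}^{3,6}|=|c_7^{2,7}+c_{11}^{2,7}|=-2$, and with differential vanishing on the generators of degree $0$ and $$db_7^{4,5}=b_6^{3,4}b_5^{5,6}+b_3^{2,3}b_2^{4,5},\quad db_{12}^{4,5}=b_{11}^{3,4}b_{10}^{5,6}+b_3^{2,3}b_2^{4,5},\quad dc_7^{3,5}=b_5^{5,6}c_7^{4,5},\quad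 dc_{11}^{3,5}=b_{10}^{5,6}c_{11}^{4,5},$$ $$d(c_7^{2,5}+c_{11}^{2,5})=b_2^{4,5}c_{11}^{4,5}+b_2^{4,5}c_7^{4,5},\quad dc_7^{4,6}=c_7^{4,5}b_6^{3,4},\quad dc_{11}^{4,6}=c_{11}^{4,5}b_{11}^{3,4},\quad d(c_7^{4,7}+c_{11}^{4,7})=c_{11}^{4,5}b_3^{2,3}+c_7^{4,5}b_3^{2,3},$$ $$d(c_7^{4,8}+c_{11}^{4,8})=c_{11}^{4,5}b_{12}^{4,5}+c_7^{4,5}b_7^{4,5}+c_7^{4,6}b_5^{5,6}+c_{11}^{4,6}b_{10}^{5,6}+(c_7^{4,7}+c_{11}^{4,7})b_2^{4,5},$$ $$d(c_7^{1,5}+c_{11}^{1,5})=b_6^{3,4}c_7^{3,5}+b_{11}^{3,4}c_{11}^{3,5}+b_3^{2,3}(c_7^{2,5}+c_{11}^{2,5})+b_{12}^{4,5}c_{11}^{4,5}+b_7^{4,5}c_7^{4,5},$$ $$dc_7^{3,6}=b_5^{5,6}c_7^{4,6}+c_7^{3,5}b_6^{3,4},\quad dc_{11}^{3,6}=b_{10}^{5,6}c_{11}^{4,6}+c_{11}^{3,5}b_{11}^{3,4},\quad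 d(c_7^{2,7}+c_{11}^{2,7})=b_2^{4,5}(c_7^{4,7}+c_{11}^{4,7})+(c_7^{2,5}+c_{11}^{2,5})b_3^{2,3}.$$ More precisely, there is a quasi-isomorphism of dg algebras $\mathcal{C}(\Lambda)\to\mathcal{C}'(\Lambda)$ over $\Bbbk$ which sends each of the 21 listed elements of $\mathcal{C}(\Lambda)$ to the generator of $\mathcal{C}'(\Lambda)$ of that name. The same holds for the dg algebras over $\mathbb{Z}/2$ freely generated by the same generators, and more generally with $\Bbbk$ replaced by $\bigoplus_{v\in V}(\mathbb{Z}/2)e_v$ for any finite set $V$ and any map $\{A,B,P,Q,R\}\to V$, by which each component is relabelled by its image in $V$. -/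

import Mathlib

/-! ## Path algebras: tensor algebras over a semisimple ring

All algebras are over the field `ZMod 2`.  For a finite set `V` the semisimple ring of the text is
`𝕜 = ⨁_{v ∈ V} (ZMod 2) e_v`. -/

namespace CellDGA

/-- The defining relations of the tensor algebra over `𝕜` on generators `x_g`, with
`x_g ∈ e_{src g} · M · e_{tgt g}`. -/
inductive PathRel {V G : Type} [Fintype V] (src tgt : G → V) :
    FreeAlgebra (ZMod 2) (V ⊕ G) → FreeAlgebra (ZMod 2) (V ⊕ G) → Prop
  | idem (v : V) : PathRel src tgt
      (FreeAlgebra.ι (ZMod 2) (Sum.inl v) * FreeAlgebra.ι (ZMod 2) (Sum.inl v))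
      (FreeAlgebra.ι (ZMod 2) (Sum.inl v))
  | orth (v w : V) (h : v ≠ w) : PathRel src tgt
      (FreeAlgebra.ι (ZMod 2) (Sum.inl v) * FreeAlgebra.ι (ZMod 2) (Sum.inl w)) 0
  | unit : PathRel src tgt (∑ v : V, FreeAlgebra.ι (ZMod 2) (Sum.inl v)) 1
  | left (g : G) : PathRel src tgt
      (FreeAlgebra.ι (ZMod 2) (Sum.inl (src g)) * FreeAlgebra.ι (ZMod 2) (Sum.inr g))
      (FreeAlgebra.ι (ZMod 2) (Sum.inr g))
  | right (g : G) : PathRel src tgt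
      (FreeAlgebra.ι (ZMod 2) (Sum.inr g) * FreeAlgebra.ι (ZMod 2) (Sum.inl (tgt g)))
      (FreeAlgebra.ι (ZMod 2) (Sum.inr g))

/-- The tensor algebra over `𝕜` of the `𝕜`-bimodule with basis `G`, that is, the path algebra of the
quiver with vertices `V` and arrows `G`.  If `V` has exactly one element, it is the free unital
algebra on `G`. -/
abbrev PathAlg {V G : Type} [Fintype V] (src tgt : G → V) : Type := RingQuot (PathRel src tgt)

section PathAlg

variable {V G : Type} [Fintype V] (src tgt : G → V)

/-- The idempotent `e_v`. -/
def idem (v : V) : PathAlg src tgt :=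
  RingQuot.mkAlgHom (ZMod 2) (PathRel src tgt) (FreeAlgebra.ι (ZMod 2) (Sum.inl v))

/-- The generator `x_g`. -/
def gen (g : G) : PathAlg src tgt :=
  RingQuot.mkAlgHom (ZMod 2) (PathRel src tgt) (FreeAlgebra.ι (ZMod 2) (Sum.inr g))

theorem idem_mul_self (v : V) : idem src tgt v * idem src tgt v = idem src tgt v := by
  simpa [idem] using RingQuot.mkAlgHom_rel (ZMod 2) (PathRel.idem (src := src) (tgt := tgt) v)

theorem idem_mul_ne {v w : V} (h : v ≠ w) : idem src tgt v * idem src tgt w = 0 := by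
  simpa [idem] using RingQuot.mkAlgHom_rel (ZMod 2) (PathRel.orth (src := src) (tgt := tgt) v w h)

theorem sum_idem : ∑ v : V, idem src tgt v = 1 := by
  simpa [idem] using RingQuot.mkAlgHom_rel (ZMod 2) (PathRel.unit (src := src) (tgt := tgt))

theorem idem_mul_gen (g : G) : idem src tgt (src g) * gen src tgt g = gen src tgt g := by
  simpa [idem, gen] using RingQuot.mkAlgHom_rel (ZMod 2) (PathRel.left (src := src) (tgt := tgt) g)

theorem gen_mul_idem (g : G) : gen src tgt g * idem src tgt (tgt g) = gen src tgt g := by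
  simpa [idem, gen] using RingQuot.mkAlgHom_rel (ZMod 2) (PathRel.right (src := src) (tgt := tgt) g)

/-- The universal property of the path algebra. -/
def lift {B : Type} [Ring B] [Algebra (ZMod 2) B] (ε : V → B) (ξ : G → B)
    (h1 : ∀ v, ε v * ε v = ε v) (h2 : ∀ v w, v ≠ w → ε v * ε w = 0) (h3 : ∑ v, ε v = 1)
    (h4 : ∀ g, ε (src g) * ξ g = ξ g) (h5 : ∀ g, ξ g * ε (tgt g) = ξ g) :
    PathAlg src tgt →ₐ[ZMod 2] B :=
  RingQuot.liftAlgHom (ZMod 2)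
    ⟨FreeAlgebra.lift (ZMod 2) (Sum.elim ε ξ), by
      intro x y h
      cases h with
      | idem v => simpa using h1 v
      | orth v w h => simpa using h2 v w h
      | unit => simpa using h3
      | left g => simpa using h4 g
      | right g => simpa using h5 g⟩

end PathAlg

/-! ## Semi-free dg algebras over `𝕜` -/

/-- A graded algebra over `𝕜`, freely generated by a set of homogeneous generators, together with
the value of a differential on each generator. -/
structure SemiFree (V : Type) [Fintype V] where
  Gen : Type
  src : Gen → V
  tgt : Gen → V
  deg : Gen → ℤ
  diff : Gen → PathAlg src tgt

namespace SemiFree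

variable {V : Type} [Fintype V]

/-- The underlying algebra. -/
abbrev Alg (A : SemiFree V) : Type := PathAlg A.src A.tgt

/-- The idempotent `e_v` of `𝕜` in the algebra. -/
abbrev e (A : SemiFree V) (v : V) : A.Alg := idem A.src A.tgt v

/-- The generator `g` as an element of the algebra. -/
abbrev x (A : SemiFree V) (g : A.Gen) : A.Alg := gen A.src A.tgt g

/-- The algebra homomorphism `a ↦ a + ε · d a` into the dual numbers, where `d` is the derivation
determined by `d e_v = 0` and `d x_g = e_{src g} · diff g · e_{tgt g}`; there are no signs because
`2 = 0`.  (The projection to `e_{src g} · _ · e_{tgt g}` does nothing when the prescribed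
differential is a differential over `𝕜`, which is part of `IsSemiFreeDG`.) -/
noncomputable def dualHom (A : SemiFree V) : A.Alg →ₐ[ZMod 2] DualNumber A.Alg :=
  lift A.src A.tgt (fun v => TrivSqZeroExt.inl (A.e v))
    (fun g => TrivSqZeroExt.inl (A.x g) +
      TrivSqZeroExt.inr (A.e (A.src g) * A.diff g * A.e (A.tgt g)))
    (fun v => by rw [← TrivSqZeroExt.inl_mul, idem_mul_self])
    (fun v w h => by rw [← TrivSqZeroExt.inl_mul, idem_mul_ne _ _ h, TrivSqZeroExt.inl_zero])
    (by rw [← TrivSqZeroExt.inl_sum, sum_idem, TrivSqZeroExt.inl_one])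
    (fun g => by
      ext
      · simp [idem_mul_gen]
      · simp [← mul_assoc, idem_mul_self])
    (fun g => by
      ext
      · simp [gen_mul_idem]
      · simp [mul_assoc, idem_mul_self])

/-- The differential. -/
noncomputable def d (A : SemiFree V) : A.Alg →ₗ[ZMod 2] A.Alg where
  toFun a := TrivSqZeroExt.snd (A.dualHom a)
  map_add' a b := by simp
  map_smul' c a := by simp

/-- The component of degree `n` of the grading, spanned by the words of total degree `n`. -/
def degreePart (A : SemiFree V) (n : ℤ) : Submodule (ZMod 2) A.Alg :=
  Submodule.span (ZMod 2)
    {a | ∃ (v : V) (l : List A.Gen), (l.map A.deg).sum = n ∧ a = A.e v * (l.map A.x).prod}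

/-- The subalgebra generated over `𝕜` by a set of generators. -/
def subalg (A : SemiFree V) (T : Set A.Gen) : Subalgebra (ZMod 2) A.Alg :=
  Algebra.adjoin (ZMod 2) (Set.range A.e ∪ A.x '' T)

/-- The prescribed differential makes `A` a semi-free dg algebra over `𝕜`: it is compatible with the
`𝕜`-bimodule structure, it has degree `1` (cohomological grading), it squares to zero, and it is
triangular for some ordering of the generators. -/
structure IsSemiFreeDG (A : SemiFree V) : Prop where
  bimodule : ∀ g, A.e (A.src g) * A.diff g * A.e (A.tgt g) = A.diff g
  degree : ∀ g, A.diff g ∈ A.degreePart (A.deg g + 1)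
  square : ∀ a, A.d (A.d a) = 0
  triangular : ∃ r : A.Gen → ℕ, ∀ g, A.diff g ∈ A.subalg {h | r h < r g}

/-- Morphisms of dg algebras over `𝕜`. -/
structure IsDGHom (A B : SemiFree V) (φ : A.Alg →ₐ[ZMod 2] B.Alg) : Prop where
  map_e : ∀ v, φ (A.e v) = B.e v
  map_degree : ∀ n, ∀ a ∈ A.degreePart n, φ a ∈ B.degreePart n
  map_d : ∀ a, φ (A.d a) = B.d (φ a)

/-- Quasi-isomorphisms of dg algebras over `𝕜`: the map induced on cohomology `ker d / im d` is
injective and surjective. -/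
structure IsQuasiIso (A B : SemiFree V) (φ : A.Alg →ₐ[ZMod 2] B.Alg) : Prop
    extends IsDGHom A B φ where
  injective : ∀ a, A.d a = 0 → (∃ b, φ a = B.d b) → ∃ a', a = A.d a'
  surjective : ∀ b, B.d b = 0 → ∃ a, A.d a = 0 ∧ ∃ b', b = φ a + B.d b'

/-! ### Stable tame isomorphisms -/

/-- Elementary automorphisms of the graded algebra `A` over `𝕜`: one generator `x_g` is sent to
`x_g + v` with `v` in the subalgebra generated by the other generators, and all other generators are
fixed.  Here `v` has the degree of `g` and lies in `e_{src g} · A · e_{tgt g}`. -/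
def IsElementary (A : SemiFree V) (τ : A.Alg ≃ₐ[ZMod 2] A.Alg) : Prop :=
  (∀ v, τ (A.e v) = A.e v) ∧
    ∃ (g : A.Gen) (v : A.Alg), v ∈ A.subalg {h | h ≠ g} ∧ v ∈ A.degreePart (A.deg g) ∧
      A.e (A.src g) * v * A.e (A.tgt g) = v ∧
      τ (A.x g) = A.x g + v ∧ ∀ h, h ≠ g → τ (A.x h) = A.x h

/-- Compositions of finitely many elementary automorphisms. -/
inductive IsTameAut (A : SemiFree V) : (A.Alg ≃ₐ[ZMod 2] A.Alg) → Prop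
  | refl : IsTameAut A AlgEquiv.refl
  | step (τ σ : A.Alg ≃ₐ[ZMod 2] A.Alg) :
      IsTameAut A τ → IsElementary A σ → IsTameAut A (τ.trans σ)

/-- Tame isomorphism of dg algebras: an isomorphism of dg algebras which is the composition of a
sequence of elementary automorphisms and an identification `σ` of the sets of generators. -/
def TameIso (A B : SemiFree V) : Prop :=
  ∃ τ : A.Alg ≃ₐ[ZMod 2] A.Alg, IsTameAut A τ ∧
    ∃ (σ : A.Gen ≃ B.Gen) (φ : A.Alg ≃ₐ[ZMod 2] B.Alg),
      (∀ g, B.src (σ g) = A.src g ∧ B.tgt (σ g) = A.tgt g ∧ B.deg (σ g) = A.deg g) ∧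
      (∀ v, φ (A.e v) = B.e v) ∧ (∀ g, φ (A.x g) = B.x (σ g)) ∧
      ∀ a, φ (τ (A.d a)) = B.d (φ (τ a))

/-- The result of stabilizing `A` once for each `k : I`: one adds generators `a_k` of degree `i k`
and `b_k` of degree `i k + 1`, both in `e_{p k} · _ · e_{q k}`, with `d a_k = b_k`, `d b_k = 0`. -/
noncomputable def stabilize (A : SemiFree V) (I : Type) (p q : I → V) (i : I → ℤ) :
    SemiFree V where
  Gen := A.Gen ⊕ (I ⊕ I)
  src := Sum.elim A.src (Sum.elim p p)
  tgt := Sum.elim A.tgt (Sum.elim q q)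
  deg := Sum.elim A.deg (Sum.elim i (fun k => i k + 1))
  diff := Sum.elim
    (fun g => lift A.src A.tgt (fun v => idem _ _ v) (fun h => gen _ _ (Sum.inl h))
      (idem_mul_self _ _) (fun _ _ h => idem_mul_ne _ _ h) (sum_idem _ _)
      (fun h => idem_mul_gen (Sum.elim A.src (Sum.elim p p)) _ (Sum.inl h))
      (fun h => gen_mul_idem _ (Sum.elim A.tgt (Sum.elim q q)) (Sum.inl h)) (A.diff g))
    (Sum.elim (fun k => gen _ _ (Sum.inr (Sum.inr k))) (fun _ => 0))

/-- Two dg algebras are stable tame isomorphic if they become tame isomorphic after finitely many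
stabilizations of each. -/
def StableTameIso (A B : SemiFree V) : Prop :=
  ∃ (I J : Type) (_ : Finite I) (_ : Finite J) (p q : I → V) (i : I → ℤ) (p' q' : J → V)
    (j : J → ℤ), TameIso (A.stabilize I p q i) (B.stabilize J p' q' j)

end SemiFree

/-! ## Legendrian fronts over polygonal decompositions -/

/-- A cell of dimension `0`, `1` or `2`. -/
inductive Cell (K0 K1 K2 : Type) : Type
  | vert : K0 → Cell K0 K1 K2
  | edge : K1 → Cell K0 K1 K2
  | face : K2 → Cell K0 K1 K2

/-- In a list of blocks, read from top to bottom, the block of `s` lies strictly above that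
of `t`. -/
def Above {S : Type} : List (List S) → S → S → Prop
  | [], _, _ => False
  | L :: M, s, t => (s ∈ L ∧ t ∈ M.flatten) ∨ Above M s t

instance Above.decidable {S : Type} [DecidableEq S] :
    (M : List (List S)) → (s t : S) → Decidable (Above M s t)
  | [], _, _ => isFalse (fun h => h)
  | L :: M, s, t =>
    have := Above.decidable M s t
    inferInstanceAs (Decidable ((s ∈ L ∧ t ∈ M.flatten) ∨ Above M s t))

/-- The combinatorics of the front projection of a Legendrian surface (a link with set of components
`Comp`) without swallowtails, over the cells of a compatible polygonal decomposition.  Several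
crossings or several cusp edges may lie above the same cell.

The sheets carry global labels `s : S`: the sheet above a cell `c` whose closure contains a given
sheet above a face of `c` has the same label.  (This covers the fronts without monodromy of the
sheets, such as those in which every component consists of an upper and a lower sheet which meet in
a cusp edge.) -/
structure Front (Comp S : Type) where
  /-- cells of dimension 0, 1, 2 -/
  K0 : Type
  K1 : Type
  K2 : Type
  /-- component of the link that contains a sheet -/
  comp : S → Comp
  /-- Maslov potential -/
  maslov : S → ℤ
  /-- the sheets above a cell that are not contained in a cusp edge, from top to bottom; sheets in
  the same block meet in a crossing above the cell -/
  stack : Cell K0 K1 K2 → List (List S)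
  /-- the pairs (upper sheet, lower sheet) that meet in a cusp edge above the cell -/
  cusp : Cell K0 K1 K2 → List (S × S)
  /-- initial vertex of a 1-cell, written with the index `-` in the text -/
  ini : K1 → K0
  /-- terminal vertex of a 1-cell, written with the index `+` in the text -/
  ter : K1 → K0
  /-- initial vertex of the boundary of a 2-cell -/
  faceIni : K2 → K0
  /-- terminal vertex of the boundary of a 2-cell -/
  faceTer : K2 → K0
  /-- the successive 1-cells along the two arcs of the boundary of a 2-cell from its initial to its
  terminal vertex; `true` if the 1-cell is passed along its orientation -/
  path₁ : K2 → List (K1 × Bool)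
  path₂ : K2 → List (K1 × Bool)

namespace Front

variable {Comp S : Type} [DecidableEq S] [Fintype S] (Λ : Front Comp S)

/-- `s ≺ t` above the cell `c`, that is, `z(s) > z(t)`. -/
abbrev Prec (c : Cell Λ.K0 Λ.K1 Λ.K2) (s t : S) : Prop := Above (Λ.stack c) s t

/-- `s` is one of the sheets above the cell `c`. -/
abbrev Present (c : Cell Λ.K0 Λ.K1 Λ.K2) (s : S) : Prop := s ∈ (Λ.stack c).flatten

/-- A sequence of oriented 1-cells is a path between two vertices. -/
def IsPath : Λ.K0 → Λ.K0 → List (Λ.K1 × Bool) → Prop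
  | v, w, [] => v = w
  | v, w, (k, true) :: l => Λ.ini k = v ∧ IsPath (Λ.ter k) w l
  | v, w, (k, false) :: l => Λ.ter k = v ∧ IsPath (Λ.ini k) w l

/-- The front above a cell `c` and above a cell `c'` in the boundary of which `c` lies fit together:
every sheet above `c` continues to a sheet above `c'`; the other sheets above `c'` meet in
pairs of neighbours in cusp edges above `c`; and the partial orders agree. -/
def Fits (c c' : Cell Λ.K0 Λ.K1 Λ.K2) : Prop :=
  (∀ s, Λ.Present c s → Λ.Present c' s) ∧
  (∀ s, Λ.Present c' s → ¬ Λ.Present c s → ∃ q ∈ Λ.cusp c, s = q.1 ∨ s = q.2) ∧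
  (∀ q ∈ Λ.cusp c, (Λ.Present c' q.1 ↔ Λ.Present c' q.2) ∧
    (Λ.Present c' q.1 → Λ.Prec c' q.1 q.2 ∧
      ∀ s, Λ.Prec c' q.1 s → Λ.Prec c' s q.2 → False)) ∧
  (∀ s t, Λ.Prec c s t → Λ.Prec c' s t)

instance Fits.decidable (c c' : Cell Λ.K0 Λ.K1 Λ.K2) : Decidable (Λ.Fits c c') :=
  have h1 : Decidable (∀ s, Λ.Present c s → Λ.Present c' s) := inferInstance
  have h2 : Decidable (∀ s, Λ.Present c' s → ¬ Λ.Present c s →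
      ∃ q ∈ Λ.cusp c, s = q.1 ∨ s = q.2) := inferInstance
  have h3 : Decidable (∀ q ∈ Λ.cusp c, (Λ.Present c' q.1 ↔ Λ.Present c' q.2) ∧
    (Λ.Present c' q.1 → Λ.Prec c' q.1 q.2 ∧
      ∀ s, Λ.Prec c' q.1 s → Λ.Prec c' s q.2 → False)) := inferInstance
  have h4 : Decidable (∀ s t, Λ.Prec c s t → Λ.Prec c' s t) := inferInstance
  @instDecidableAnd _ _ h1 (@instDecidableAnd _ _ h2 (@instDecidableAnd _ _ h3 h4))

/-- The data are consistent. -/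
structure IsConsistent : Prop where
  nodup : ∀ c, (Λ.stack c).flatten.Nodup
  total : ∀ f, ∀ L ∈ Λ.stack (.face f), L.length = 1
  cusp_comp : ∀ c, ∀ q ∈ Λ.cusp c, Λ.comp q.1 = Λ.comp q.2
  cusp_maslov : ∀ c, ∀ q ∈ Λ.cusp c, Λ.maslov q.1 = Λ.maslov q.2 + 1
  cusp_absent : ∀ c, ∀ q ∈ Λ.cusp c, ¬ Λ.Present c q.1 ∧ ¬ Λ.Present c q.2
  path_one : ∀ f, Λ.IsPath (Λ.faceIni f) (Λ.faceTer f) (Λ.path₁ f)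
  path_two : ∀ f, Λ.IsPath (Λ.faceIni f) (Λ.faceTer f) (Λ.path₂ f)
  fits_ini : ∀ k, Λ.Fits (.vert (Λ.ini k)) (.edge k)
  fits_ter : ∀ k, Λ.Fits (.vert (Λ.ter k)) (.edge k)
  fits_edge : ∀ f, ∀ k ∈ Λ.path₁ f ++ Λ.path₂ f, Λ.Fits (.edge k.1) (.face f)
  fits_faceIni : ∀ f, Λ.Fits (.vert (Λ.faceIni f)) (.face f)
  fits_faceTer : ∀ f, Λ.Fits (.vert (Λ.faceTer f)) (.face f)

/-- The generators of the cellular dg algebra: one for each cell and each pair of sheets `s ≺ t`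
above it. -/
abbrev CellGen : Type := {g : Cell Λ.K0 Λ.K1 Λ.K2 × S × S // Λ.Prec g.1 g.2.1 g.2.2}

/-- `|a^{s,t}| = μ(t) - μ(s) + 1`, `|b^{s,t}| = μ(t) - μ(s)`, `|c^{s,t}| = μ(t) - μ(s) - 1`. -/
def cellDeg : Λ.CellGen → ℤ
  | ⟨(.vert _, s, t), _⟩ => Λ.maslov t - Λ.maslov s + 1
  | ⟨(.edge _, s, t), _⟩ => Λ.maslov t - Λ.maslov s
  | ⟨(.face _, s, t), _⟩ => Λ.maslov t - Λ.maslov s - 1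

section Matrices

variable {V : Type} [Fintype V] (π : Comp → V)

/-- Left vertex of a generator. -/
def cellSrc (g : Λ.CellGen) : V := π (Λ.comp g.1.2.1)

/-- Right vertex of a generator. -/
def cellTgt (g : Λ.CellGen) : V := π (Λ.comp g.1.2.2)

/-- The underlying algebra of the cellular dg algebra. -/
abbrev CellAlg : Type := PathAlg (Λ.cellSrc π) (Λ.cellTgt π)

/-- The matrix of the generators of the 0-cell `v`, regarded from the cell `c` in the closure of
which `v` lies: a block `N` is inserted for each pair of sheets above `c` that meet in a cusp
above `v`.  The rows and columns of all matrices are indexed by all sheet labels, and those of the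
sheets which are absent above `c` vanish. -/
def matA (v : Λ.K0) (c : Cell Λ.K0 Λ.K1 Λ.K2) : Matrix S S (Λ.CellAlg π) :=
  Matrix.of fun s t =>
    if h : Λ.Prec (.vert v) s t then gen _ _ ⟨(.vert v, s, t), h⟩
    else if (s, t) ∈ Λ.cusp (.vert v) ∧ Λ.Present c s ∧ Λ.Present c t then
      idem _ _ (π (Λ.comp s))
    else 0

/-- The matrix of the generators of the 1-cell `k`; a zero block is inserted for each pair of sheets
that meet in a cusp edge above `k`. -/
def matB (k : Λ.K1) : Matrix S S (Λ.CellAlg π) :=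
  Matrix.of fun s t =>
    if h : Λ.Prec (.edge k) s t then gen _ _ ⟨(.edge k, s, t), h⟩ else 0

/-- The matrix of the generators of the 2-cell `f`. -/
def matC (f : Λ.K2) : Matrix S S (Λ.CellAlg π) :=
  Matrix.of fun s t =>
    if h : Λ.Prec (.face f) s t then gen _ _ ⟨(.face f, s, t), h⟩ else 0

/-- The product `(E + B_n)^{± 1} ⋯ (E + B_1)^{± 1}` along a sequence of 1-cells `1, …, n`. -/
noncomputable def holonomy : List (Λ.K1 × Bool) → Matrix S S (Λ.CellAlg π)
  | [] => 1
  | (k, true) :: l => holonomy l * (1 + Λ.matB π k)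
  | (k, false) :: l => holonomy l * Ring.inverse (1 + Λ.matB π k)

/-- The differential of the cellular dg algebra on generators:
`dA = A²`, `dB = A₊ (E + B) + (E + B) A₋`, and
`dC = A₊ C + C A₋ + (E + B_{n₊})^{±1} ⋯ (E + B_1)^{±1}
  + (E + B_{n₊ + n₋})^{±1} ⋯ (E + B_{n₊ + 1})^{±1}`. -/
noncomputable def cellDiff : Λ.CellGen → Λ.CellAlg π
  | ⟨(.vert v, s, t), _⟩ => (Λ.matA π v (.vert v) * Λ.matA π v (.vert v)) s t
  | ⟨(.edge k, s, t), _⟩ =>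
    (Λ.matA π (Λ.ter k) (.edge k) * (1 + Λ.matB π k) +
      (1 + Λ.matB π k) * Λ.matA π (Λ.ini k) (.edge k)) s t
  | ⟨(.face f, s, t), _⟩ =>
    (Λ.matA π (Λ.faceTer f) (.face f) * Λ.matC π f +
      Λ.matC π f * Λ.matA π (Λ.faceIni f) (.face f) +
      Λ.holonomy π (Λ.path₁ f) + Λ.holonomy π (Λ.path₂ f)) s t

/-- The cellular dg algebra.  For `π = id` it is the dg algebra over
`𝕜 = ⨁_{v ∈ Comp} (ZMod 2) e_v`; for a map `π` to a one-point set it is the dg algebra over `ZMod 2`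
that is freely generated by the same generators. -/
noncomputable def cellular : SemiFree V where
  Gen := Λ.CellGen
  src := Λ.cellSrc π
  tgt := Λ.cellTgt π
  deg := Λ.cellDeg
  diff := Λ.cellDiff π

end Matrices

end Front

/-! ## The link `Λ_{2,2,2}` -/

/-- The components of the link. -/
inductive Comp222 : Type
  | A | B | P | Q | R
  deriving DecidableEq

instance : Fintype Comp222 where
  elems := {.A, .B, .P, .Q, .R}
  complete X := by cases X <;> decide

/-- The front of each component consists of an upper sheet `(X, true)` and a lower sheet
`(X, false)`. -/
abbrev Sheet222 : Type := Comp222 × Bool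

/-- Upper sheet of a component. -/
abbrev U (X : Comp222) : Sheet222 := (X, true)

/-- Lower sheet of a component. -/
abbrev L (X : Comp222) : Sheet222 := (X, false)

/-- The 0-cells. -/
inductive K0 : Type
  | v1 | v2 | v3 | v4 | v5 | v6 | v7 | v8 | v9 | v10 | v11 | v12
  deriving DecidableEq

/-- The 1-cells; `e0` is the outer circle, above which lie only the cusp edges of three
components. -/
inductive K1 : Type
  | e0 | e1 | e2 | e3 | e4 | e5 | e6 | e7 | e8 | e9 | e10 | e11 | e12 | e13 | e14 | e15 | e16 | e17
  | e18 | e19 | e20 | e21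
  deriving DecidableEq

/-- The 2-cells. -/
inductive K2 : Type
  | f1 | f2 | f3 | f4 | f5 | f6 | f7 | f8 | f9 | f10 | f11
  deriving DecidableEq

open Comp222 K0 K1 K2

/-- The values of the Maslov potential. -/
def maslov222 : Sheet222 → ℤ
  | (.A, true) => -1
  | (.A, false) => -2
  | (.B, true) => 1
  | (.B, false) => 0
  | (.P, true) => 0
  | (.P, false) => -1
  | (.Q, true) => 0
  | (.Q, false) => -1
  | (.R, true) => 0
  | (.R, false) => -1

/-- The front above the annulus inside the outer circle. -/
def stackOuter : List (List Sheet222) := [[U B], [L B], [U R], [L R], [U A], [L A]]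

/-- The crossing of `Λ_A` and `Λ_R`. -/
def crossAR : List (List Sheet222) := [[U B], [L B], [U R], [L R, U A], [L A]]

/-- The front above the annulus between the crossings of `Λ_A`, `Λ_R` and of `Λ_B`, `Λ_R`. -/
def stackMiddle : List (List Sheet222) := [[U B], [L B], [U R], [U A], [L R], [L A]]

/-- The crossing of `Λ_B` and `Λ_R`. -/
def crossBR : List (List Sheet222) := [[U B], [L B, U R], [U A], [L R], [L A]]

/-- The front above the region that surrounds the two inner discs. -/
def stackInner : List (List Sheet222) := [[U B], [U R], [L B], [U A], [L R], [L A]]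

/-- The front just inside the cusp edge of `Λ_X`, with `X = P` or `X = Q`. -/
def stackX1 (X : Comp222) : List (List Sheet222) :=
  [[U B], [U R], [L B], [U X], [L X], [U A], [L R], [L A]]

/-- The crossing of `Λ_A` and `Λ_X`. -/
def crossAX (X : Comp222) : List (List Sheet222) :=
  [[U B], [U R], [L B], [U X], [L X, U A], [L R], [L A]]

/-- The front between the crossings of `Λ_A`, `Λ_X` and of `Λ_B`, `Λ_X`. -/
def stackX2 (X : Comp222) : List (List Sheet222) :=
  [[U B], [U R], [L B], [U X], [U A], [L X], [L R], [L A]]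

/-- The crossing of `Λ_B` and `Λ_X`. -/
def crossBX (X : Comp222) : List (List Sheet222) :=
  [[U B], [U R], [L B, U X], [U A], [L X], [L R], [L A]]

/-- The front between the crossings of `Λ_B`, `Λ_X` and of `Λ_A`, `Λ_B`. -/
def stackX3 (X : Comp222) : List (List Sheet222) :=
  [[U B], [U R], [U X], [L B], [U A], [L X], [L R], [L A]]

/-- The crossing of `Λ_A` and `Λ_B` near `Λ_X`. -/
def crossABX (X : Comp222) : List (List Sheet222) :=
  [[U B], [U R], [U X], [L B, U A], [L X], [L R], [L A]]

/-- The front above the innermost disc. -/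
def stackX4 (X : Comp222) : List (List Sheet222) :=
  [[U B], [U R], [U X], [U A], [L B], [L X], [L R], [L A]]

/-- The sheets above each cell, from top to bottom. -/
def stack222 : Cell K0 K1 K2 → List (List Sheet222)
  | .vert v1 => []
  | .vert v2 => crossAR
  | .vert v3 => crossBR
  | .vert v4 => stackInner
  | .vert v5 => crossAX P
  | .vert v6 => crossBX P
  | .vert v7 => crossABX P
  | .vert v8 => crossBR
  | .vert v9 => stackInner
  | .vert v10 => crossAX Q
  | .vert v11 => crossBX Q
  | .vert v12 => crossABX Q
  | .edge e0 => []
  | .edge e1 => crossABX P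
  | .edge e2 => stackOuter
  | .edge e3 => stackMiddle
  | .edge e4 => stackInner
  | .edge e5 => stackX1 P
  | .edge e6 => stackX2 P
  | .edge e7 => stackX3 P
  | .edge e8 => crossABX Q
  | .edge e9 => stackInner
  | .edge e10 => stackX1 Q
  | .edge e11 => stackX2 Q
  | .edge e12 => stackX3 Q
  | .edge e13 => crossBX P
  | .edge e14 => crossAX P
  | .edge e15 => stackInner
  | .edge e16 => crossBX Q
  | .edge e17 => crossAX Q
  | .edge e18 => stackInner
  | .edge e19 => crossBR
  | .edge e20 => crossBR
  | .edge e21 => crossAR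
  | .face f1 => stackOuter
  | .face f2 => stackMiddle
  | .face f3 => stackInner
  | .face f4 => stackX1 P
  | .face f5 => stackX2 P
  | .face f6 => stackX3 P
  | .face f7 => stackX4 P
  | .face f8 => stackX1 Q
  | .face f9 => stackX2 Q
  | .face f10 => stackX3 Q
  | .face f11 => stackX4 Q

/-- The cusp edges above each cell. -/
def cusp222 : Cell K0 K1 K2 → List (Sheet222 × Sheet222)
  | .vert v1 => [(U A, L A), (U B, L B), (U R, L R)]
  | .edge e0 => [(U A, L A), (U B, L B), (U R, L R)]
  | .vert v4 => [(U P, L P)]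
  | .edge e15 => [(U P, L P)]
  | .vert v9 => [(U Q, L Q)]
  | .edge e18 => [(U Q, L Q)]
  | _ => []

/-- Initial and terminal vertices of the 1-cells. -/
def ends222 : K1 → K0 × K0
  | e0 => (v1, v1)
  | e1 => (v7, v7)
  | e2 => (v1, v2)
  | e3 => (v2, v3)
  | e4 => (v3, v4)
  | e5 => (v4, v5)
  | e6 => (v5, v6)
  | e7 => (v6, v7)
  | e8 => (v12, v12)
  | e9 => (v8, v9)
  | e10 => (v9, v10)
  | e11 => (v10, v11)
  | e12 => (v11, v12)
  | e13 => (v6, v6)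
  | e14 => (v5, v5)
  | e15 => (v4, v4)
  | e16 => (v11, v11)
  | e17 => (v10, v10)
  | e18 => (v9, v9)
  | e19 => (v3, v8)
  | e20 => (v8, v3)
  | e21 => (v2, v2)

/-- Initial and terminal vertices of the boundaries of the 2-cells, and the two arcs between them.
All 2-cells other than `f3`, `f7`, `f11` are annuli that are cut open along a 1-cell. -/
def boundary222 : K2 → (K0 × K0) × List (K1 × Bool) × List (K1 × Bool)
  | f1 => ((v1, v2), [(e2, true), (e21, true)], [(e0, true), (e2, true)])
  | f2 => ((v2, v3), [(e3, true), (e19, true), (e20, true)], [(e21, true), (e3, true)])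
  | f3 => ((v4, v9), [(e15, true), (e4, false), (e19, true), (e9, true)],
      [(e4, false), (e20, false), (e9, true), (e18, true)])
  | f4 => ((v4, v5), [(e5, true), (e14, true)], [(e15, true), (e5, true)])
  | f5 => ((v5, v6), [(e6, true), (e13, true)], [(e14, true), (e6, true)])
  | f6 => ((v6, v7), [(e7, true), (e1, true)], [(e13, true), (e7, true)])
  | f7 => ((v7, v7), [(e1, true)], [])
  | f8 => ((v9, v10), [(e10, true), (e17, true)], [(e18, true), (e10, true)])
  | f9 => ((v10, v11), [(e11, true), (e16, true)], [(e17, true), (e11, true)])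
  | f10 => ((v11, v12), [(e12, true), (e8, true)], [(e16, true), (e12, true)])
  | f11 => ((v12, v12), [(e8, true)], [])

/-- The front of the Legendrian link `Λ_{2,2,2}` over its polygonal decomposition. -/
def front222 : Front Comp222 Sheet222 where
  K0 := K0
  K1 := K1
  K2 := K2
  comp := Prod.fst
  maslov := maslov222
  stack := stack222
  cusp := cusp222
  ini k := (ends222 k).1
  ter k := (ends222 k).2
  faceIni f := (boundary222 f).1.1
  faceTer f := (boundary222 f).1.2
  path₁ f := (boundary222 f).2.1
  path₂ f := (boundary222 f).2.2

set_option maxRecDepth 10000 in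
/-- The data above do describe a front over a polygonal decomposition. -/
theorem front222_isConsistent : front222.IsConsistent where
  nodup c := by rcases c with c | c | c <;> cases c <;> decide
  total f := by cases f <;> decide
  cusp_comp c := by rcases c with c | c | c <;> cases c <;> decide
  cusp_maslov c := by rcases c with c | c | c <;> cases c <;> decide
  cusp_absent c := by rcases c with c | c | c <;> cases c <;> decide
  path_one f := by cases f <;> simp [front222, boundary222, Front.IsPath, ends222]
  path_two f := by cases f <;> simp [front222, boundary222, Front.IsPath, ends222]
  fits_ini k := by cases k <;> decide
  fits_ter k := by cases k <;> decide
  fits_edge f := by cases f <;> decide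
  fits_faceIni f := by cases f <;> decide
  fits_faceTer f := by cases f <;> decide

/-- The `m`-th sheet from the top, `m = 1, 2, …`, above a cell on which the sheets are totally
ordered. -/
def nthSheet (c : Cell K0 K1 K2) (m : ℕ) : Sheet222 := (stack222 c).flatten.getD (m - 1) (U A)

section

variable {V : Type} [Fintype V] (π : Comp222 → V)

/-- The cellular dg algebra `𝒞(Λ_{2,2,2})`. -/
noncomputable def C222 : SemiFree V := front222.cellular π

/-- The generator `b^{m,n}` or `c^{m,n}` of `𝒞(Λ_{2,2,2})` for a pair of positions `m < n`. -/
noncomputable def cgen (c : Cell K0 K1 K2) (m n : ℕ)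
    (h : front222.Prec c (nthSheet c m) (nthSheet c n)) : (C222 π).Alg :=
  (C222 π).x ⟨(c, nthSheet c m, nthSheet c n), h⟩

end

/-! ## The explicit dg algebra -/

/-- The 21 generators; `s25` stands for `c_7^{2,5} + c_11^{2,5}`, and so on. -/
inductive Gen21 : Type
  | b2 | b3 | b5 | b6 | b7 | b10 | b11 | b12
  | c7_45 | c11_45 | c7_35 | c11_35 | s25 | c7_46 | c11_46 | s47
  | s48 | s15 | c7_36 | c11_36 | s27
  deriving DecidableEq

namespace Gen21

/-- The components of the link at which a generator starts and ends. -/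
def ends : Gen21 → Comp222 × Comp222
  | b2 => (R, A)
  | b3 => (B, R)
  | b5 => (P, A)
  | b6 => (B, P)
  | b7 => (B, A)
  | b10 => (Q, A)
  | b11 => (B, Q)
  | b12 => (B, A)
  | c7_45 => (A, B)
  | c11_45 => (A, B)
  | c7_35 => (P, B)
  | c11_35 => (Q, B)
  | s25 => (R, B)
  | c7_46 => (A, P)
  | c11_46 => (A, Q)
  | s47 => (A, R)
  | s48 => (A, A)
  | s15 => (B, B)
  | c7_36 => (P, P)
  | c11_36 => (Q, Q)
  | s27 => (R, R)

/-- The degrees. -/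
def degree : Gen21 → ℤ
  | b2 | b3 | b5 | b6 | c7_45 | b10 | b11 | c11_45 => 0
  | b7 | b12 | c7_35 | c11_35 | s25 | c7_46 | c11_46 | s47 => -1
  | s48 | s15 | c7_36 | c11_36 | s27 => -2

/-- The differentials, in terms of the images `x g` of the generators in any algebra. -/
def differential {T : Type} [Ring T] (x : Gen21 → T) : Gen21 → T
  | b2 | b3 | b5 | b6 | c7_45 | b10 | b11 | c11_45 => 0
  | b7 => x b6 * x b5 + x b3 * x b2
  | b12 => x b11 * x b10 + x b3 * x b2
  | c7_35 => x b5 * x c7_45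
  | c11_35 => x b10 * x c11_45
  | s25 => x b2 * x c11_45 + x b2 * x c7_45
  | c7_46 => x c7_45 * x b6
  | c11_46 => x c11_45 * x b11
  | s47 => x c11_45 * x b3 + x c7_45 * x b3
  | s48 => x c11_45 * x b12 + x c7_45 * x b7 + x c7_46 * x b5 + x c11_46 * x b10 + x s47 * x b2
  | s15 => x b6 * x c7_35 + x b11 * x c11_35 + x b3 * x s25 + x b12 * x c11_45 + x b7 * x c7_45
  | c7_36 => x b5 * x c7_46 + x c7_35 * x b6
  | c11_36 => x b10 * x c11_46 + x c11_35 * x b11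
  | s27 => x b2 * x s47 + x s25 * x b3

end Gen21

/-- The explicit dg algebra `𝒞'(Λ_{2,2,2})`. -/
noncomputable def C222' {V : Type} [Fintype V] (π : Comp222 → V) : SemiFree V where
  Gen := Gen21
  src g := π g.ends.1
  tgt g := π g.ends.2
  deg := Gen21.degree
  diff := Gen21.differential (gen _ _)

end CellDGA

namespace CellDGA

/-! ## Homomorphisms out of path algebras -/

section PathAlg

variable {V G : Type} [Fintype V] {src tgt : G → V}

/-! The small dg algebra arises by cancelling generators in pairs `hi`, `lo` with `d hi = lo +
(lower terms)`.

The general principle is `Cancellation`. Suppose that both members of a pair have the same rank and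
that the differentials are triangular for the rank. Let `φ : A → B` kill all `hi` and all `d hi` and
identify the remaining generators with those of `B`, so that `φ (d k) = d k` on these. Then `A` is
tame isomorphic to `B` stabilized once for each pair, by a map `F` with `F hi = hi`, `F (d hi) = lo`
and `F k = k + H (F (d k))`, where `H` is the contracting homotopy of the stabilization onto `B`.
These equations are a recursion on the rank, so `F` is triangular and hence tame. Since `φ` is `F`
followed by the projection, it is a quasi-isomorphism (`Cancellation.exists_iso`,
`Cancellation.isQuasiIso`), and `B` inherits the dg structure (`Cancellation.isSemiFreeDG`).

That `𝒞(Λ)` is itself a dg algebra follows from matrix identities. One has `dA = A²`, and the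
holonomy `H` along a path satisfies `dH = A₊ H + H A₋` (`matD_cellHolonomy`). All terms of `d²` then
cancel in pairs modulo 2.

There are two rounds of cancellation. First a spanning tree of the 1-skeleton is used: the
generators of each vertex cancel with generators of the tree edge joining it to the rest. Of the
tree edges there remain the eight generators `b` of sheets that are about to cross. In the second
round the generators of the circles cancel with those of the 2-cells on either side. For each pair
of sheets this leaves one 2-cell, or one for each of `Λ_P` and `Λ_Q` in the case of `A⁺`, `B⁻`.
There the entries `e_v` coming from cusps cancel further generators against each other. Thirteen
generators `c` survive.

Both rounds are verified by finite computation with noncommutative polynomials, stored as lists of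
words (`treeMatching_spec`, `circleMatching_spec`). The values of `φ` on the generators `lo` are
given by tables, and substitution shows that `φ (d hi) = 0` and that `φ (d k)` is as asserted.
Idempotents occur as letters indexed by components of the link, not by elements of `V`, so that one
computation serves every map `π`. -/

theorem PathAlg.algHom_ext {B : Type*} [Semiring B] [Algebra (ZMod 2) B]
    {f g : PathAlg src tgt →ₐ[ZMod 2] B}
    (he : ∀ v, f (idem src tgt v) = g (idem src tgt v))
    (hx : ∀ x, f (gen src tgt x) = g (gen src tgt x)) : f = g := by
  apply RingQuot.ringQuot_ext'
  apply FreeAlgebra.hom_ext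
  funext x
  rcases x with v | x
  · exact he v
  · exact hx x

theorem PathAlg.adjoin_eq_top :
    Algebra.adjoin (ZMod 2) (Set.range (idem src tgt) ∪ Set.range (gen src tgt)) = ⊤ := by
  rw [eq_top_iff]
  rintro a -
  obtain ⟨a, rfl⟩ := RingQuot.mkAlgHom_surjective (ZMod 2) (PathRel src tgt) a
  induction a using FreeAlgebra.induction with
  | grade0 r => rw [AlgHom.commutes]; exact Subalgebra.algebraMap_mem _ r
  | grade1 x =>
    apply Algebra.subset_adjoin
    rcases x with v | x
    · exact Or.inl ⟨v, rfl⟩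
    · exact Or.inr ⟨x, rfl⟩
  | mul a b ha hb => rw [map_mul]; exact mul_mem ha hb
  | add a b ha hb => rw [map_add]; exact add_mem ha hb

section lift

variable {B : Type} [Ring B] [Algebra (ZMod 2) B] (ε : V → B) (ξ : G → B)
    (h1 : ∀ v, ε v * ε v = ε v) (h2 : ∀ v w, v ≠ w → ε v * ε w = 0) (h3 : ∑ v, ε v = 1)
    (h4 : ∀ g, ε (src g) * ξ g = ξ g) (h5 : ∀ g, ξ g * ε (tgt g) = ξ g)

@[simp]
theorem lift_idem (v : V) : lift src tgt ε ξ h1 h2 h3 h4 h5 (idem src tgt v) = ε v := by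
  simp [lift, idem]

@[simp]
theorem lift_gen (g : G) : lift src tgt ε ξ h1 h2 h3 h4 h5 (gen src tgt g) = ξ g := by
  simp [lift, gen]

end lift

/-- Twisted derivations with prescribed values on the generators. -/
theorem PathAlg.exists_twisted_derivation {B : Type} [Ring B] [Algebra (ZMod 2) B]
    (p q : PathAlg src tgt →ₐ[ZMod 2] B) (h : G → B)
    (hl : ∀ g, p (idem src tgt (src g)) * h g = h g)
    (hr : ∀ g, h g * q (idem src tgt (tgt g)) = h g) :
    ∃ H : PathAlg src tgt →ₗ[ZMod 2] B, (∀ v, H (idem src tgt v) = 0) ∧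
      (∀ g, H (gen src tgt g) = h g) ∧ ∀ a b, H (a * b) = H a * q b + p a * H b := by
  -- For an algebra homomorphism into upper triangular matrices with diagonal `p`, `q`, the corner
  -- entry is a twisted derivation. The universal property of the path algebra therefore produces
  -- `H`.
  let M : PathAlg src tgt →ₐ[ZMod 2] Matrix (Fin 2) (Fin 2) B :=
    lift src tgt (fun v => !![p (idem src tgt v), 0; 0, q (idem src tgt v)])
      (fun g => !![p (gen src tgt g), h g; 0, q (gen src tgt g)])
      (fun v => by simp [← map_mul, idem_mul_self])
      (fun v w hvw => by
        simp only [Matrix.mul_fin_two, ← map_mul, idem_mul_ne _ _ hvw]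
        ext i j; fin_cases i <;> fin_cases j <;> simp)
      (by
        ext i j
        rw [Matrix.sum_apply]
        fin_cases i <;> fin_cases j <;> simp [← map_sum, sum_idem])
      (fun g => by simp [← map_mul, idem_mul_gen, hl])
      (fun g => by simp [← map_mul, gen_mul_idem, hr])
  have hM : ∀ a ∈ Algebra.adjoin (ZMod 2) (Set.range (idem src tgt) ∪ Set.range (gen src tgt)),
      M a 0 0 = p a ∧ M a 1 1 = q a ∧ M a 1 0 = 0 := by
    intro a ha
    induction ha using Algebra.adjoin_induction with
    | mem a ha =>
      rcases ha with ⟨v, rfl⟩ | ⟨g, rfl⟩ <;> simp [M]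
    | algebraMap r =>
      simp only [AlgHom.commutes]
      simp [Matrix.algebraMap_matrix_apply]
    | add a b _ _ ha hb => simp [ha, hb]
    | mul a b _ _ ha hb => simp [Matrix.mul_apply, Fin.sum_univ_two, ha, hb]
  have hM' := fun a => hM a (by rw [PathAlg.adjoin_eq_top]; trivial)
  refine ⟨{ toFun := fun a => M a 0 1, map_add' := by simp, map_smul' := by simp }, ?_, ?_, ?_⟩
  · intro v; simp [M]
  · intro g; simp [M]
  · intro a b
    change M (a * b) 0 1 = M a 0 1 * q b + p a * M b 0 1
    rw [map_mul, Matrix.mul_apply, Fin.sum_univ_two, (hM' a).1, (hM' b).2.1]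
    exact add_comm _ _

end PathAlg

namespace SemiFree

variable {V : Type} [Fintype V] (A B : SemiFree V)

/-! ## The differential -/

/-- This turns the multiplicativity of `dualHom` into the Leibniz rule for its second component. -/
theorem fst_dualHom (a : A.Alg) : (A.dualHom a).fst = a := by
  have : (TrivSqZeroExt.fstHom (ZMod 2) A.Alg A.Alg).comp A.dualHom = AlgHom.id _ _ := by
    apply PathAlg.algHom_ext
    · intro v; simp [dualHom]
    · intro g; simp [dualHom]
  exact congrArg (fun f => f a) this

theorem d_mul (a b : A.Alg) : A.d (a * b) = A.d a * b + a * A.d b := by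
  change (A.dualHom (a * b)).snd = (A.dualHom a).snd * b + a * (A.dualHom b).snd
  rw [map_mul, TrivSqZeroExt.snd_mul, fst_dualHom, fst_dualHom, add_comm]
  rfl

@[simp]
theorem d_e (v : V) : A.d (A.e v) = 0 := by
  change (A.dualHom _).snd = 0
  simp [dualHom]

@[simp]
theorem d_one : A.d 1 = 0 := by
  change (A.dualHom _).snd = 0
  simp

theorem d_x' (g : A.Gen) : A.d (A.x g) = A.e (A.src g) * A.diff g * A.e (A.tgt g) := by
  change (A.dualHom _).snd = _
  simp [dualHom]

/-- Elements of `e_v · A · e_w`. -/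
def corner (v w : V) : Submodule (ZMod 2) A.Alg where
  carrier := {a | A.e v * a * A.e w = a}
  add_mem' {a b} ha hb := by
    simp only [Set.mem_ofPred_eq] at *
    rw [mul_add, add_mul, ha, hb]
  zero_mem' := by simp
  smul_mem' c a ha := by
    simp only [Set.mem_ofPred_eq] at *
    rw [mul_smul_comm, smul_mul_assoc, ha]

variable {A B}

theorem mem_corner {v w : V} {a : A.Alg} : a ∈ A.corner v w ↔ A.e v * a * A.e w = a := Iff.rfl

theorem e_mul_of_mem_corner {v w : V} {a : A.Alg} (h : a ∈ A.corner v w) : A.e v * a = a := by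
  rw [mem_corner] at h
  rw [← h, ← mul_assoc, ← mul_assoc, idem_mul_self]

theorem mul_e_of_mem_corner {v w : V} {a : A.Alg} (h : a ∈ A.corner v w) : a * A.e w = a := by
  rw [mem_corner] at h
  rw [← h, mul_assoc, idem_mul_self]

theorem mem_corner_of {v w : V} {a : A.Alg} (h : A.e v * a = a) (h' : a * A.e w = a) :
    a ∈ A.corner v w := by
  rw [mem_corner, h, h']

theorem mul_mem_corner {u v w : V} {a b : A.Alg} (ha : a ∈ A.corner u v) (hb : b ∈ A.corner v w) :
    a * b ∈ A.corner u w :=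
  mem_corner_of (by rw [← mul_assoc, e_mul_of_mem_corner ha])
    (by rw [mul_assoc, mul_e_of_mem_corner hb])

theorem e_mem_corner (v : V) : A.e v ∈ A.corner v v :=
  mem_corner_of (idem_mul_self _ _ v) (idem_mul_self _ _ v)

theorem x_mem_corner (g : A.Gen) : A.x g ∈ A.corner (A.src g) (A.tgt g) :=
  mem_corner_of (idem_mul_gen _ _ g) (gen_mul_idem _ _ g)

theorem map_mem_corner (f : A.Alg →ₐ[ZMod 2] B.Alg) (hf : ∀ v, f (A.e v) = B.e v) {v w : V}
    {a : A.Alg} (h : a ∈ A.corner v w) : f a ∈ B.corner v w := by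
  rw [mem_corner] at *
  rw [← hf, ← hf, ← map_mul, ← map_mul, h]

theorem d_x {g : A.Gen} (h : A.diff g ∈ A.corner (A.src g) (A.tgt g)) :
    A.d (A.x g) = A.diff g := by
  rw [d_x']; exact h

/-- The homomorphism over `𝕜` with given values on generators. -/
theorem exists_algHom (ξ : A.Gen → B.Alg) (hξ : ∀ g, ξ g ∈ B.corner (A.src g) (A.tgt g)) :
    ∃ F : A.Alg →ₐ[ZMod 2] B.Alg, (∀ v, F (A.e v) = B.e v) ∧ ∀ g, F (A.x g) = ξ g :=
  ⟨lift A.src A.tgt (fun v => B.e v) ξ (idem_mul_self _ _) (fun _ _ h => idem_mul_ne _ _ h)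
    (sum_idem _ _) (fun g => e_mul_of_mem_corner (hξ g)) (fun g => mul_e_of_mem_corner (hξ g)),
    fun _ => lift_idem .., fun _ => lift_gen ..⟩

/-! ## Subalgebras generated by generators -/

theorem e_mem_subalg (T : Set A.Gen) (v : V) : A.e v ∈ A.subalg T :=
  Algebra.subset_adjoin (Or.inl ⟨v, rfl⟩)

theorem x_mem_subalg {T : Set A.Gen} {g : A.Gen} (h : g ∈ T) : A.x g ∈ A.subalg T :=
  Algebra.subset_adjoin (Or.inr ⟨g, h, rfl⟩)

theorem subalg_mono {T T' : Set A.Gen} (h : T ⊆ T') : A.subalg T ≤ A.subalg T' :=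
  Algebra.adjoin_mono (Set.union_subset_union_right _ (Set.image_mono h))

theorem mem_subalg_univ (a : A.Alg) : a ∈ A.subalg Set.univ := by
  rw [subalg, Set.image_univ, PathAlg.adjoin_eq_top]; trivial

theorem map_mem_of_subalg {R : Type*} [Semiring R] [Algebra (ZMod 2) R] {T : Set A.Gen}
    (f : A.Alg →ₐ[ZMod 2] R) (N : Subalgebra (ZMod 2) R) (he : ∀ v, f (A.e v) ∈ N)
    (hx : ∀ g ∈ T, f (A.x g) ∈ N) {a : A.Alg} (ha : a ∈ A.subalg T) : f a ∈ N := by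
  have : A.subalg T ≤ N.comap f := by
    rw [subalg, Algebra.adjoin_le_iff]
    rintro _ (⟨v, rfl⟩ | ⟨g, hg, rfl⟩)
    · exact he v
    · exact hx g hg
  exact this ha

theorem eqOn_subalg {R : Type*} [Semiring R] [Algebra (ZMod 2) R] {T : Set A.Gen}
    (f g : A.Alg →ₐ[ZMod 2] R) (he : ∀ v, f (A.e v) = g (A.e v))
    (hx : ∀ x ∈ T, f (A.x x) = g (A.x x)) {a : A.Alg} (ha : a ∈ A.subalg T) : f a = g a := by
  have : A.subalg T ≤ AlgHom.equalizer f g := by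
    rw [subalg, Algebra.adjoin_le_iff]
    rintro _ (⟨v, rfl⟩ | ⟨y, hy, rfl⟩)
    · exact he v
    · exact hx y hy
  exact this ha

/-- Induction over the elements of a subalgebra. -/
theorem subalg_induction {T : Set A.Gen} {P : A.Alg → Prop} (one : P 1) (e : ∀ v, P (A.e v))
    (x : ∀ g ∈ T, P (A.x g)) (add : ∀ a ∈ A.subalg T, ∀ b ∈ A.subalg T, P a → P b → P (a + b))
    (mul : ∀ a ∈ A.subalg T, ∀ b ∈ A.subalg T, P a → P b → P (a * b)) {a : A.Alg}
    (ha : a ∈ A.subalg T) : P a := by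
  -- Zero needs no separate hypothesis because `1 + 1 = 0`.
  have h0 : P 0 := by
    simpa [ZModModule.add_self] using add 1 (one_mem _) 1 (one_mem _) one one
  rw [subalg] at ha
  induction ha using Algebra.adjoin_induction with
  | mem a ha =>
    rcases ha with ⟨v, rfl⟩ | ⟨g, hg, rfl⟩
    · exact e v
    · exact x g hg
  | algebraMap r =>
    fin_cases r
    · exact (map_zero (algebraMap (ZMod 2) A.Alg)).symm ▸ h0
    · exact (map_one (algebraMap (ZMod 2) A.Alg)).symm ▸ one
  | add a b ha hb h h' => exact add a ha b hb h h'
  | mul a b ha hb h h' => exact mul a ha b hb h h'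

/-- Two maps which commute with the differentials on generators do so on the subalgebra. -/
theorem map_d_of_subalg {T : Set A.Gen} (f : A.Alg →ₐ[ZMod 2] B.Alg) (he : ∀ v, f (A.e v) = B.e v)
    (hx : ∀ g ∈ T, f (A.d (A.x g)) = B.d (f (A.x g))) {a : A.Alg} (ha : a ∈ A.subalg T) :
    f (A.d a) = B.d (f a) := by
  refine subalg_induction (P := fun a => f (A.d a) = B.d (f a)) (by simp) (fun v => ?_) hx
    (fun a _ b _ h h' => ?_) (fun a _ b _ h h' => ?_) ha
  · rw [d_e, he, d_e, map_zero]
  · rw [map_add, map_add, map_add, map_add, h, h']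
  · rw [d_mul, map_add, map_mul, map_mul, map_mul, d_mul, h, h']

/-- The term `d a * d b` occurs twice in `d (d (a * b))`, so `d² = 0` passes to products in
characteristic 2. -/
theorem d_d_of_gen (h : ∀ g, A.d (A.d (A.x g)) = 0) (a : A.Alg) : A.d (A.d a) = 0 := by
  refine subalg_induction (P := fun a => A.d (A.d a) = 0) (by simp) (by simp) (fun g _ => h g)
    (fun a _ b _ h h' => ?_) (fun a _ b _ h h' => ?_) (mem_subalg_univ a)
  · rw [map_add, map_add, h, h', add_zero]
  · rw [d_mul, map_add, d_mul, d_mul, h, h', zero_mul, mul_zero, zero_add, add_zero,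
      ZModModule.add_self]

/-! ## The grading -/

/-- The words that span `degreePart` carry an idempotent only on the left. In a product of two of
them, the one in the middle is absorbed or kills the product. -/
theorem word_mul_e (l : List A.Gen) (v w : V) :
    A.e v * (l.map A.x).prod * A.e w = A.e v * (l.map A.x).prod ∨
      A.e v * (l.map A.x).prod * A.e w = 0 := by
  induction l generalizing v with
  | nil =>
    by_cases h : v = w
    · subst h; left; simp [idem_mul_self]
    · right; simp [idem_mul_ne _ _ h]
  | cons g l ih =>
    have : (((g :: l).map A.x).prod : A.Alg) = A.x g * (A.e (A.tgt g) * (l.map A.x).prod) := by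
      rw [← mul_assoc, gen_mul_idem]; simp
    rw [this, mul_assoc, mul_assoc]
    rcases ih (A.tgt g) with h | h
    · left; rw [h]
    · right; rw [h]; simp

theorem word_mem_degreePart (v : V) (l : List A.Gen) :
    A.e v * (l.map A.x).prod ∈ A.degreePart (l.map A.deg).sum :=
  Submodule.subset_span ⟨v, l, rfl, rfl⟩

theorem e_mem_degreePart (v : V) : A.e v ∈ A.degreePart 0 := by
  simpa using word_mem_degreePart (A := A) v []

theorem x_mem_degreePart (g : A.Gen) : A.x g ∈ A.degreePart (A.deg g) := by
  simpa [idem_mul_gen] using word_mem_degreePart (A := A) (A.src g) [g]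

theorem one_mem_degreePart : (1 : A.Alg) ∈ A.degreePart 0 := by
  rw [← sum_idem A.src A.tgt]
  exact Submodule.sum_mem _ fun v _ => e_mem_degreePart v

theorem mul_mem_degreePart {m n : ℤ} {a b : A.Alg} (ha : a ∈ A.degreePart m)
    (hb : b ∈ A.degreePart n) : a * b ∈ A.degreePart (m + n) := by
  induction ha using Submodule.span_induction with
  | zero => simp
  | add a a' _ _ h h' => rw [add_mul]; exact add_mem h h'
  | smul c a _ h => rw [smul_mul_assoc]; exact Submodule.smul_mem _ _ h
  | mem a ha =>
    obtain ⟨v, l, rfl, rfl⟩ := ha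
    induction hb using Submodule.span_induction with
    | zero => simp
    | add a a' _ _ h h' => rw [mul_add]; exact add_mem h h'
    | smul c a _ h => rw [mul_smul_comm]; exact Submodule.smul_mem _ _ h
    | mem b hb =>
      obtain ⟨w, l', rfl, rfl⟩ := hb
      rw [← mul_assoc]
      rcases word_mul_e l v w with h | h
      · rw [h, mul_assoc, ← List.prod_append, ← List.map_append, ← List.sum_append,
          ← List.map_append]
        exact word_mem_degreePart v _
      · rw [h]; simp

theorem map_mem_degreePart (f : A.Alg →ₐ[ZMod 2] B.Alg) (he : ∀ v, f (A.e v) = B.e v)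
    (hx : ∀ g, f (A.x g) ∈ B.degreePart (A.deg g)) {n : ℤ} {a : A.Alg} (ha : a ∈ A.degreePart n) :
    f a ∈ B.degreePart n := by
  induction ha using Submodule.span_induction with
  | zero => simp
  | add a a' _ _ h h' => rw [map_add]; exact add_mem h h'
  | smul c a _ h => rw [map_smul]; exact Submodule.smul_mem _ _ h
  | mem a ha =>
    obtain ⟨v, l, rfl, rfl⟩ := ha
    rw [map_mul, he]
    have : f (l.map A.x).prod ∈ B.degreePart (l.map A.deg).sum := by
      induction l with
      | nil => simpa using one_mem_degreePart
      | cons g l ih =>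
        simp only [List.map_cons, List.prod_cons, List.sum_cons, map_mul]
        exact mul_mem_degreePart (hx g) ih
    simpa using mul_mem_degreePart (e_mem_degreePart v) this

/-- A twisted derivation which changes the degree of generators by `c` changes the degree
by `c`. -/
theorem twisted_mem_degreePart (p q : A.Alg →ₐ[ZMod 2] B.Alg) (H : A.Alg →ₗ[ZMod 2] B.Alg) (c : ℤ)
    (hp : ∀ n, ∀ a ∈ A.degreePart n, p a ∈ B.degreePart n)
    (hq : ∀ n, ∀ a ∈ A.degreePart n, q a ∈ B.degreePart n)
    (he : ∀ v, H (A.e v) = 0) (hx : ∀ g, H (A.x g) ∈ B.degreePart (A.deg g + c))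
    (hmul : ∀ a b, H (a * b) = H a * q b + p a * H b) {n : ℤ} {a : A.Alg}
    (ha : a ∈ A.degreePart n) : H a ∈ B.degreePart (n + c) := by
  have h1 : H 1 = 0 := by
    rw [← sum_idem A.src A.tgt, map_sum]
    exact Finset.sum_eq_zero fun v _ => he v
  have hw : ∀ l : List A.Gen, (l.map A.x).prod ∈ A.degreePart (l.map A.deg).sum := by
    intro l
    induction l with
    | nil => simpa using one_mem_degreePart
    | cons g l ih => simpa using mul_mem_degreePart (x_mem_degreePart g) ih
  induction ha using Submodule.span_induction with
  | zero => simp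
  | add a a' _ _ h h' => rw [map_add]; exact add_mem h h'
  | smul c a _ h => rw [map_smul]; exact Submodule.smul_mem _ _ h
  | mem a ha =>
    obtain ⟨v, l, rfl, rfl⟩ := ha
    rw [hmul, he, zero_mul, zero_add]
    have : H (l.map A.x).prod ∈ B.degreePart ((l.map A.deg).sum + c) := by
      induction l with
      | nil => simp [h1]
      | cons g l ih =>
        simp only [List.map_cons, List.prod_cons, List.sum_cons, hmul]
        apply add_mem
        · have := mul_mem_degreePart (hx g) (hq _ _ (hw l))
          rwa [add_right_comm] at this
        · have := mul_mem_degreePart (hp _ _ (x_mem_degreePart g)) ih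
          rwa [← add_assoc] at this
    simpa using mul_mem_degreePart (hp _ _ (e_mem_degreePart v)) this

end SemiFree

end CellDGA

namespace CellDGA

namespace SemiFree

variable {V : Type} [Fintype V]

/-! ## Stabilizations -/

section Stabilize

variable (A : SemiFree V) (I : Type) (p q : I → V) (i : I → ℤ)

/-- The generators of a stabilization that come from the dg algebra. -/
def stabOld {A : SemiFree V} {I : Type} {p q : I → V} {i : I → ℤ} (g : A.Gen) :
    (A.stabilize I p q i).Gen := Sum.inl g

/-- The new generators of a stabilization whose differential is a generator. -/
def stabHi {A : SemiFree V} {I : Type} {p q : I → V} {i : I → ℤ} (j : I) :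
    (A.stabilize I p q i).Gen := Sum.inr (Sum.inl j)

/-- The new generators of a stabilization whose differential vanishes. -/
def stabLo {A : SemiFree V} {I : Type} {p q : I → V} {i : I → ℤ} (j : I) :
    (A.stabilize I p q i).Gen := Sum.inr (Sum.inr j)

theorem stab_cases {A : SemiFree V} {I : Type} {p q : I → V} {i : I → ℤ}
    {P : (A.stabilize I p q i).Gen → Prop} (old : ∀ g, P (stabOld g)) (hi : ∀ j, P (stabHi j))
    (lo : ∀ j, P (stabLo j)) : ∀ g, P g
  | Sum.inl g => old g
  | Sum.inr (Sum.inl j) => hi j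
  | Sum.inr (Sum.inr j) => lo j

/-- The inclusion of a dg algebra into its stabilization. -/
noncomputable def stabInc : A.Alg →ₐ[ZMod 2] (A.stabilize I p q i).Alg :=
  lift A.src A.tgt (fun v => idem _ _ v) (fun h => gen _ _ (Sum.inl h))
      (idem_mul_self _ _) (fun _ _ h => idem_mul_ne _ _ h) (sum_idem _ _)
      (fun h => idem_mul_gen (Sum.elim A.src (Sum.elim p p)) _ (Sum.inl h))
      (fun h => gen_mul_idem _ (Sum.elim A.tgt (Sum.elim q q)) (Sum.inl h))

/-- The projection of a stabilization. -/
noncomputable def stabProj : (A.stabilize I p q i).Alg →ₐ[ZMod 2] A.Alg :=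
  lift _ _ (fun v => A.e v) (Sum.elim A.x (fun _ => 0))
      (idem_mul_self _ _) (fun _ _ h => idem_mul_ne _ _ h) (sum_idem _ _)
      (by rintro (g | j)
          · exact idem_mul_gen _ _ _
          · simp)
      (by rintro (g | j)
          · exact gen_mul_idem _ _ _
          · simp)

variable {A I p q i}

@[simp] theorem stabInc_e (v : V) : A.stabInc I p q i (A.e v) = (A.stabilize I p q i).e v :=
  lift_idem ..

@[simp] theorem stabInc_x (g : A.Gen) :
    A.stabInc I p q i (A.x g) = (A.stabilize I p q i).x (stabOld g) := lift_gen ..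

@[simp] theorem stabProj_e (v : V) : A.stabProj I p q i ((A.stabilize I p q i).e v) = A.e v :=
  lift_idem ..

@[simp] theorem stabProj_old (g : A.Gen) :
    A.stabProj I p q i ((A.stabilize I p q i).x (stabOld g)) = A.x g := lift_gen ..

@[simp] theorem stabProj_hi (j : I) :
    A.stabProj I p q i ((A.stabilize I p q i).x (stabHi j)) = 0 := lift_gen ..

@[simp] theorem stabProj_lo (j : I) :
    A.stabProj I p q i ((A.stabilize I p q i).x (stabLo j)) = 0 := lift_gen ..

theorem stab_diff_old (g : A.Gen) :
    (A.stabilize I p q i).diff (stabOld g) = A.stabInc I p q i (A.diff g) := rfl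

theorem stab_diff_hi (j : I) :
    (A.stabilize I p q i).diff (stabHi j) = (A.stabilize I p q i).x (stabLo j) := rfl

theorem stab_diff_lo (j : I) : (A.stabilize I p q i).diff (stabLo j) = 0 := rfl

theorem stabProj_stabInc (a : A.Alg) : A.stabProj I p q i (A.stabInc I p q i a) = a := by
  have : (A.stabProj I p q i).comp (A.stabInc I p q i) = AlgHom.id _ _ :=
    PathAlg.algHom_ext (fun v => by
        change A.stabProj I p q i (A.stabInc I p q i (A.e v)) = A.e v
        rw [stabInc_e, stabProj_e])
      (fun g => by
        change A.stabProj I p q i (A.stabInc I p q i (A.x g)) = A.x g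
        rw [stabInc_x, stabProj_old])
  exact congrArg (fun f => f a) this

theorem stabInc_mem_degreePart {n : ℤ} {a : A.Alg} (ha : a ∈ A.degreePart n) :
    A.stabInc I p q i a ∈ (A.stabilize I p q i).degreePart n :=
  map_mem_degreePart _ stabInc_e (fun g => by
    rw [stabInc_x]; exact x_mem_degreePart (A := A.stabilize I p q i) (stabOld g)) ha

theorem stabProj_mem_degreePart {n : ℤ} {a : (A.stabilize I p q i).Alg}
    (ha : a ∈ (A.stabilize I p q i).degreePart n) : A.stabProj I p q i a ∈ A.degreePart n := by
  refine map_mem_degreePart _ stabProj_e ?_ ha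
  apply stab_cases <;> intro g
  · rw [stabProj_old]; exact x_mem_degreePart g
  · rw [stabProj_hi]; exact zero_mem _
  · rw [stabProj_lo]; exact zero_mem _

theorem stabilize_bimodule (h : ∀ g, A.diff g ∈ A.corner (A.src g) (A.tgt g))
    (g : (A.stabilize I p q i).Gen) : (A.stabilize I p q i).diff g ∈
      (A.stabilize I p q i).corner ((A.stabilize I p q i).src g) ((A.stabilize I p q i).tgt g) := by
  revert g
  apply stab_cases <;> intro g
  · exact map_mem_corner (A.stabInc I p q i) stabInc_e (h g)
  · exact x_mem_corner (A := A.stabilize I p q i) (stabLo g)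
  · exact zero_mem _

theorem stabInc_d (h : ∀ g, A.diff g ∈ A.corner (A.src g) (A.tgt g)) (a : A.Alg) :
    A.stabInc I p q i (A.d a) = (A.stabilize I p q i).d (A.stabInc I p q i a) := by
  refine map_d_of_subalg _ stabInc_e (fun g _ => ?_) (mem_subalg_univ a)
  rw [stabInc_x, d_x (h g), d_x (stabilize_bimodule h (stabOld g)), stab_diff_old]

theorem stabProj_d (h : ∀ g, A.diff g ∈ A.corner (A.src g) (A.tgt g))
    (a : (A.stabilize I p q i).Alg) :
    A.stabProj I p q i ((A.stabilize I p q i).d a) = A.d (A.stabProj I p q i a) := by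
  refine map_d_of_subalg _ stabProj_e (fun g _ => ?_) (mem_subalg_univ a)
  rw [d_x (stabilize_bimodule h g)]
  revert g
  apply stab_cases <;> intro g _
  · rw [stabProj_old, d_x (h g), stab_diff_old, stabProj_stabInc]
  · rw [stabProj_hi, map_zero, stab_diff_hi, stabProj_lo]
  · rw [stabProj_lo, map_zero, stab_diff_lo, map_zero]

theorem stabilize_square (hb : ∀ g, A.diff g ∈ A.corner (A.src g) (A.tgt g))
    (h : ∀ a, A.d (A.d a) = 0) (a : (A.stabilize I p q i).Alg) :
    (A.stabilize I p q i).d ((A.stabilize I p q i).d a) = 0 := by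
  refine d_d_of_gen (fun g => ?_) a
  rw [d_x (stabilize_bimodule hb g)]
  revert g
  apply stab_cases <;> intro g
  · rw [stab_diff_old, ← stabInc_d hb, ← d_x (hb g), h, map_zero]
  · rw [stab_diff_hi, d_x (stabilize_bimodule hb _), stab_diff_lo]
  · rw [stab_diff_lo, map_zero]

theorem stabilize_degree (h : ∀ g, A.diff g ∈ A.degreePart (A.deg g + 1))
    (g : (A.stabilize I p q i).Gen) : (A.stabilize I p q i).diff g ∈
      (A.stabilize I p q i).degreePart ((A.stabilize I p q i).deg g + 1) := by
  revert g
  apply stab_cases <;> intro g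
  · exact stabInc_mem_degreePart (h g)
  · exact x_mem_degreePart (A := A.stabilize I p q i) (stabLo g)
  · exact zero_mem _

variable (A I p q i) in
/-- The contraction of a stabilization onto the dg algebra. -/
theorem exists_stab_homotopy : ∃ H : (A.stabilize I p q i).Alg →ₗ[ZMod 2] (A.stabilize I p q i).Alg,
    (∀ v, H ((A.stabilize I p q i).e v) = 0) ∧
    (∀ g, H ((A.stabilize I p q i).x (stabOld g)) = 0) ∧
    (∀ j, H ((A.stabilize I p q i).x (stabHi j)) = 0) ∧
    (∀ j, H ((A.stabilize I p q i).x (stabLo j)) =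
      (A.stabilize I p q i).x (stabHi j)) ∧
    ∀ a b, H (a * b) = H a * b + A.stabInc I p q i (A.stabProj I p q i a) * H b := by
  obtain ⟨H, h1, h2, h3⟩ := PathAlg.exists_twisted_derivation
    ((A.stabInc I p q i).comp (A.stabProj I p q i)) (AlgHom.id _ _)
    (Sum.elim (fun _ => 0) (Sum.elim (fun _ => 0)
      (fun j => (A.stabilize I p q i).x (stabHi j))))
    (by
      rintro (g | g | g)
      · simp
      · simp
      · change A.stabInc I p q i (A.stabProj I p q i ((A.stabilize I p q i).e (p g))) * _ = _
        rw [stabProj_e, stabInc_e]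
        exact idem_mul_gen (A.stabilize I p q i).src _ (stabHi g))
    (by
      rintro (g | g | g)
      · simp
      · simp
      · exact gen_mul_idem _ (A.stabilize I p q i).tgt (stabHi g))
  exact ⟨H, h1, fun g => h2 _, fun g => h2 _, fun g => h2 _, h3⟩

/-- Write `p` for the projection followed by the inclusion. Both sides are twisted derivations with
respect to `p` and the identity, as `ab + p(a)p(b) = (a + p(a))b + p(a)(b + p(b))` modulo 2. This
reduces the identity to generators. -/
theorem stab_homotopy_identity (hb : ∀ g, A.diff g ∈ A.corner (A.src g) (A.tgt g))
    {H : (A.stabilize I p q i).Alg →ₗ[ZMod 2] (A.stabilize I p q i).Alg}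
    (he : ∀ v, H ((A.stabilize I p q i).e v) = 0)
    (h1 : ∀ g, H ((A.stabilize I p q i).x (stabOld g)) = 0)
    (h2 : ∀ j, H ((A.stabilize I p q i).x (stabHi j)) = 0)
    (h3 : ∀ j, H ((A.stabilize I p q i).x (stabLo j)) =
      (A.stabilize I p q i).x (stabHi j))
    (hmul : ∀ a b, H (a * b) = H a * b + A.stabInc I p q i (A.stabProj I p q i a) * H b)
    (a : (A.stabilize I p q i).Alg) :
    (A.stabilize I p q i).d (H a) + H ((A.stabilize I p q i).d a) =
      a + A.stabInc I p q i (A.stabProj I p q i a) := by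
  have hH1 : H 1 = 0 := by
    rw [← sum_idem (A.stabilize I p q i).src (A.stabilize I p q i).tgt, map_sum]
    exact Finset.sum_eq_zero fun v _ => he v
  have hinc : ∀ a, H (A.stabInc I p q i a) = 0 := by
    intro a
    refine subalg_induction (P := fun a => H (A.stabInc I p q i a) = 0) (by simp [hH1])
      (fun v => by rw [stabInc_e, he]) (fun g _ => by rw [stabInc_x, h1])
      (fun a _ b _ h h' => by rw [map_add, map_add, h, h', add_zero])
      (fun a _ b _ h h' => by rw [map_mul, hmul, h, h', zero_mul, mul_zero, add_zero])
      (mem_subalg_univ a)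
  refine subalg_induction (P := fun a => (A.stabilize I p q i).d (H a) +
    H ((A.stabilize I p q i).d a) = a + A.stabInc I p q i (A.stabProj I p q i a)) ?_ ?_ ?_ ?_ ?_
    (mem_subalg_univ a)
  · simp [hH1, ZModModule.add_self]
  · intro v
    rw [he, d_e, map_zero, stabProj_e, stabInc_e, ZModModule.add_self, map_zero, add_zero]
  · apply stab_cases <;> intro g _
    · rw [h1, d_x (stabilize_bimodule hb _), stabProj_old, stabInc_x, ZModModule.add_self, map_zero,
        zero_add, stab_diff_old, hinc]
    · rw [h2, d_x (stabilize_bimodule hb _), stabProj_hi, map_zero, map_zero, zero_add, add_zero,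
        stab_diff_hi, h3]
    · rw [h3, d_x (stabilize_bimodule hb _), d_x (stabilize_bimodule hb _), stabProj_lo, map_zero,
        add_zero, stab_diff_hi, stab_diff_lo, map_zero, add_zero]
  · intro a _ b _ h h'
    simp only [map_add]
    rw [add_add_add_comm, h, h', add_add_add_comm]
  · intro a _ b _ h h'
    have hd : (A.stabilize I p q i).d (A.stabInc I p q i (A.stabProj I p q i a)) =
        A.stabInc I p q i (A.stabProj I p q i ((A.stabilize I p q i).d a)) := by
      rw [stabProj_d hb, stabInc_d hb]
    rw [d_mul, hmul, map_add, map_add, hmul, hmul, d_mul, d_mul, hd, map_mul, map_mul]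
    have e1 : (A.stabilize I p q i).d (H a) = H ((A.stabilize I p q i).d a) +
        (a + A.stabInc I p q i (A.stabProj I p q i a)) := by
      rw [← h, add_comm ((A.stabilize I p q i).d (H a)), ← add_assoc, ZModModule.add_self, zero_add]
    have e2 : (A.stabilize I p q i).d (H b) = H ((A.stabilize I p q i).d b) +
        (b + A.stabInc I p q i (A.stabProj I p q i b)) := by
      rw [← h', add_comm ((A.stabilize I p q i).d (H b)), ← add_assoc, ZModModule.add_self,
        zero_add]
    rw [e1, e2]
    generalize A.stabInc I p q i (A.stabProj I p q i a) = a'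
    generalize A.stabInc I p q i (A.stabProj I p q i b) = b'
    generalize A.stabInc I p q i (A.stabProj I p q i _) = c
    generalize H ((A.stabilize I p q i).d a) = u
    generalize H ((A.stabilize I p q i).d b) = w
    generalize H a = y
    generalize H b = z
    generalize (A.stabilize I p q i).d b = t
    -- The products `ub`, `a'b`, `yt`, `cz` and `a'w` each occur twice.
    have key : (u + (a + a')) * b + y * t + (c * z + a' * (w + (b + b'))) +
        (u * b + c * z + (y * t + a' * w)) = (a * b + a' * b') + ((u * b + u * b) +
          (a' * b + a' * b) + (y * t + y * t) + (c * z + c * z) + (a' * w + a' * w)) := by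
      simp only [add_mul, mul_add]; abel
    rw [key]
    simp [ZModModule.add_self]

end Stabilize

end SemiFree

end CellDGA

namespace CellDGA

namespace SemiFree

variable {V : Type} [Fintype V]

/-! ## Cancellation of pairs of generators -/

/-- Pairs of generators `hi j`, `lo j` of `A` with `d (hi j) = lo j + ⋯` that can be cancelled
simultaneously, so that the generators of `B` remain.  A pair has a single rank. -/
structure Cancellation (A B : SemiFree V) (J : Type) where
  keep : B.Gen → A.Gen
  hi : J → A.Gen
  lo : J → A.Gen
  rank : A.Gen → ℕ
  bij : Function.Bijective (Sum.elim keep (Sum.elim hi lo))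
  src_keep : ∀ k, A.src (keep k) = B.src k
  tgt_keep : ∀ k, A.tgt (keep k) = B.tgt k
  deg_keep : ∀ k, A.deg (keep k) = B.deg k
  src_lo : ∀ j, A.src (lo j) = A.src (hi j)
  tgt_lo : ∀ j, A.tgt (lo j) = A.tgt (hi j)
  deg_lo : ∀ j, A.deg (lo j) = A.deg (hi j) + 1
  rank_hi : ∀ j, rank (hi j) = rank (lo j)
  diff_keep : ∀ k, A.diff (keep k) ∈ A.subalg {h | rank h < rank (keep k)}
  diff_lo : ∀ j, A.diff (lo j) ∈ A.subalg {h | rank h < rank (lo j)}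
  diff_hi : ∀ j, A.x (lo j) + A.diff (hi j) ∈ A.subalg {h | rank h < rank (lo j)}

namespace Cancellation

variable {A B : SemiFree V} {J : Type} (C : Cancellation A B J)

theorem cases {P : A.Gen → Prop} (keep : ∀ k, P (C.keep k)) (hi : ∀ j, P (C.hi j))
    (lo : ∀ j, P (C.lo j)) (g : A.Gen) : P g := by
  obtain ⟨k | j | j, rfl⟩ := C.bij.2 g
  · exact keep k
  · exact hi j
  · exact lo j

/-- The quotient map: an algebra homomorphism which is compatible with the cancellation. -/
structure IsQuotientMap (φ : A.Alg →ₐ[ZMod 2] B.Alg) : Prop where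
  map_e : ∀ v, φ (A.e v) = B.e v
  map_keep : ∀ k, φ (A.x (C.keep k)) = B.x k
  map_hi : ∀ j, φ (A.x (C.hi j)) = 0
  map_diff_hi : ∀ j, φ (A.diff (C.hi j)) = 0

theorem IsQuotientMap.map_lo {φ : A.Alg →ₐ[ZMod 2] B.Alg} (hφ : C.IsQuotientMap φ) (j : J) :
    φ (A.x (C.lo j)) = φ (A.x (C.lo j) + A.diff (C.hi j)) := by
  rw [map_add, hφ.map_diff_hi, add_zero]

/-- Killing `d (hi j)` forces the value on `lo j` to be that of `lo j + d (hi j)`, an expression of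
lower rank. So the rank determines everything recursively. -/
theorem IsQuotientMap.unique {φ ψ : A.Alg →ₐ[ZMod 2] B.Alg} (hφ : C.IsQuotientMap φ)
    (hψ : C.IsQuotientMap ψ) : φ = ψ := by
  have key : ∀ n, ∀ g, C.rank g < n → φ (A.x g) = ψ (A.x g) := by
    intro n
    induction n with
    | zero => intro g hg; omega
    | succ n ih =>
      refine C.cases (fun k _ => ?_) (fun j _ => ?_) (fun j hj => ?_)
      · rw [hφ.map_keep, hψ.map_keep]
      · rw [hφ.map_hi, hψ.map_hi]
      · rw [hφ.map_lo, hψ.map_lo]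
        refine eqOn_subalg φ ψ (fun v => by rw [hφ.map_e, hψ.map_e]) (fun g hg => ih g ?_)
          (C.diff_hi j)
        have : C.rank g < C.rank (C.lo j) := hg
        omega
  exact PathAlg.algHom_ext (fun v => (hφ.map_e v).trans (hψ.map_e v).symm)
    (fun g => key _ g (Nat.lt_succ_self _))

/-- The dg algebra `B`, stabilized once for each pair that is cancelled. -/
noncomputable abbrev target (_C : Cancellation A B J) : SemiFree V :=
  B.stabilize J (A.src ∘ _C.hi) (A.tgt ∘ _C.hi) (A.deg ∘ _C.hi)

/-- The correspondence of generators. -/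
noncomputable def genEquiv : A.Gen ≃ C.target.Gen := (Equiv.ofBijective _ C.bij).symm

theorem genEquiv_keep (k : B.Gen) : C.genEquiv (C.keep k) = stabOld k := by
  exact (Equiv.symm_apply_eq (Equiv.ofBijective _ C.bij)).2 rfl

theorem genEquiv_hi (j : J) : C.genEquiv (C.hi j) = stabHi j := by
  exact (Equiv.symm_apply_eq (Equiv.ofBijective _ C.bij)).2 rfl

theorem genEquiv_lo (j : J) : C.genEquiv (C.lo j) = stabLo j := by
  exact (Equiv.symm_apply_eq (Equiv.ofBijective _ C.bij)).2 rfl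

theorem src_genEquiv (g : A.Gen) : C.target.src (C.genEquiv g) = A.src g := by
  revert g
  refine C.cases (fun k => ?_) (fun j => ?_) (fun j => ?_)
  · rw [genEquiv_keep, C.src_keep]; rfl
  · rw [genEquiv_hi]; rfl
  · rw [genEquiv_lo, C.src_lo]; rfl

theorem tgt_genEquiv (g : A.Gen) : C.target.tgt (C.genEquiv g) = A.tgt g := by
  revert g
  refine C.cases (fun k => ?_) (fun j => ?_) (fun j => ?_)
  · rw [genEquiv_keep, C.tgt_keep]; rfl
  · rw [genEquiv_hi]; rfl
  · rw [genEquiv_lo, C.tgt_lo]; rfl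

theorem deg_genEquiv (g : A.Gen) : C.target.deg (C.genEquiv g) = A.deg g := by
  revert g
  refine C.cases (fun k => ?_) (fun j => ?_) (fun j => ?_)
  · rw [genEquiv_keep, C.deg_keep]; rfl
  · rw [genEquiv_hi]; rfl
  · rw [genEquiv_lo, C.deg_lo]; rfl

/-- The filtration of the stabilized algebra. -/
noncomputable def filt (n : ℕ) : Subalgebra (ZMod 2) C.target.Alg :=
  C.target.subalg {s | C.rank (C.genEquiv.symm s) < n}

theorem x_mem_filt {g : A.Gen} {n : ℕ} (h : C.rank g < n) :
    C.target.x (C.genEquiv g) ∈ C.filt n :=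
  x_mem_subalg (by
    change C.rank (C.genEquiv.symm (C.genEquiv g)) < n
    rwa [Equiv.symm_apply_apply])

/-- This is where the two members of a pair must have the same rank: `H` replaces a generator `lo`
by its `hi`. -/
theorem homotopy_mem_filt {H : C.target.Alg →ₗ[ZMod 2] C.target.Alg}
    (he : ∀ v, H (C.target.e v) = 0) (h1 : ∀ g, H (C.target.x (stabOld g)) = 0)
    (h2 : ∀ j, H (C.target.x (stabHi j)) = 0)
    (h3 : ∀ j, H (C.target.x (stabLo j)) = C.target.x (stabHi j))
    (hmul : ∀ a b, H (a * b) = H a * b + B.stabInc J _ _ _ (B.stabProj J _ _ _ a) * H b)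
    {n : ℕ} {a : C.target.Alg} (ha : a ∈ C.filt n) : H a ∈ C.filt n := by
  have hH1 : H 1 = 0 := by
    rw [← sum_idem C.target.src C.target.tgt, map_sum]
    exact Finset.sum_eq_zero fun v _ => he v
  have hp : ∀ a ∈ C.filt n, B.stabInc J _ _ _ (B.stabProj J _ _ _ a) ∈ C.filt n := by
    intro a ha
    refine map_mem_of_subalg ((B.stabInc J _ _ _).comp (B.stabProj J _ _ _)) (C.filt n) (fun v => ?_)
      (stab_cases (fun g hg => ?_) (fun g hg => ?_) (fun g hg => ?_)) ha
    · rw [AlgHom.comp_apply, stabProj_e, stabInc_e]; exact e_mem_subalg _ v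
    · rw [AlgHom.comp_apply, stabProj_old, stabInc_x]; exact x_mem_subalg hg
    · rw [AlgHom.comp_apply, stabProj_hi, map_zero]; exact zero_mem _
    · rw [AlgHom.comp_apply, stabProj_lo, map_zero]; exact zero_mem _
  refine subalg_induction (P := fun a => H a ∈ C.filt n) ?_ ?_ ?_ ?_ ?_ ha
  · rw [hH1]; exact zero_mem _
  · intro v; rw [he]; exact zero_mem _
  · apply stab_cases <;> intro g hg
    · rw [h1]; exact zero_mem _
    · rw [h2]; exact zero_mem _
    · rw [h3, ← C.genEquiv_hi]
      apply C.x_mem_filt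
      rw [C.rank_hi]
      rw [← C.genEquiv_lo] at hg
      change C.rank (C.genEquiv.symm (C.genEquiv _)) < n at hg
      rwa [Equiv.symm_apply_apply] at hg
  · intro a _ b _ h h'; rw [map_add]; exact add_mem h h'
  · intro a ha b hb h h'
    rw [hmul]
    exact add_mem (mul_mem h hb) (mul_mem (hp a ha) h')

/-- The map on generators of the isomorphism onto the stabilization. -/
noncomputable def step (H : C.target.Alg →ₗ[ZMod 2] C.target.Alg)
    (F : A.Alg →ₐ[ZMod 2] C.target.Alg) (g : A.Gen) : C.target.Alg :=
  C.target.x (C.genEquiv g) + Sum.elim (fun k => H (F (A.diff (C.keep k))))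
    (Sum.elim (fun _ => 0) (fun j => F (A.x (C.lo j) + A.diff (C.hi j)))) (C.genEquiv g)

variable (H : C.target.Alg →ₗ[ZMod 2] C.target.Alg)

theorem step_keep (F : A.Alg →ₐ[ZMod 2] C.target.Alg) (k : B.Gen) : C.step H F (C.keep k) =
    C.target.x (stabOld k) + H (F (A.diff (C.keep k))) := by
  rw [step, genEquiv_keep]; rfl

theorem step_hi (F : A.Alg →ₐ[ZMod 2] C.target.Alg) (j : J) : C.step H F (C.hi j) =
    C.target.x (stabHi j) := by
  rw [step, genEquiv_hi]; exact add_zero _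

theorem step_lo (F : A.Alg →ₐ[ZMod 2] C.target.Alg) (j : J) : C.step H F (C.lo j) =
    C.target.x (stabLo j) + F (A.x (C.lo j) + A.diff (C.hi j)) := by
  rw [step, genEquiv_lo]; rfl

/-- Since `step` uses `F` only in ranks below that of `g`, the equation `F (x g) = step H F g` can
be solved by recursion on the rank. -/
theorem step_congr {F F' : A.Alg →ₐ[ZMod 2] C.target.Alg} (g : A.Gen)
    (h : ∀ a ∈ A.subalg {h | C.rank h < C.rank g}, F a = F' a) : C.step H F g = C.step H F' g := by
  revert g
  refine C.cases (fun k h => ?_) (fun j h => ?_) (fun j h => ?_)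
  · rw [step_keep, step_keep, h _ (C.diff_keep k)]
  · rw [step_hi, step_hi]
  · rw [step_lo, step_lo, h _ (C.diff_hi j)]

/-- The maps which are triangular with respect to the filtration and homogeneous. -/
structure IsTriangular (F : A.Alg →ₐ[ZMod 2] C.target.Alg) : Prop where
  map_e : ∀ v, F (A.e v) = C.target.e v
  corner : ∀ g, F (A.x g) ∈ C.target.corner (A.src g) (A.tgt g)
  degree : ∀ g, F (A.x g) ∈ C.target.degreePart (A.deg g)
  filt : ∀ g, F (A.x g) + C.target.x (C.genEquiv g) ∈ C.filt (C.rank g)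

variable {C} in
theorem IsTriangular.map_filt {F : A.Alg →ₐ[ZMod 2] C.target.Alg} (hF : C.IsTriangular F) {n : ℕ}
    {a : A.Alg} (ha : a ∈ A.subalg {h | C.rank h < n}) : F a ∈ C.filt n := by
  refine map_mem_of_subalg F (C.filt n) (fun v => ?_) (fun g hg => ?_) ha
  · rw [hF.map_e]; exact e_mem_subalg _ v
  · have h1 := hF.filt g
    have h2 : C.filt (C.rank g) ≤ C.filt n := subalg_mono fun s hs => lt_trans
      (show C.rank (C.genEquiv.symm s) < C.rank g from hs) hg
    have h3 := add_mem (h2 h1) (C.x_mem_filt hg)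
    rwa [add_assoc, ZModModule.add_self, add_zero] at h3

theorem x_genEquiv_mem_corner (g : A.Gen) :
    C.target.x (C.genEquiv g) ∈ C.target.corner (A.src g) (A.tgt g) := by
  have := x_mem_corner (A := C.target) (C.genEquiv g)
  rwa [C.src_genEquiv, C.tgt_genEquiv] at this

theorem x_genEquiv_mem_degreePart (g : A.Gen) :
    C.target.x (C.genEquiv g) ∈ C.target.degreePart (A.deg g) := by
  have := x_mem_degreePart (A := C.target) (C.genEquiv g)
  rwa [C.deg_genEquiv] at this

/-- The isomorphism onto the stabilization, as a homomorphism. -/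
theorem exists_triangular [Finite A.Gen] (hA : A.IsSemiFreeDG)
    (he : ∀ v, H (C.target.e v) = 0) (h1 : ∀ g, H (C.target.x (stabOld g)) = 0)
    (h2 : ∀ j, H (C.target.x (stabHi j)) = 0)
    (h3 : ∀ j, H (C.target.x (stabLo j)) = C.target.x (stabHi j))
    (hmul : ∀ a b, H (a * b) = H a * b + B.stabInc J _ _ _ (B.stabProj J _ _ _ a) * H b) :
    ∃ F : A.Alg →ₐ[ZMod 2] C.target.Alg, C.IsTriangular F ∧ ∀ g, F (A.x g) = C.step H F g := by
  classical
  have hcor : ∀ (v w) (a : C.target.Alg), a ∈ C.target.corner v w → H a ∈ C.target.corner v w := by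
    intro v w a ha
    refine mem_corner_of ?_ ?_
    · conv_rhs => rw [← e_mul_of_mem_corner ha, hmul, he, zero_mul, zero_add, stabProj_e, stabInc_e]
    · conv_rhs => rw [← mul_e_of_mem_corner ha, hmul, he, mul_zero, add_zero]
  -- The homotopy has degree `-1`, while the differential has degree `1`, so `H (F (d k))` has the
  -- degree of `k`.
  have hdeg : ∀ (n : ℤ) (a : C.target.Alg), a ∈ C.target.degreePart (n + 1) →
      H a ∈ C.target.degreePart n := by
    intro n a ha
    have := twisted_mem_degreePart (((B.stabInc J _ _ _).comp (B.stabProj J _ _ _)))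
      (AlgHom.id _ _) H (-1)
      (fun n a ha => stabInc_mem_degreePart (stabProj_mem_degreePart ha)) (fun n a ha => ha) he
      (stab_cases (fun g => by rw [h1]; exact zero_mem _) (fun g => by rw [h2]; exact zero_mem _)
        (fun g => by
          rw [h3]
          have := x_mem_degreePart (A := C.target) (stabHi g)
          have e : C.target.deg (stabLo g) + -1 = C.target.deg (stabHi g) := by
            change A.deg (C.hi g) + 1 + -1 = A.deg (C.hi g)
            ring
          rwa [e])) hmul ha
    simpa using this
  have hstep : ∀ F : A.Alg →ₐ[ZMod 2] C.target.Alg, C.IsTriangular F → ∀ g,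
      C.step H F g ∈ C.target.corner (A.src g) (A.tgt g) ∧
      C.step H F g ∈ C.target.degreePart (A.deg g) ∧
      C.step H F g + C.target.x (C.genEquiv g) ∈ C.filt (C.rank g) := by
    intro F hF
    have Fcor : ∀ {v w a}, a ∈ A.corner v w → F a ∈ C.target.corner v w :=
      fun h => map_mem_corner F hF.map_e h
    have Fdeg : ∀ {n a}, a ∈ A.degreePart n → F a ∈ C.target.degreePart n :=
      fun h => map_mem_degreePart F hF.map_e hF.degree h
    refine C.cases (fun k => ?_) (fun j => ?_) (fun j => ?_)
    · rw [step_keep, ← C.genEquiv_keep]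
      refine ⟨add_mem (C.x_genEquiv_mem_corner _) (hcor _ _ _ (Fcor (hA.bimodule _))),
        add_mem (C.x_genEquiv_mem_degreePart _) (hdeg _ _ (Fdeg (hA.degree _))), ?_⟩
      rw [add_right_comm, ZModModule.add_self, zero_add]
      exact C.homotopy_mem_filt he h1 h2 h3 hmul (hF.map_filt (C.diff_keep k))
    · rw [step_hi, ← C.genEquiv_hi]
      refine ⟨C.x_genEquiv_mem_corner _, C.x_genEquiv_mem_degreePart _, ?_⟩
      rw [ZModModule.add_self]
      exact zero_mem _
    · rw [step_lo, ← C.genEquiv_lo]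
      have e1 : A.x (C.lo j) + A.diff (C.hi j) ∈ A.corner (A.src (C.lo j)) (A.tgt (C.lo j)) := by
        refine add_mem (x_mem_corner _) ?_
        rw [C.src_lo, C.tgt_lo]
        exact hA.bimodule _
      have e2 : A.x (C.lo j) + A.diff (C.hi j) ∈ A.degreePart (A.deg (C.lo j)) := by
        refine add_mem (x_mem_degreePart _) ?_
        rw [C.deg_lo]
        exact hA.degree _
      refine ⟨add_mem (C.x_genEquiv_mem_corner _) (Fcor e1),
        add_mem (C.x_genEquiv_mem_degreePart _) (Fdeg e2), ?_⟩
      rw [add_right_comm, ZModModule.add_self, zero_add]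
      exact hF.map_filt (C.diff_hi j)
  -- Starting from the mere renaming of generators, the values on generators of rank `n` are
  -- corrected while all others are kept. The equations already achieved in lower ranks persist by
  -- `step_congr`.
  have key : ∀ n, ∃ F : A.Alg →ₐ[ZMod 2] C.target.Alg, C.IsTriangular F ∧
      ∀ g, C.rank g < n → F (A.x g) = C.step H F g := by
    intro n
    induction n with
    | zero =>
      obtain ⟨F, hFe, hFx⟩ := exists_algHom (fun g => C.target.x (C.genEquiv g))
        C.x_genEquiv_mem_corner
      refine ⟨F, ⟨hFe, fun g => ?_, fun g => ?_, fun g => ?_⟩, fun g hg => by omega⟩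
      · rw [hFx]; exact C.x_genEquiv_mem_corner g
      · rw [hFx]; exact C.x_genEquiv_mem_degreePart g
      · rw [hFx, ZModModule.add_self]; exact zero_mem _
    | succ n ih =>
      obtain ⟨F, hF, hFs⟩ := ih
      obtain ⟨F', hFe, hFx⟩ := exists_algHom
        (fun g => if C.rank g = n then C.step H F g else F (A.x g)) (fun g => by
          split_ifs
          · exact (hstep F hF g).1
          · exact hF.corner g)
      have hFF : ∀ a ∈ A.subalg {h | C.rank h < n}, F' a = F a := fun a ha =>
        eqOn_subalg F' F (fun v => by rw [hFe, hF.map_e]) (fun g hg => by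
          rw [hFx, if_neg (ne_of_lt hg)]) ha
      refine ⟨F', ⟨hFe, fun g => ?_, fun g => ?_, fun g => ?_⟩, fun g hg => ?_⟩
      · rw [hFx]
        split_ifs
        · exact (hstep F hF g).1
        · exact hF.corner g
      · rw [hFx]
        split_ifs
        · exact (hstep F hF g).2.1
        · exact hF.degree g
      · rw [hFx]
        split_ifs
        · exact (hstep F hF g).2.2
        · exact hF.filt g
      · have hle : C.rank g ≤ n := by omega
        have : C.step H F' g = C.step H F g := C.step_congr H g fun a ha =>
          hFF a (subalg_mono (fun h hh => lt_of_lt_of_le (show C.rank h < C.rank g from hh) hle) ha)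
        rw [this, hFx]
        split_ifs with h
        · rfl
        · exact hFs g (by omega)
  obtain ⟨N, hN⟩ := (Set.finite_range C.rank).bddAbove
  obtain ⟨F, hF, hFs⟩ := key (N + 1)
  exact ⟨F, hF, fun g => hFs g (Nat.lt_succ_of_le (hN ⟨g, rfl⟩))⟩

end Cancellation

end SemiFree

end CellDGA

namespace CellDGA

namespace SemiFree

variable {V : Type} [Fintype V]

/-! ## Tame automorphisms -/

section Tame

variable {A B D : SemiFree V}

/-- As `v` does not involve `x_g` and `2 = 0`, the substitution is its own inverse. -/
theorem exists_elementary (g : A.Gen) (v : A.Alg) (hs : v ∈ A.subalg {h | h ≠ g})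
    (hd : v ∈ A.degreePart (A.deg g)) (hc : v ∈ A.corner (A.src g) (A.tgt g)) :
    ∃ σ : A.Alg ≃ₐ[ZMod 2] A.Alg, IsElementary A σ ∧ (∀ w, σ (A.e w) = A.e w) ∧
      σ (A.x g) = A.x g + v ∧ ∀ h, h ≠ g → σ (A.x h) = A.x h := by
  classical
  obtain ⟨f, fe, fx⟩ := exists_algHom (A := A) (B := A)
    (fun h => if h = g then A.x g + v else A.x h) (fun h => by
      split_ifs with hh
      · subst hh; exact add_mem (x_mem_corner h) hc
      · exact x_mem_corner h)
  have fx' : ∀ h, h ≠ g → f (A.x h) = A.x h := fun h hh => by rw [fx, if_neg hh]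
  have fg : f (A.x g) = A.x g + v := by rw [fx, if_pos rfl]
  have fv : f v = v := eqOn_subalg f (AlgHom.id _ _) fe fx' hs
  have ff : f.comp f = AlgHom.id _ _ := by
    refine PathAlg.algHom_ext (fun w => ?_) (fun h => ?_)
    · change f (f (A.e w)) = A.e w
      rw [fe, fe]
    · change f (f (A.x h)) = A.x h
      by_cases hh : h = g
      · rw [hh, fg, map_add, fg, fv, add_assoc, ZModModule.add_self, add_zero]
      · rw [fx' h hh, fx' h hh]
  exact ⟨AlgEquiv.ofAlgHom f f ff ff, ⟨fe, g, v, hs, hd, hc, fg, fx'⟩, fe, fg, fx'⟩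

/-- Triangular automorphisms are tame. -/
theorem exists_tame_of_triangular [Finite A.Gen] (r : A.Gen → ℕ) (v : A.Gen → A.Alg)
    (hs : ∀ g, v g ∈ A.subalg {h | r h < r g}) (hd : ∀ g, v g ∈ A.degreePart (A.deg g))
    (hc : ∀ g, v g ∈ A.corner (A.src g) (A.tgt g)) :
    ∃ τ : A.Alg ≃ₐ[ZMod 2] A.Alg, IsTameAut A τ ∧ (∀ w, τ (A.e w) = A.e w) ∧
      ∀ g, τ (A.x g) = A.x g + v g := by
  classical
  have := Fintype.ofFinite A.Gen
  have key : ∀ s : Finset A.Gen, ∃ τ : A.Alg ≃ₐ[ZMod 2] A.Alg, IsTameAut A τ ∧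
      (∀ w, τ (A.e w) = A.e w) ∧ (∀ g ∈ s, τ (A.x g) = A.x g + v g) ∧
        ∀ g, g ∉ s → τ (A.x g) = A.x g := by
    intro s
    -- Generators are added in order of increasing rank. The new elementary automorphism alters only
    -- `x_a`, which does not occur in the terms `v g` already added, since `r a` is maximal.
    induction s using Finset.induction_on_max_value r with
    | empty => exact ⟨AlgEquiv.refl, .refl, fun _ => rfl, by simp, fun _ _ => rfl⟩
    | insert a s ha hmax ih =>
      obtain ⟨τ, hτ, τe, τs, τn⟩ := ih
      obtain ⟨σ, hσ, σe, σa, σn⟩ := exists_elementary a (v a)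
        (subalg_mono (fun h (hh : r h < r a) => by rintro rfl; exact lt_irrefl _ hh) (hs a))
        (hd a) (hc a)
      refine ⟨τ.trans σ, hτ.step _ _ hσ, fun w => ?_, fun g hg => ?_, fun g hg => ?_⟩
      · rw [AlgEquiv.trans_apply, τe, σe]
      · rw [AlgEquiv.trans_apply]
        rcases Finset.mem_insert.1 hg with rfl | hgs
        · rw [τn _ ha, σa]
        · have hne : g ≠ a := fun h => ha (h ▸ hgs)
          rw [τs g hgs, map_add, σn g hne]
          congr 1
          exact eqOn_subalg σ.toAlgHom (AlgHom.id _ _) σe (fun h (hh : r h < r g) => σn h (by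
            rintro rfl; exact absurd (hmax g hgs) (not_le.2 hh))) (hs g)
      · rw [Finset.mem_insert, not_or] at hg
        rw [AlgEquiv.trans_apply, τn g hg.2, σn g hg.1]
  obtain ⟨τ, h1, h2, h3, -⟩ := key Finset.univ
  exact ⟨τ, h1, h2, fun g => h3 g (Finset.mem_univ g)⟩

theorem IsTameAut.trans {τ σ : A.Alg ≃ₐ[ZMod 2] A.Alg} (hτ : IsTameAut A τ) (hσ : IsTameAut A σ) :
    IsTameAut A (τ.trans σ) := by
  induction hσ with
  | refl => exact hτ
  | step σ ρ _ hρ ih => exact ih.step _ _ hρ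

section Rename

variable (σ : A.Gen ≃ B.Gen) (φ : A.Alg ≃ₐ[ZMod 2] B.Alg) (hφe : ∀ v, φ (A.e v) = B.e v)
  (hφx : ∀ g, φ (A.x g) = B.x (σ g))

include hφe in
theorem rename_symm_e (v : V) : φ.symm (B.e v) = A.e v := by
  rw [← hφe, AlgEquiv.symm_apply_apply]

include hφx in
theorem rename_symm_x (g : B.Gen) : φ.symm (B.x g) = A.x (σ.symm g) := by
  rw [AlgEquiv.symm_apply_eq, hφx, Equiv.apply_symm_apply]

variable (hσ : ∀ g, B.src (σ g) = A.src g ∧ B.tgt (σ g) = A.tgt g ∧ B.deg (σ g) = A.deg g)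

-- Transitivity of `TameIso` needs this: a tame automorphism of the middle algebra has to be moved
-- across the identification of generators.
include hφe hφx hσ in
theorem IsTameAut.conj {τ : B.Alg ≃ₐ[ZMod 2] B.Alg} (hτ : IsTameAut B τ) :
    IsTameAut A ((φ.trans τ).trans φ.symm) := by
  induction hτ with
  | refl =>
    have : (φ.trans AlgEquiv.refl).trans φ.symm = AlgEquiv.refl := by
      ext a; simp
    rw [this]
    exact .refl
  | step τ ρ _ hρ ih =>
    have : (φ.trans (τ.trans ρ)).trans φ.symm =
        ((φ.trans τ).trans φ.symm).trans ((φ.trans ρ).trans φ.symm) := by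
      ext a; simp
    rw [this]
    refine ih.step _ _ ?_
    obtain ⟨he, g, v, hs, hd, hc, hg, hn⟩ := hρ
    have se := rename_symm_e φ hφe
    have sx := rename_symm_x σ φ hφx
    refine ⟨fun w => ?_, σ.symm g, φ.symm v, ?_, ?_, ?_, ?_, fun h hh => ?_⟩
    · simp only [AlgEquiv.trans_apply]; rw [hφe, he, se]
    · refine map_mem_of_subalg φ.symm.toAlgHom _ (fun w => ?_) (fun h hh => ?_) hs
      · change φ.symm _ ∈ _
        rw [se]; exact e_mem_subalg _ w
      · change φ.symm _ ∈ _
        rw [sx]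
        exact x_mem_subalg fun hgh => hh (σ.symm.injective hgh)
    · have := map_mem_degreePart φ.symm.toAlgHom se (fun h => ?_) hd
      · have e := (hσ (σ.symm g)).2.2
        rw [Equiv.apply_symm_apply] at e
        rw [← e]; exact this
      · change φ.symm _ ∈ _
        rw [sx]
        have e := (hσ (σ.symm h)).2.2
        rw [Equiv.apply_symm_apply] at e
        rw [e]; exact x_mem_degreePart _
    · have e1 := (hσ (σ.symm g)).1
      have e2 := (hσ (σ.symm g)).2.1
      rw [Equiv.apply_symm_apply] at e1 e2
      rw [← e1, ← e2]
      exact map_mem_corner φ.symm.toAlgHom se hc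
    · simp only [AlgEquiv.trans_apply]
      rw [hφx, Equiv.apply_symm_apply, hg, map_add, sx]
    · simp only [AlgEquiv.trans_apply]
      rw [hφx, hn, sx, Equiv.symm_apply_apply]
      rintro rfl
      exact hh (Equiv.symm_apply_apply _ _).symm

end Rename

theorem exists_rename (σ : A.Gen ≃ B.Gen)
    (hσ : ∀ g, B.src (σ g) = A.src g ∧ B.tgt (σ g) = A.tgt g ∧ B.deg (σ g) = A.deg g) :
    ∃ φ : A.Alg ≃ₐ[ZMod 2] B.Alg, (∀ v, φ (A.e v) = B.e v) ∧ ∀ g, φ (A.x g) = B.x (σ g) := by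
  obtain ⟨f, fe, fx⟩ := exists_algHom (A := A) (B := B) (fun g => B.x (σ g)) (fun g => by
    have := x_mem_corner (σ g)
    rwa [(hσ g).1, (hσ g).2.1] at this)
  obtain ⟨f', fe', fx'⟩ := exists_algHom (A := B) (B := A) (fun g => A.x (σ.symm g)) (fun g => by
    have := x_mem_corner (σ.symm g)
    rwa [← (hσ _).1, ← (hσ _).2.1, Equiv.apply_symm_apply] at this)
  refine ⟨AlgEquiv.ofAlgHom f f' ?_ ?_, fe, fx⟩
  · refine PathAlg.algHom_ext (fun v => ?_) (fun g => ?_)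
    · change f (f' (B.e v)) = B.e v
      rw [fe', fe]
    · change f (f' (B.x g)) = B.x g
      rw [fx', fx, Equiv.apply_symm_apply]
  · refine PathAlg.algHom_ext (fun v => ?_) (fun g => ?_)
    · change f' (f (A.e v)) = A.e v
      rw [fe, fe']
    · change f' (f (A.x g)) = A.x g
      rw [fx, fx', Equiv.symm_apply_apply]

theorem TameIso.trans (h : TameIso A B) (h' : TameIso B D) : TameIso A D := by
  obtain ⟨τ, hτ, σ, φ, hσ, hφe, hφx, hφ⟩ := h
  obtain ⟨τ', hτ', σ', φ', hσ', hφe', hφx', hφ'⟩ := h'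
  refine ⟨τ.trans ((φ.trans τ').trans φ.symm), hτ.trans (hτ'.conj σ φ hφe hφx hσ), σ.trans σ',
    φ.trans φ', fun g => ?_, fun v => ?_, fun g => ?_, fun a => ?_⟩
  · obtain ⟨h1, h2, h3⟩ := hσ g
    obtain ⟨h1', h2', h3'⟩ := hσ' (σ g)
    exact ⟨h1'.trans h1, h2'.trans h2, h3'.trans h3⟩
  · rw [AlgEquiv.trans_apply, hφe, hφe']
  · rw [AlgEquiv.trans_apply, hφx, hφx', Equiv.trans_apply]
  · simp only [AlgEquiv.trans_apply, AlgEquiv.apply_symm_apply]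
    rw [hφ, hφ']

end Tame

/-! ## Consequences of a cancellation -/

theorem IsQuasiIso.comp {A B D : SemiFree V} {φ : A.Alg →ₐ[ZMod 2] B.Alg}
    {ψ : B.Alg →ₐ[ZMod 2] D.Alg} (hφ : IsQuasiIso A B φ) (hψ : IsQuasiIso B D ψ) :
    IsQuasiIso A D (ψ.comp φ) where
  map_e v := by rw [AlgHom.comp_apply, hφ.map_e, hψ.map_e]
  map_degree n a ha := hψ.map_degree n _ (hφ.map_degree n a ha)
  map_d a := by rw [AlgHom.comp_apply, AlgHom.comp_apply, hφ.map_d, hψ.map_d]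
  injective a ha hb := hφ.injective a ha (hψ.injective _ (by rw [← hφ.map_d, ha, map_zero]) hb)
  surjective b hb := by
    obtain ⟨c, hc, b', rfl⟩ := hψ.surjective b hb
    obtain ⟨a, ha, c', rfl⟩ := hφ.surjective c hc
    refine ⟨a, ha, ψ c' + b', ?_⟩
    rw [map_add, map_add, hψ.map_d, AlgHom.comp_apply, add_assoc]

namespace Cancellation

variable {A B : SemiFree V} {J : Type} (C : Cancellation A B J)

/-- The equation for `F (lo j)` contains `F (lo j)` on both sides; cancelling it leaves `F (d (hi
j)) = lo j`. The projection annihilates the image of `H`, so the corrections to kept generators are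
not seen in `B`. -/
theorem isQuotientMap_of_triangular {H : C.target.Alg →ₗ[ZMod 2] C.target.Alg}
    (he : ∀ v, H (C.target.e v) = 0) (h1 : ∀ g, H (C.target.x (stabOld g)) = 0)
    (h2 : ∀ j, H (C.target.x (stabHi j)) = 0)
    (h3 : ∀ j, H (C.target.x (stabLo j)) = C.target.x (stabHi j))
    (hmul : ∀ a b, H (a * b) = H a * b + B.stabInc J _ _ _ (B.stabProj J _ _ _ a) * H b)
    {F : A.Alg →ₐ[ZMod 2] C.target.Alg} (hF : C.IsTriangular F)
    (hFs : ∀ g, F (A.x g) = C.step H F g) :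
    (∀ j, F (A.diff (C.hi j)) = C.target.x (stabLo j)) ∧
      C.IsQuotientMap ((B.stabProj J _ _ _).comp F) := by
  have hpH : ∀ a : C.target.Alg, B.stabProj J _ _ _ (H a) = 0 := by
    intro a
    refine subalg_induction (P := fun a : C.target.Alg => B.stabProj J _ _ _ (H a) = 0) ?_ ?_ ?_ ?_
      ?_ (mem_subalg_univ a)
    · rw [← sum_idem C.target.src C.target.tgt, map_sum, map_sum]
      exact Finset.sum_eq_zero fun v _ => (congrArg _ (he v)).trans (map_zero _)
    · intro v; rw [he, map_zero]
    · apply stab_cases <;> intro g _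
      · rw [h1, map_zero]
      · rw [h2, map_zero]
      · rw [h3, stabProj_hi]
    · intro a _ b _ h h'; rw [map_add, map_add, h, h', add_zero]
    · intro a _ b _ h h'
      rw [hmul, map_add, map_mul, map_mul, h, h', zero_mul, mul_zero, add_zero]
  have hlo : ∀ j, F (A.diff (C.hi j)) = C.target.x (stabLo j) := by
    intro j
    have h4 := hFs (C.lo j)
    rw [step_lo, map_add, add_comm (C.target.x _), add_assoc] at h4
    have h5 := left_eq_add.1 h4
    rw [← sub_eq_zero, ZModModule.sub_eq_add]
    exact h5
  refine ⟨hlo, fun v => ?_, fun k => ?_, fun j => ?_, fun j => ?_⟩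
  · rw [AlgHom.comp_apply, hF.map_e, stabProj_e]
  · rw [AlgHom.comp_apply, hFs, step_keep, map_add, hpH, stabProj_old, add_zero]
  · rw [AlgHom.comp_apply, hFs, step_hi, stabProj_hi]
  · rw [AlgHom.comp_apply, hlo, stabProj_lo]

variable {φ : A.Alg →ₐ[ZMod 2] B.Alg} (hφ : C.IsQuotientMap φ)
  (hA : A.IsSemiFreeDG) (hd : ∀ k, φ (A.diff (C.keep k)) = B.diff k)

include hφ hA hd

theorem bimodule (k : B.Gen) : B.diff k ∈ B.corner (B.src k) (B.tgt k) := by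
  rw [← hd, ← C.src_keep, ← C.tgt_keep]
  exact map_mem_corner φ hφ.map_e (hA.bimodule _)

theorem map_d (a : A.Alg) : φ (A.d a) = B.d (φ a) := by
  have key : ∀ n, ∀ g, C.rank g < n → φ (A.d (A.x g)) = B.d (φ (A.x g)) := by
    intro n
    induction n with
    | zero => intro g hg; omega
    | succ n ih =>
      refine C.cases (fun k _ => ?_) (fun j _ => ?_) (fun j hj => ?_)
      · rw [d_x (hA.bimodule _), hd, hφ.map_keep, d_x (C.bimodule hφ hA hd k)]
      · rw [d_x (hA.bimodule _), hφ.map_diff_hi, hφ.map_hi, map_zero]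
      · rw [hφ.map_lo]
        -- Because `d² (hi j) = 0`, the generator `lo j` may be replaced by an expression of lower
        -- rank with the same differential.
        have h1 : A.d (A.x (C.lo j)) = A.d (A.x (C.lo j) + A.diff (C.hi j)) := by
          rw [map_add, ← d_x (hA.bimodule (C.hi j)), hA.square, add_zero]
        rw [h1]
        refine map_d_of_subalg φ hφ.map_e (fun g hg => ih g ?_) (C.diff_hi j)
        have : C.rank g < C.rank (C.lo j) := hg
        omega
  exact map_d_of_subalg φ hφ.map_e (fun g _ => key _ g (Nat.lt_succ_self _)) (mem_subalg_univ a)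

variable [Finite A.Gen]

/-- The stabilization of `B` is isomorphic to `A` as a dg algebra. -/
theorem exists_iso : TameIso A C.target ∧ ∃ F : A.Alg ≃ₐ[ZMod 2] C.target.Alg,
    (∀ a, φ a = B.stabProj J _ _ _ (F a)) ∧ (∀ a, F (A.d a) = C.target.d (F a)) ∧
    (∀ n, ∀ a ∈ A.degreePart n, F a ∈ C.target.degreePart n) := by
  have hB := C.bimodule hφ hA hd
  have hT := stabilize_bimodule (I := J) (p := A.src ∘ C.hi) (q := A.tgt ∘ C.hi)
    (i := A.deg ∘ C.hi) hB
  obtain ⟨H, he, h1, h2, h3, hmul⟩ := exists_stab_homotopy B J (A.src ∘ C.hi) (A.tgt ∘ C.hi)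
    (A.deg ∘ C.hi)
  have hid := stab_homotopy_identity hB he h1 h2 h3 hmul
  obtain ⟨F, hF, hFs⟩ := C.exists_triangular H hA he h1 h2 h3 hmul
  obtain ⟨hlo, hq⟩ := C.isQuotientMap_of_triangular he h1 h2 h3 hmul hF hFs
  -- By uniqueness the given map `φ` is `F` followed by the projection.
  obtain rfl := hφ.unique C hq
  have hFd : ∀ a, F (A.d a) = C.target.d (F a) := by
    have key : ∀ n, ∀ g, C.rank g < n → F (A.d (A.x g)) = C.target.d (F (A.x g)) := by
      intro n
      induction n with
      | zero => intro g hg; omega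
      | succ n ih =>
        have hsub : ∀ m ≤ n, ∀ a ∈ A.subalg {h | C.rank h < m}, F (A.d a) = C.target.d (F a) :=
          fun m hm a ha => map_d_of_subalg F hF.map_e (fun g hg => ih g (by
            have : C.rank g < m := hg
            omega)) ha
        refine C.cases (fun k hk => ?_) (fun j _ => ?_) (fun j hj => ?_)
        · have hy : C.target.d (F (A.diff (C.keep k))) = 0 := by
            rw [← hsub _ (Nat.lt_succ_iff.1 hk) _ (C.diff_keep k), ← d_x (hA.bimodule _), hA.square,
              map_zero]
          -- The homotopy identity is applied to the cycle `F (d k)`. It shows that `d (H (F (d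
          -- k)))` is the difference between `F (d k)` and the included differential of `B`, which
          -- is what the correction term has to contribute.
          have h4 := hid (F (A.diff (C.keep k)))
          have h5 : B.stabProj J _ _ _ (F (A.diff (C.keep k))) = B.diff k := hd k
          rw [hy, map_zero, add_zero, h5] at h4
          rw [d_x (hA.bimodule _), hFs, step_keep, map_add, d_x (hT _), h4, stab_diff_old,
            add_left_comm, ZModModule.add_self, add_zero]
        · rw [d_x (hA.bimodule _), hlo, hFs, step_hi, d_x (hT _), stab_diff_hi]
        · have h4 : A.d (A.x (C.lo j)) = A.d (A.x (C.lo j) + A.diff (C.hi j)) := by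
            rw [map_add, ← d_x (hA.bimodule (C.hi j)), hA.square, add_zero]
          rw [hFs, step_lo, map_add, d_x (hT _), stab_diff_lo, zero_add, h4]
          exact hsub _ (Nat.lt_succ_iff.1 hj) _ (C.diff_hi j)
    exact fun a => map_d_of_subalg F hF.map_e (fun g _ => key _ g (Nat.lt_succ_self _))
      (mem_subalg_univ a)
  have hσ : ∀ g, C.target.src (C.genEquiv g) = A.src g ∧ C.target.tgt (C.genEquiv g) = A.tgt g ∧
      C.target.deg (C.genEquiv g) = A.deg g :=
    fun g => ⟨C.src_genEquiv g, C.tgt_genEquiv g, C.deg_genEquiv g⟩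
  obtain ⟨ρ, ρe, ρx⟩ := exists_rename C.genEquiv hσ
  have se := rename_symm_e ρ ρe
  have sx := rename_symm_x C.genEquiv ρ ρx
  -- The map `F` is split into a triangular automorphism of `A` and a renaming; the terms added by
  -- the former are the deviations of `F` from the renaming, carried back to `A`.
  obtain ⟨τ, hτ, τe, τx⟩ := exists_tame_of_triangular C.rank
    (fun g => ρ.symm (F (A.x g) + C.target.x (C.genEquiv g)))
    (fun g => map_mem_of_subalg ρ.symm.toAlgHom _
      (fun v => by change ρ.symm _ ∈ _; rw [se]; exact e_mem_subalg _ v)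
      (fun h hh => by change ρ.symm _ ∈ _; rw [sx]; exact x_mem_subalg hh) (hF.filt g))
    (fun g => map_mem_degreePart ρ.symm.toAlgHom se (fun h => by
      change ρ.symm _ ∈ _
      rw [sx]
      have := x_mem_degreePart (C.genEquiv.symm h)
      rwa [← C.deg_genEquiv, Equiv.apply_symm_apply] at this)
      (add_mem (hF.degree g) (C.x_genEquiv_mem_degreePart g)))
    (fun g => map_mem_corner ρ.symm.toAlgHom se
      (add_mem (hF.corner g) (C.x_genEquiv_mem_corner g)))
  have hFτ : F = (τ.trans ρ).toAlgHom := by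
    refine PathAlg.algHom_ext (fun v => ?_) (fun g => ?_)
    · change F (A.e v) = ρ (τ (A.e v))
      rw [τe, ρe, hF.map_e]
    · change F (A.x g) = ρ (τ (A.x g))
      rw [τx, map_add, AlgEquiv.apply_symm_apply, ρx, add_left_comm, ZModModule.add_self, add_zero]
  have hFτ' : ∀ a, (τ.trans ρ) a = F a := fun a => by rw [hFτ]; rfl
  refine ⟨⟨τ, hτ, C.genEquiv, ρ, hσ, ρe, ρx, fun a => ?_⟩, τ.trans ρ, fun a => ?_, fun a => ?_,
    fun n a ha => ?_⟩
  · exact (hFτ' _).trans ((hFd a).trans (congrArg _ (hFτ' a).symm))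
  · rw [hFτ', AlgHom.comp_apply]
  · rw [hFτ', hFτ', hFd]
  · rw [hFτ']
    exact map_mem_degreePart F hF.map_e hF.degree ha

theorem tameIso : TameIso A C.target := (C.exists_iso hφ hA hd).1

/-- After the isomorphism `F` this is the projection of the stabilization, whose homotopy inverse is
the inclusion. -/
theorem isQuasiIso : IsQuasiIso A B φ := by
  have hB := C.bimodule hφ hA hd
  obtain ⟨-, F, hF, hFd, hFdeg⟩ := C.exists_iso hφ hA hd
  obtain ⟨H, he, h1, h2, h3, hmul⟩ := exists_stab_homotopy B J (A.src ∘ C.hi) (A.tgt ∘ C.hi)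
    (A.deg ∘ C.hi)
  have hid := stab_homotopy_identity hB he h1 h2 h3 hmul
  have hsymm : ∀ s, A.d (F.symm s) = F.symm (C.target.d s) := by
    intro s
    rw [AlgEquiv.eq_symm_apply, hFd, AlgEquiv.apply_symm_apply]
  refine ⟨⟨hφ.map_e, fun n a ha => ?_, C.map_d hφ hA hd⟩, fun a ha hb => ?_, fun b hb => ?_⟩
  · rw [hF]; exact stabProj_mem_degreePart (hFdeg n a ha)
  · obtain ⟨b, hb⟩ := hb
    have h4 := hid (F a)
    rw [← hFd, ha, map_zero, map_zero, add_zero, ← hF, hb, stabInc_d hB] at h4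
    refine ⟨F.symm (H (F a) + B.stabInc J _ _ _ b), ?_⟩
    rw [hsymm, map_add, h4, add_assoc, ZModModule.add_self, add_zero, AlgEquiv.symm_apply_apply]
  · refine ⟨F.symm (B.stabInc J _ _ _ b), ?_, 0, ?_⟩
    · rw [hsymm, ← stabInc_d hB, hb, map_zero, map_zero]
    · rw [hF, AlgEquiv.apply_symm_apply, stabProj_stabInc, map_zero, add_zero]

/-- The differential of `B` is known only through `φ`. Triangularity survives because `φ` does not
raise the rank: a generator `lo` goes to a polynomial in kept generators of lower rank. -/
theorem isSemiFreeDG : B.IsSemiFreeDG where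
  bimodule := C.bimodule hφ hA hd
  degree k := by
    rw [← hd, ← C.deg_keep]
    exact (C.isQuasiIso hφ hA hd).map_degree _ _ (hA.degree _)
  square := by
    have hB := C.bimodule hφ hA hd
    refine d_d_of_gen fun k => ?_
    rw [← hφ.map_keep, ← C.map_d hφ hA hd, ← C.map_d hφ hA hd, hA.square, map_zero]
  triangular := by
    refine ⟨fun k => C.rank (C.keep k), fun k => ?_⟩
    have key : ∀ n, ∀ g, C.rank g < n →
        φ (A.x g) ∈ B.subalg {h | C.rank (C.keep h) < n} := by
      intro n
      induction n with
      | zero => intro g hg; omega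
      | succ n ih =>
        refine C.cases (fun k hk => ?_) (fun j _ => ?_) (fun j hj => ?_)
        · rw [hφ.map_keep]; exact x_mem_subalg hk
        · rw [hφ.map_hi]; exact zero_mem _
        · rw [hφ.map_lo]
          refine map_mem_of_subalg φ _ (fun v => ?_) (fun g hg => ?_) (C.diff_hi j)
          · rw [hφ.map_e]; exact e_mem_subalg _ v
          · have : C.rank g < C.rank (C.lo j) := hg
            refine subalg_mono (fun h hh => ?_) (ih g (by omega))
            have : C.rank (C.keep h) < n := hh
            change C.rank (C.keep h) < n + 1
            omega
    rw [← hd]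
    refine map_mem_of_subalg φ _ (fun v => ?_) (fun g hg => ?_) (C.diff_keep k)
    · rw [hφ.map_e]; exact e_mem_subalg _ v
    · exact subalg_mono (fun h hh => lt_of_lt_of_le
        (show C.rank (C.keep h) < C.rank g + 1 from hh) hg) (key _ g (Nat.lt_succ_self _))

end Cancellation

end SemiFree

end CellDGA

/-! ### Cancellation inside stabilizations, and two successive cancellations. -/

namespace CellDGA

namespace SemiFree

variable {V : Type} [Fintype V]

namespace Cancellation

variable {A B : SemiFree V} {J : Type} (C : Cancellation A B J)

section Stabilize

variable (I : Type) (p q : I → V) (i : I → ℤ)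

/-- The rank of the generators of a stabilization. -/
def stabRank : (A.stabilize I p q i).Gen → ℕ
  | Sum.inl g => C.rank g + 1
  | Sum.inr _ => 0

/-- The sets of generators of a stabilization. -/
def stabSplit (K I J : Type) : K ⊕ ((I ⊕ J) ⊕ (I ⊕ J)) ≃ (K ⊕ (J ⊕ J)) ⊕ (I ⊕ I) where
  toFun := Sum.elim (fun k => Sum.inl (Sum.inl k)) (Sum.elim
    (Sum.elim (fun i => Sum.inr (Sum.inl i)) (fun j => Sum.inl (Sum.inr (Sum.inl j))))
    (Sum.elim (fun i => Sum.inr (Sum.inr i)) (fun j => Sum.inl (Sum.inr (Sum.inr j)))))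
  invFun := Sum.elim (Sum.elim (fun k => Sum.inl k) (Sum.elim
    (fun j => Sum.inr (Sum.inl (Sum.inr j))) (fun j => Sum.inr (Sum.inr (Sum.inr j)))))
    (Sum.elim (fun i => Sum.inr (Sum.inl (Sum.inl i))) (fun i => Sum.inr (Sum.inr (Sum.inl i))))
  left_inv := by rintro (k | (i | j) | (i | j)) <;> rfl
  right_inv := by rintro ((k | j | j) | i | i) <;> rfl

theorem stabInc_mem_subalg {n : ℕ} {a : A.Alg} (ha : a ∈ A.subalg {h | C.rank h < n}) :
    A.stabInc I p q i a ∈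
      (A.stabilize I p q i).subalg {h | C.stabRank I p q i h < n + 1} := by
  refine map_mem_of_subalg _ _ (fun v => ?_) (fun g hg => ?_) ha
  · rw [stabInc_e]; exact e_mem_subalg _ v
  · rw [stabInc_x]; exact x_mem_subalg (Nat.succ_lt_succ hg)

/-- A cancellation extends to every stabilization, in which the new generators are cancelled as
well. -/
def stab : Cancellation (A.stabilize I p q i) B (I ⊕ J) where
  keep k := stabOld (C.keep k)
  hi := Sum.elim stabHi (fun j => stabOld (C.hi j))
  lo := Sum.elim stabLo (fun j => stabOld (C.lo j))
  rank := C.stabRank I p q i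
  bij := by
    have h : Function.Bijective (Sum.map (Sum.elim C.keep (Sum.elim C.hi C.lo)) (id : I ⊕ I → I ⊕ I) ∘
        stabSplit B.Gen I J) :=
      (C.bij.sumMap Function.bijective_id).comp (stabSplit B.Gen I J).bijective
    have e : Sum.map (Sum.elim C.keep (Sum.elim C.hi C.lo)) (id : I ⊕ I → I ⊕ I) ∘
        stabSplit B.Gen I J =
          (Sum.elim (fun k => Sum.inl (C.keep k)) (Sum.elim
            (Sum.elim (fun i => Sum.inr (Sum.inl i)) (fun j => Sum.inl (C.hi j)))
            (Sum.elim (fun i => Sum.inr (Sum.inr i)) (fun j => Sum.inl (C.lo j))))) := by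
      funext x
      rcases x with k | (i | j) | (i | j) <;> rfl
    rw [e] at h
    exact h
  src_keep := C.src_keep
  tgt_keep := C.tgt_keep
  deg_keep := C.deg_keep
  src_lo := by rintro (j | j); exacts [rfl, C.src_lo j]
  tgt_lo := by rintro (j | j); exacts [rfl, C.tgt_lo j]
  deg_lo := by rintro (j | j); exacts [rfl, C.deg_lo j]
  rank_hi := by rintro (j | j); exacts [rfl, congrArg (· + 1) (C.rank_hi j)]
  diff_keep k := C.stabInc_mem_subalg I p q i (C.diff_keep k)
  diff_lo := by
    rintro (j | j)
    · exact zero_mem _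
    · exact C.stabInc_mem_subalg I p q i (C.diff_lo j)
  diff_hi := by
    rintro (j | j)
    -- A pair added by stabilization cancels without remainder, so it may be given rank `0`, below
    -- all old generators.
    · change (A.stabilize I p q i).x (stabLo j) + (A.stabilize I p q i).x (stabLo j) ∈ _
      rw [ZModModule.add_self]
      exact zero_mem _
    · have := C.stabInc_mem_subalg I p q i (C.diff_hi j)
      rw [map_add, stabInc_x] at this
      exact this

variable {I p q i}

theorem stabilize_isSemiFreeDG {A : SemiFree V} (hA : A.IsSemiFreeDG) :
    (A.stabilize I p q i).IsSemiFreeDG where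
  bimodule := stabilize_bimodule hA.bimodule
  degree := stabilize_degree hA.degree
  square := stabilize_square hA.bimodule hA.square
  triangular := by
    obtain ⟨r, hr⟩ := hA.triangular
    refine ⟨Sum.elim (fun g => r g + 2) (Sum.elim (fun _ => 1) (fun _ => 0)),
      stab_cases (fun g => ?_) (fun g => ?_) (fun g => ?_)⟩
    · refine map_mem_of_subalg (A.stabInc I p q i) _ (fun v => ?_) (fun h hh => ?_) (hr g)
      · rw [stabInc_e]; exact e_mem_subalg _ v
      · rw [stabInc_x]
        exact x_mem_subalg (Nat.add_lt_add_right (show r h < r g from hh) 2)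
    · exact x_mem_subalg (A := A.stabilize I p q i) (g := stabLo g) Nat.zero_lt_one
    · exact zero_mem _

/-- Cancellation yields a tame isomorphism of arbitrary stabilizations. -/
theorem tameIso_stabilize [Finite A.Gen] [Finite I] {φ : A.Alg →ₐ[ZMod 2] B.Alg}
    (hφ : C.IsQuotientMap φ) (hA : A.IsSemiFreeDG) (hd : ∀ k, φ (A.diff (C.keep k)) = B.diff k) :
    ∃ (p' q' : I ⊕ J → V) (i' : I ⊕ J → ℤ),
      TameIso (A.stabilize I p q i) (B.stabilize (I ⊕ J) p' q' i') := by
  have : Finite (A.stabilize I p q i).Gen := inferInstanceAs (Finite (A.Gen ⊕ (I ⊕ I)))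
  refine ⟨_, _, _, (C.stab I p q i).tameIso (φ := φ.comp (A.stabProj I p q i))
    ⟨fun v => ?_, fun k => ?_, ?_, ?_⟩ (stabilize_isSemiFreeDG hA) (fun k => ?_)⟩
  · rw [AlgHom.comp_apply, stabProj_e, hφ.map_e]
  · rw [AlgHom.comp_apply]
    exact (congrArg φ (stabProj_old _)).trans (hφ.map_keep k)
  · rintro (j | j)
    · exact (congrArg φ (stabProj_hi _)).trans (map_zero φ)
    · exact (congrArg φ (stabProj_old _)).trans (hφ.map_hi j)
  · rintro (j | j)
    · exact (congrArg φ (stabProj_lo _)).trans (map_zero φ)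
    · exact (congrArg φ (stabProj_stabInc _)).trans (hφ.map_diff_hi j)
  · exact (congrArg φ (stabProj_stabInc _)).trans (hd k)

end Stabilize

/-- The result of two successive cancellations. -/
theorem stableTameIso_of_two {A B D : SemiFree V} {J J' : Type} (C : Cancellation A B J)
    (C' : Cancellation B D J') [Finite A.Gen] [Finite B.Gen] [Finite J] [Finite J']
    {φ : A.Alg →ₐ[ZMod 2] B.Alg} {ψ : B.Alg →ₐ[ZMod 2] D.Alg}
    (hφ : C.IsQuotientMap φ) (hψ : C'.IsQuotientMap ψ) (hA : A.IsSemiFreeDG)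
    (hd : ∀ k, φ (A.diff (C.keep k)) = B.diff k) (hd' : ∀ k, ψ (B.diff (C'.keep k)) = D.diff k) :
    StableTameIso A D := by
  -- The first cancellation identifies `A`, stabilized by nothing, with a stabilization of `B`. The
  -- second is carried out inside that same stabilization, so that the tame isomorphisms can be
  -- composed.
  obtain ⟨p, q, i, h⟩ := C.tameIso_stabilize (I := Empty) (p := Empty.elim) (q := Empty.elim)
    (i := Empty.elim) hφ hA hd
  obtain ⟨p', q', i', h'⟩ := C'.tameIso_stabilize (p := p) (q := q) (i := i) hψ
    (C.isSemiFreeDG hφ hA hd) hd'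
  exact ⟨_, _, inferInstance, inferInstance, _, _, _, p', q', i', h.trans h'⟩

end Cancellation

end SemiFree

end CellDGA

namespace CellDGA

/-! ## Formal noncommutative polynomials -/

/-- Noncommutative polynomials over `ZMod 2` in letters `T`, as lists of words. -/
abbrev NCPoly (T : Type) : Type := List (List T)

namespace NCPoly

variable {T T' : Type} {R : Type*} [Ring R]

/-- The product of two polynomials. -/
def mul (p q : NCPoly T) : NCPoly T := p.flatMap fun a => q.map (a ++ ·)

/-- Evaluation of a polynomial. -/
def eval (f : T → R) (p : NCPoly T) : R := (p.map fun w => (w.map f).prod).sum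

@[simp] theorem eval_nil (f : T → R) : eval f [] = 0 := rfl

@[simp] theorem eval_cons (f : T → R) (w : List T) (p : NCPoly T) :
    eval f (w :: p) = (w.map f).prod + eval f p := by simp [eval]

@[simp] theorem eval_append (f : T → R) (p q : NCPoly T) : eval f (p ++ q) = eval f p + eval f q := by
  simp [eval]

theorem eval_map_append (f : T → R) (a : List T) (q : NCPoly T) :
    eval f (q.map (a ++ ·)) = (a.map f).prod * eval f q := by
  induction q with
  | nil => simp
  | cons w q ih => simp [ih, mul_add]

@[simp] theorem eval_mul (f : T → R) (p q : NCPoly T) : eval f (mul p q) = eval f p * eval f q := by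
  induction p with
  | nil => simp [mul]
  | cons a p ih =>
    have : mul (a :: p) q = q.map (a ++ ·) ++ mul p q := rfl
    rw [this, eval_append, eval_map_append, ih, eval_cons, add_mul]

/-- Substitution of polynomials for the letters of a word. -/
def substWord (g : T → NCPoly T') : List T → NCPoly T'
  | [] => [[]]
  | a :: w => mul (g a) (substWord g w)

/-- Substitution of polynomials for the letters. -/
def subst (g : T → NCPoly T') (p : NCPoly T) : NCPoly T' := p.flatMap (substWord g)

theorem eval_substWord (f : T' → R) (g : T → NCPoly T') (w : List T) :
    eval f (substWord g w) = (w.map fun a => eval f (g a)).prod := by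
  induction w with
  | nil => simp [substWord]
  | cons a w ih => simp [substWord, ih]

@[simp] theorem eval_subst (f : T' → R) (g : T → NCPoly T') (p : NCPoly T) :
    eval f (subst g p) = eval (fun a => eval f (g a)) p := by
  induction p with
  | nil => simp [subst]
  | cons w p ih =>
    have : subst g (w :: p) = substWord g w ++ subst g p := rfl
    rw [this, eval_append, eval_substWord, ih, eval_cons]

theorem map_eval {R' : Type*} [Ring R'] (φ : R →+* R') (f : T → R) (p : NCPoly T) :
    φ (eval f p) = eval (φ ∘ f) p := by
  induction p with
  | nil => simp
  | cons w p ih => simp [ih, map_list_prod]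

/-- The derivation of the free algebra with given values on the letters, applied to a word. -/
def derWord (δ : T → NCPoly T) : List T → NCPoly T
  | [] => []
  | a :: w => mul (δ a) [w] ++ mul [[a]] (derWord δ w)

/-- The derivation of the free algebra with given values on the letters. -/
def der (δ : T → NCPoly T) (p : NCPoly T) : NCPoly T := p.flatMap (derWord δ)

/-- Differentials of matrix entries can thus be computed on words. -/
theorem eval_der (f : T → R) (δ : T → NCPoly T) (d : R →+ R) (h1 : d 1 = 0)
    (hd : ∀ a b, d (a * b) = d a * b + a * d b) (h : ∀ a, d (f a) = eval f (δ a)) (p : NCPoly T) :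
    eval f (der δ p) = d (eval f p) := by
  have hw : ∀ w : List T, eval f (derWord δ w) = d (w.map f).prod := by
    intro w
    induction w with
    | nil => simp [derWord, h1]
    | cons a w ih => simp [derWord, ih, hd, h]
  induction p with
  | nil => simp [der]
  | cons w p ih =>
    have : der δ (w :: p) = derWord δ w ++ der δ p := rfl
    rw [this, eval_append, hw, ih, eval_cons, map_add]

section Cancel

variable [DecidableEq T]

/-- Adds a word modulo 2. -/
def toggle (w : List T) : NCPoly T → NCPoly T
  | [] => [w]
  | u :: p => if w = u then p else u :: toggle w p

/-- Cancels equal words in pairs. -/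
def cancel : NCPoly T → NCPoly T
  | [] => []
  | w :: p => toggle w (cancel p)

theorem eval_toggle (h2 : ∀ a : R, a + a = 0) (f : T → R) (w : List T) (p : NCPoly T) :
    eval f (toggle w p) = (w.map f).prod + eval f p := by
  induction p with
  | nil => simp [toggle]
  | cons u p ih =>
    rw [toggle]
    split_ifs with h
    · rw [h, eval_cons, ← add_assoc, h2, zero_add]
    · rw [eval_cons, ih, eval_cons, add_left_comm]

theorem eval_cancel (h2 : ∀ a : R, a + a = 0) (f : T → R) (p : NCPoly T) :
    eval f (cancel p) = eval f p := by
  induction p with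
  | nil => rfl
  | cons w p ih => rw [cancel, eval_toggle h2, ih, eval_cons]

end Cancel

/-! ### Matrices of polynomials -/

section Matrix

variable {S : Type}

/-- Matrices of polynomials. -/
abbrev Mat (S T : Type) : Type := S → S → NCPoly T

/-- Evaluation of a matrix of polynomials. -/
def evalMat (f : T → R) (M : Mat S T) : Matrix S S R := Matrix.of fun s t => eval f (M s t)

theorem evalMat_apply (f : T → R) (M : Mat S T) (s t : S) : evalMat f M s t = eval f (M s t) := rfl

/-- The sum of two matrices. -/
def matAdd (M N : Mat S T) : Mat S T := fun s t => M s t ++ N s t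

/-- The identity matrix. -/
def matOne [DecidableEq S] : Mat S T := fun s t => if s = t then [[]] else []

theorem eval_flatMap_mul (f : T → R) (l : List S) (M N : S → NCPoly T) :
    eval f (l.flatMap fun u => mul (M u) (N u)) =
      (l.map fun u => eval f (M u) * eval f (N u)).sum := by
  induction l with
  | nil => rfl
  | cons u l ih => rw [List.flatMap_cons, eval_append, ih, eval_mul, List.map_cons, List.sum_cons]

theorem evalMat_add (f : T → R) (M N : Mat S T) :
    evalMat f (matAdd M N) = evalMat f M + evalMat f N := by
  ext s t; exact eval_append _ _ _

theorem evalMat_one [DecidableEq S] (f : T → R) : evalMat f (matOne : Mat S T) = 1 := by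
  ext s t
  rw [evalMat_apply, matOne, Matrix.one_apply]
  split_ifs <;> simp

end Matrix

/-! ### Letters of two kinds: idempotents and generators -/

section Typed

variable {I G : Type} [DecidableEq I] (src tgt : G → I)

/-- Multiplies a word by a letter on the left, where idempotents are absorbed. -/
def glue : I ⊕ G → List (I ⊕ G) → List (I ⊕ G)
  | a, [] => [a]
  | Sum.inl i, b :: w => if Sum.elim id src b = i then b :: w else Sum.inl i :: b :: w
  | Sum.inr g, Sum.inl i :: w => if tgt g = i then Sum.inr g :: w else Sum.inr g :: Sum.inl i :: w
  | Sum.inr g, Sum.inr h :: w => Sum.inr g :: Sum.inr h :: w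

/-- Absorbs the idempotents in a word. -/
def absorb : List (I ⊕ G) → List (I ⊕ G)
  | [] => []
  | a :: w => glue src tgt a (absorb w)

/-- The normal form of a polynomial. -/
def normal [DecidableEq G] (p : NCPoly (I ⊕ G)) : NCPoly (I ⊕ G) := cancel (p.map (absorb src tgt))

/-- A word is a nonempty path from `i` to `j`. -/
def IsPathWord : I → I → List (I ⊕ G) → Bool
  | _, _, [] => false
  | i, j, [a] => decide (Sum.elim id src a = i) && decide (Sum.elim id tgt a = j)
  | i, j, a :: b :: w =>
    decide (Sum.elim id src a = i) && IsPathWord (Sum.elim id tgt a) j (b :: w)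

/-- Only absorption of idempotents and cancellation modulo 2 are used. Orthogonality of idempotents
is not, so the statement remains available when different components are sent to one element of `V`.
-/
theorem eval_normal [DecidableEq G] (h2 : ∀ a : R, a + a = 0) (f : I ⊕ G → R)
    (hi : ∀ i, f (Sum.inl i) * f (Sum.inl i) = f (Sum.inl i))
    (hs : ∀ g, f (Sum.inl (src g)) * f (Sum.inr g) = f (Sum.inr g))
    (ht : ∀ g, f (Sum.inr g) * f (Sum.inl (tgt g)) = f (Sum.inr g)) (p : NCPoly (I ⊕ G)) :
    eval f (normal src tgt p) = eval f p := by
  have hg : ∀ (a : I ⊕ G) (w : List (I ⊕ G)),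
      ((glue src tgt a w).map f).prod = f a * (w.map f).prod := by
    intro a w
    rcases a with i | g <;> rcases w with _ | ⟨j | h, w⟩ <;> simp only [glue]
    · simp
    · split_ifs with hj
      · obtain rfl : j = i := hj
        simp [← mul_assoc, hi]
      · simp
    · split_ifs with hj
      · obtain rfl : src h = i := hj
        simp [← mul_assoc, hs]
      · simp
    · simp
    · split_ifs with hj
      · subst hj
        simp [← mul_assoc, ht]
      · simp
    · simp
  have hw : ∀ w : List (I ⊕ G), ((absorb src tgt w).map f).prod = (w.map f).prod := by
    intro w
    induction w with
    | nil => rfl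
    | cons a w ih => rw [absorb, hg, ih, List.map_cons, List.prod_cons]
  rw [normal, eval_cancel h2]
  simp only [eval, List.map_map]
  congr 2
  funext w
  exact hw w

end Typed

end NCPoly

/-! ### Semi-free algebras presented by formal polynomials. -/

namespace SemiFree

open CellDGA.NCPoly

variable {V : Type} [Fintype V] {A B : SemiFree V} {I G G' : Type} {π : I → V}

/-- A presentation of a semi-free algebra by formal polynomials.  The generators are labelled by a
subset of `G`; their endpoints come from `I`, and the idempotents occur as letters. -/
structure Presentation (A : SemiFree V) (π : I → V) (G : Type) where
  mem : G → Prop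
  src : G → I
  tgt : G → I
  deg : G → ℤ
  diff : G → NCPoly (I ⊕ G)
  label : A.Gen → G
  val : G → A.Alg
  label_injective : Function.Injective label
  mem_iff : ∀ r, mem r ↔ ∃ g, label g = r
  val_label : ∀ g, val (label g) = A.x g
  val_of_not_mem : ∀ r, ¬ mem r → val r = 0
  src_label : ∀ g, A.src g = π (src (label g))
  tgt_label : ∀ g, A.tgt g = π (tgt (label g))
  deg_label : ∀ g, A.deg g = deg (label g)
  diff_label : ∀ g, A.diff g = eval (Sum.elim (fun i => A.e (π i)) val) (diff (label g))

namespace Presentation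

variable (P : Presentation A π G)

/-- The elements of the algebra that are represented by the letters. -/
abbrev letter : I ⊕ G → A.Alg := Sum.elim (fun i => A.e (π i)) P.val

theorem mem_label (g : A.Gen) : P.mem (P.label g) := (P.mem_iff _).2 ⟨g, rfl⟩

theorem val_mem_corner (r : G) : P.val r ∈ A.corner (π (P.src r)) (π (P.tgt r)) := by
  by_cases h : P.mem r
  · obtain ⟨g, rfl⟩ := (P.mem_iff r).1 h
    rw [P.val_label, ← P.src_label, ← P.tgt_label]
    exact x_mem_corner g
  · rw [P.val_of_not_mem r h]
    exact zero_mem _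

theorem letter_mem_corner (a : I ⊕ G) :
    P.letter a ∈ A.corner (π (Sum.elim id P.src a)) (π (Sum.elim id P.tgt a)) := by
  rcases a with i | r
  · exact e_mem_corner _
  · exact P.val_mem_corner r

theorem eval_mem (N : Submodule (ZMod 2) A.Alg) {p : NCPoly (I ⊕ G)}
    (h : ∀ w ∈ p, (w.map P.letter).prod ∈ N) : eval P.letter p ∈ N := by
  refine list_sum_mem fun a ha => ?_
  obtain ⟨w, hw, rfl⟩ := List.mem_map.1 ha
  exact h w hw

theorem eval_mem_corner [DecidableEq I] {i j : I} {p : NCPoly (I ⊕ G)}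
    (h : ∀ w ∈ p, IsPathWord P.src P.tgt i j w = true) :
    eval P.letter p ∈ A.corner (π i) (π j) := by
  have hw : ∀ w i, IsPathWord P.src P.tgt i j w = true →
      (w.map P.letter).prod ∈ A.corner (π i) (π j) := by
    intro w
    induction w with
    | nil => intro i h; simp [IsPathWord] at h
    | cons a w ih =>
      intro i h
      have ha := P.letter_mem_corner a
      rcases w with _ | ⟨b, w⟩
      · simp only [IsPathWord, Bool.and_eq_true, decide_eq_true_eq] at h
        rw [h.1, h.2] at ha
        simpa using ha
      · simp only [IsPathWord, Bool.and_eq_true, decide_eq_true_eq] at h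
        rw [h.1] at ha
        rw [List.map_cons, List.prod_cons]
        exact mul_mem_corner ha (ih _ h.2)
  exact P.eval_mem _ fun w h' => hw w i (h w h')

theorem eval_mem_degreePart {n : ℤ} {p : NCPoly (I ⊕ G)}
    (h : ∀ w ∈ p, (w.map (Sum.elim (fun _ => 0) P.deg)).sum = n) :
    eval P.letter p ∈ A.degreePart n := by
  have ha : ∀ a, P.letter a ∈ A.degreePart (Sum.elim (fun _ => 0) P.deg a) := by
    rintro (i | r)
    · exact e_mem_degreePart _
    · change P.val r ∈ A.degreePart (P.deg r)
      by_cases h : P.mem r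
      · obtain ⟨g, rfl⟩ := (P.mem_iff r).1 h
        rw [P.val_label, ← P.deg_label]
        exact x_mem_degreePart g
      · rw [P.val_of_not_mem r h]
        exact zero_mem _
  refine P.eval_mem _ fun w hw => ?_
  rw [← h w hw]
  generalize w = w
  induction w with
  | nil => exact one_mem_degreePart
  | cons a w ih => exact mul_mem_degreePart (ha a) ih

/-- The generators that occur in a polynomial have rank less than `n`. -/
def IsBelow (rank : G → ℕ) (n : ℕ) (p : NCPoly (I ⊕ G)) : Bool :=
  p.all fun w => w.all (Sum.elim (fun _ => true) fun g => decide (rank g < n))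

theorem eval_mem_subalg {rank : G → ℕ} {n : ℕ} {p : NCPoly (I ⊕ G)} (h : IsBelow rank n p = true) :
    eval P.letter p ∈ A.subalg {g | rank (P.label g) < n} := by
  refine P.eval_mem (Subalgebra.toSubmodule (A.subalg {g | rank (P.label g) < n})) fun w hw =>
    list_prod_mem (S := A.subalg {g | rank (P.label g) < n}) (l := w.map P.letter) fun a ha => ?_
  obtain ⟨b, hb, rfl⟩ := List.mem_map.1 ha
  have hb' := List.all_eq_true.1 (List.all_eq_true.1 h w hw) b hb
  rcases b with i | r
  · exact e_mem_subalg _ _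
  · change P.val r ∈ _
    by_cases h : P.mem r
    · obtain ⟨g, rfl⟩ := (P.mem_iff r).1 h
      rw [P.val_label]
      exact x_mem_subalg (of_decide_eq_true hb')
    · rw [P.val_of_not_mem r h]
      exact zero_mem _

theorem eval_normal [DecidableEq I] [DecidableEq G] (p : NCPoly (I ⊕ G)) :
    eval P.letter (normal P.src P.tgt p) = eval P.letter p :=
  NCPoly.eval_normal P.src P.tgt ZModModule.add_self P.letter (fun _ => idem_mul_self _ _ _)
    (fun g => e_mul_of_mem_corner (P.val_mem_corner g))
    (fun g => mul_e_of_mem_corner (P.val_mem_corner g)) p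

/-- Modulo 2 an equation amounts to the vanishing of a sum, so it suffices that `p ++ q` normalizes
to nothing. -/
theorem eval_eq_of_normal [DecidableEq I] [DecidableEq G] {p q : NCPoly (I ⊕ G)}
    (h : normal P.src P.tgt (p ++ q) = []) : eval P.letter p = eval P.letter q := by
  have := P.eval_normal (p ++ q)
  rw [h, eval_nil, eval_append] at this
  exact sub_eq_zero.1 (by rw [ZModModule.sub_eq_add, ← this])

/-- All conditions but `d² = 0` can be read off the individual words; `d² = 0` is left as an input
to be supplied by matrix identities. -/
theorem isSemiFreeDG [DecidableEq I] {rank : G → ℕ}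
    (path : ∀ r, P.mem r → ∀ w ∈ P.diff r, IsPathWord P.src P.tgt (P.src r) (P.tgt r) w = true)
    (degree : ∀ r, P.mem r → ∀ w ∈ P.diff r,
      (w.map (Sum.elim (fun _ => 0) P.deg)).sum = P.deg r + 1)
    (below : ∀ r, P.mem r → IsBelow rank (rank r) (P.diff r) = true)
    (square : (∀ g, A.diff g ∈ A.corner (A.src g) (A.tgt g)) → ∀ g, A.d (A.diff g) = 0) :
    A.IsSemiFreeDG := by
  have hb : ∀ g, A.diff g ∈ A.corner (A.src g) (A.tgt g) := fun g => by
    rw [P.diff_label, P.src_label, P.tgt_label]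
    exact P.eval_mem_corner (path _ (P.mem_label g))
  refine ⟨hb, fun g => ?_, d_d_of_gen fun g => ?_, rank ∘ P.label, fun g => ?_⟩
  · rw [P.diff_label, P.deg_label]
    exact P.eval_mem_degreePart (degree _ (P.mem_label g))
  · rw [d_x (hb g)]
    exact square hb g
  · rw [P.diff_label]
    exact P.eval_mem_subalg (below _ (P.mem_label g))

end Presentation

/-! ### Cancellations given by finite tables. -/

/-- The role of a generator in a cancellation. -/
inductive Status : Type
  | keep | hi | lo
  deriving DecidableEq

open Presentation

/-- A cancellation in terms of presentations. -/
structure Matching [DecidableEq I] [DecidableEq G] (P : Presentation A π G)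
    (P' : Presentation B π G') where
  status : G → Status
  up : G → G
  down : G → G
  kept : G' → G
  name : G → G'
  rank : G → ℕ
  lo_spec : ∀ r, P.mem r → status r = .lo → P.mem (up r) ∧ status (up r) = .hi ∧ down (up r) = r ∧
    P.src (up r) = P.src r ∧ P.tgt (up r) = P.tgt r ∧ P.deg r = P.deg (up r) + 1 ∧
    rank (up r) = rank r
  hi_spec : ∀ r, P.mem r → status r = .hi → P.mem (down r) ∧ status (down r) = .lo ∧
    up (down r) = r
  kept_spec : ∀ k, P'.mem k → P.mem (kept k) ∧ status (kept k) = .keep ∧ name (kept k) = k ∧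
    P.src (kept k) = P'.src k ∧ P.tgt (kept k) = P'.tgt k ∧ P.deg (kept k) = P'.deg k
  name_spec : ∀ r, P.mem r → status r = .keep → P'.mem (name r) ∧ kept (name r) = r
  diff_below : ∀ r, P.mem r → status r ≠ .hi → IsBelow rank (rank r) (P.diff r) = true
  diff_up : ∀ r, P.mem r → status r = .lo →
    IsBelow rank (rank r) (normal P.src P.tgt ([Sum.inr r] :: P.diff (up r))) = true

namespace Matching

variable [DecidableEq I] [DecidableEq G] {P : Presentation A π G} {P' : Presentation B π G'}
  (M : Matching P P')

/-- The generators that are cancelled as boundaries. -/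
abbrev Low : Type := {g : A.Gen // M.status (P.label g) = .lo}

theorem exists_kept (k : B.Gen) : ∃ g, P.label g = M.kept (P'.label k) :=
  (P.mem_iff _).1 (M.kept_spec _ (P'.mem_label k)).1

theorem exists_up (j : M.Low) : ∃ g, P.label g = M.up (P.label j) :=
  (P.mem_iff _).1 (M.lo_spec _ (P.mem_label _) j.2).1

/-- The generator of `A` that corresponds to a generator of `B`. -/
noncomputable def keepGen (k : B.Gen) : A.Gen := (M.exists_kept k).choose

/-- The generator with which a boundary is cancelled. -/
noncomputable def hiGen (j : M.Low) : A.Gen := (M.exists_up j).choose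

theorem label_keepGen (k : B.Gen) : P.label (M.keepGen k) = M.kept (P'.label k) :=
  (M.exists_kept k).choose_spec

theorem label_hiGen (j : M.Low) : P.label (M.hiGen j) = M.up (P.label j) :=
  (M.exists_up j).choose_spec

theorem status_keepGen (k : B.Gen) : M.status (P.label (M.keepGen k)) = .keep := by
  rw [label_keepGen]; exact (M.kept_spec _ (P'.mem_label k)).2.1

theorem status_hiGen (j : M.Low) : M.status (P.label (M.hiGen j)) = .hi := by
  rw [label_hiGen]; exact (M.lo_spec _ (P.mem_label _) j.2).2.1

/-- The three roles are disjoint and exhaust the generators. Within each role `name`, `down` and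
`up` provide the inverses. -/
theorem bijective :
    Function.Bijective (Sum.elim M.keepGen (Sum.elim M.hiGen (Subtype.val : M.Low → A.Gen))) := by
  constructor
  · have h1 : Function.Injective M.keepGen := fun k k' h => by
      have := congrArg (fun g => M.name (P.label g)) h
      simp only [label_keepGen, (M.kept_spec _ (P'.mem_label _)).2.2.1] at this
      exact P'.label_injective this
    have h2 : Function.Injective M.hiGen := fun j j' h => by
      have := congrArg (fun g => M.down (P.label g)) h
      simp only [label_hiGen, (M.lo_spec _ (P.mem_label _) j.2).2.2.1,
        (M.lo_spec _ (P.mem_label _) j'.2).2.2.1] at this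
      exact Subtype.ext (P.label_injective this)
    refine Function.Injective.sumElim h1 (Function.Injective.sumElim h2 Subtype.val_injective ?_) ?_
    · intro j j' h
      have := M.status_hiGen j
      rw [h, j'.2] at this
      cases this
    · rintro k (j | j) h
      · have := M.status_keepGen k
        rw [h, Sum.elim_inl, M.status_hiGen] at this
        cases this
      · have := M.status_keepGen k
        rw [h, Sum.elim_inr, j.2] at this
        cases this
  · intro g
    rcases h : M.status (P.label g) with _ | _ | _
    · obtain ⟨h1, h2⟩ := M.name_spec _ (P.mem_label g) h
      obtain ⟨k, hk⟩ := (P'.mem_iff _).1 h1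
      refine ⟨Sum.inl k, P.label_injective ?_⟩
      rw [Sum.elim_inl, label_keepGen, hk, h2]
    · obtain ⟨h1, h2, h3⟩ := M.hi_spec _ (P.mem_label g) h
      obtain ⟨j, hj⟩ := (P.mem_iff _).1 h1
      refine ⟨Sum.inr (Sum.inl ⟨j, by rw [hj]; exact h2⟩), P.label_injective ?_⟩
      rw [Sum.elim_inr, Sum.elim_inl, label_hiGen, hj, h3]
    · exact ⟨Sum.inr (Sum.inr ⟨g, h⟩), rfl⟩

/-- The cancellation that is given by a matching. -/
noncomputable def cancellation : Cancellation A B M.Low where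
  keep := M.keepGen
  hi := M.hiGen
  lo := Subtype.val
  rank g := M.rank (P.label g)
  bij := M.bijective
  src_keep k := by
    rw [P.src_label, label_keepGen, (M.kept_spec _ (P'.mem_label k)).2.2.2.1, P'.src_label]
  tgt_keep k := by
    rw [P.tgt_label, label_keepGen, (M.kept_spec _ (P'.mem_label k)).2.2.2.2.1, P'.tgt_label]
  deg_keep k := by
    rw [P.deg_label, label_keepGen, (M.kept_spec _ (P'.mem_label k)).2.2.2.2.2, P'.deg_label]
  src_lo j := by
    rw [P.src_label, P.src_label, label_hiGen, (M.lo_spec _ (P.mem_label _) j.2).2.2.2.1]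
  tgt_lo j := by
    rw [P.tgt_label, P.tgt_label, label_hiGen, (M.lo_spec _ (P.mem_label _) j.2).2.2.2.2.1]
  deg_lo j := by
    rw [P.deg_label, P.deg_label, label_hiGen, (M.lo_spec _ (P.mem_label _) j.2).2.2.2.2.2.1]
  rank_hi j := by
    rw [label_hiGen, (M.lo_spec _ (P.mem_label _) j.2).2.2.2.2.2.2]
  diff_keep k := by
    rw [P.diff_label]
    exact P.eval_mem_subalg (M.diff_below _ (P.mem_label _) (by rw [status_keepGen]; decide))
  diff_lo j := by
    rw [P.diff_label]
    exact P.eval_mem_subalg (M.diff_below _ (P.mem_label _) (by rw [j.2]; decide))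
  diff_hi j := by
    have := P.eval_mem_subalg (M.diff_up _ (P.mem_label _) j.2)
    rw [P.eval_normal, eval_cons, ← label_hiGen, ← P.diff_label] at this
    simpa [P.val_label] using this

/-- The values of the quotient map on the generators. -/
structure IsValue [DecidableEq G'] (value : G → NCPoly (I ⊕ G')) : Prop where
  not_mem : ∀ r, ¬ P.mem r → value r = []
  path : ∀ r, P.mem r → ∀ w ∈ value r, IsPathWord P'.src P'.tgt (P.src r) (P.tgt r) w = true
  keep : ∀ r, P.mem r → M.status r = .keep → value r = [[Sum.inr (M.name r)]]
  hi : ∀ r, P.mem r → M.status r = .hi → value r = []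
  diff_hi : ∀ r, P.mem r → M.status r = .hi →
    normal P'.src P'.tgt (subst (Sum.elim (fun i => [[Sum.inl i]]) value) (P.diff r)) = []
  diff_keep : ∀ r, P.mem r → M.status r = .keep →
    eval P'.letter (subst (Sum.elim (fun i => [[Sum.inl i]]) value) (P.diff r)) =
      eval P'.letter (P'.diff (M.name r))

/-- The values on generators `lo` need no derivation from the recursion. A table is right as soon as
substituting it into the differentials of the generators `hi` gives zero. -/
theorem IsValue.exists_quotientMap [DecidableEq G'] {M : Matching P P'} {value : G → NCPoly (I ⊕ G')}
    (hv : M.IsValue value) :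
    ∃ φ : A.Alg →ₐ[ZMod 2] B.Alg, M.cancellation.IsQuotientMap φ ∧
      (∀ k, φ (A.diff (M.cancellation.keep k)) = B.diff k) ∧
      ∀ r, φ (P.val r) = eval P'.letter (value r) := by
  obtain ⟨φ, he, hx⟩ := exists_algHom (fun g => eval P'.letter (value (P.label g))) (fun g => by
    rw [P.src_label, P.tgt_label]
    exact P'.eval_mem_corner (hv.path _ (P.mem_label g)))
  have hval : ∀ r, φ (P.val r) = eval P'.letter (value r) := by
    intro r
    by_cases h : P.mem r
    · obtain ⟨g, rfl⟩ := (P.mem_iff r).1 h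
      rw [P.val_label, hx]
    · rw [P.val_of_not_mem r h, hv.not_mem r h, map_zero, eval_nil]
  have hp : ∀ p : NCPoly (I ⊕ G), φ (eval P.letter p) =
      eval P'.letter (subst (Sum.elim (fun i => [[Sum.inl i]]) value) p) := by
    intro p
    rw [eval_subst]
    refine (map_eval (φ : A.Alg →+* B.Alg) _ p).trans ?_
    congr 1
    funext a
    rcases a with i | r
    · simp [he]
    · exact hval r
  refine ⟨φ, ⟨he, fun k => ?_, fun j => ?_, fun j => ?_⟩, fun k => ?_, hval⟩
  · change φ (A.x (M.keepGen k)) = _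
    rw [hx, hv.keep _ (P.mem_label _) (M.status_keepGen k), M.label_keepGen,
      (M.kept_spec _ (P'.mem_label k)).2.2.1]
    simp [P'.val_label]
  · change φ (A.x (M.hiGen j)) = 0
    rw [hx, hv.hi _ (P.mem_label _) (M.status_hiGen j), eval_nil]
  · change φ (A.diff (M.hiGen j)) = 0
    rw [P.diff_label, hp, ← P'.eval_normal, hv.diff_hi _ (P.mem_label _) (M.status_hiGen j),
      eval_nil]
  · change φ (A.diff (M.keepGen k)) = _
    rw [P.diff_label, hp, hv.diff_keep _ (P.mem_label _) (M.status_keepGen k), P'.diff_label,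
      M.label_keepGen, (M.kept_spec _ (P'.mem_label k)).2.2.1]

end Matching

end SemiFree

end CellDGA

namespace CellDGA

open NCPoly SemiFree Comp222 K0 K1 K2

/-! ## Formal cellular matrices -/

/-- Decidable equality of cells. -/
def Cell.decEq {K0 K1 K2 : Type} [DecidableEq K0] [DecidableEq K1] [DecidableEq K2] :
    (c c' : Cell K0 K1 K2) → Decidable (c = c')
  | .vert v, .vert w => decidable_of_iff (v = w) (by simp)
  | .edge v, .edge w => decidable_of_iff (v = w) (by simp)
  | .face v, .face w => decidable_of_iff (v = w) (by simp)
  | .vert _, .edge _ => isFalse (by simp)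
  | .vert _, .face _ => isFalse (by simp)
  | .edge _, .vert _ => isFalse (by simp)
  | .edge _, .face _ => isFalse (by simp)
  | .face _, .vert _ => isFalse (by simp)
  | .face _, .edge _ => isFalse (by simp)

instance {K0 K1 K2 : Type} [DecidableEq K0] [DecidableEq K1] [DecidableEq K2] :
    DecidableEq (Cell K0 K1 K2) := Cell.decEq

/-- A cell and a pair of sheets. -/
abbrev Label222 : Type := Cell K0 K1 K2 × Sheet222 × Sheet222

/-- The letters of the formal polynomials. -/
abbrev Letter222 : Type := Comp222 ⊕ Label222

/-- The sheet `s` lies strictly above the sheet `t` over the cell `c`. -/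
def Over (c : Cell K0 K1 K2) (s t : Sheet222) : Prop := Above (stack222 c) s t

/-- All sheets. -/
def sheets222 : List Sheet222 :=
  [U A, L A, U B, L B, U P, L P, U Q, L Q, U R, L R]

/-- The cells. -/
def cells222 : List (Cell K0 K1 K2) :=
  [v1, v2, v3, v4, v5, v6, v7, v8, v9, v10, v11, v12].map .vert ++
  [e0, e1, e2, e3, e4, e5, e6, e7, e8, e9, e10, e11, e12, e13, e14, e15, e16, e17, e18, e19, e20,
    e21].map .edge ++
  [f1, f2, f3, f4, f5, f6, f7, f8, f9, f10, f11].map .face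

theorem mem_sheets222 : ∀ s, s ∈ sheets222 := by decide

theorem mem_cells222 : ∀ c, c ∈ cells222 := by
  rintro (c | c | c) <;> cases c <;> decide

/-- The position of the first block that contains `s`, starting with `1`, or `0`. -/
def posIn (s : Sheet222) : List (List Sheet222) → ℕ
  | [] => 0
  | L :: M => if s ∈ L then 1 else if posIn s M = 0 then 0 else posIn s M + 1

/-- The relation `Over c` in terms of positions. -/
def overBool (c : Cell K0 K1 K2) (s t : Sheet222) : Bool :=
  Nat.blt 0 (posIn s (stack222 c)) && Nat.blt (posIn s (stack222 c)) (posIn t (stack222 c))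

/-- Comparing positions is a cheaper decision procedure than unfolding `Above`; the instance for
`Over` used in the computations below rests on it. -/
theorem overBool_eq : (cells222.all fun c => sheets222.all fun s => sheets222.all fun t =>
    overBool c s t == decide (Above (stack222 c) s t)) = true := by
  decide +kernel

theorem over_iff (c : Cell K0 K1 K2) (s t : Sheet222) : overBool c s t = true ↔ Over c s t := by
  have := List.all_eq_true.1 (List.all_eq_true.1 (List.all_eq_true.1 overBool_eq c
    (mem_cells222 c)) s (mem_sheets222 s)) t (mem_sheets222 t)
  rw [eq_of_beq this, decide_eq_true_iff]
  rfl

instance (c : Cell K0 K1 K2) (s t : Sheet222) : Decidable (Over c s t) :=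
  decidable_of_iff _ (over_iff c s t)

theorem over_iff_pos (c : Cell K0 K1 K2) (s t : Sheet222) : Over c s t ↔
    0 < posIn s (stack222 c) ∧ posIn s (stack222 c) < posIn t (stack222 c) := by
  rw [← over_iff, overBool, Bool.and_eq_true, Nat.blt_eq, Nat.blt_eq]

theorem Over.trans {c : Cell K0 K1 K2} {s t u : Sheet222} (h : Over c s t) (h' : Over c t u) :
    Over c s u := by
  rw [over_iff_pos] at *
  omega

theorem Over.ne {c : Cell K0 K1 K2} {s t : Sheet222} (h : Over c s t) : s ≠ t := by
  rintro rfl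
  rw [over_iff_pos] at h
  omega

/-- The sheets in the blocks between those of `s` and `t`, inclusively. -/
def between (c : Cell K0 K1 K2) (s t : Sheet222) : List Sheet222 :=
  (((stack222 c).drop (posIn s (stack222 c) - 1)).take
    (posIn t (stack222 c) - posIn s (stack222 c) + 1)).flatten

theorem mem_flatten_take_drop {u : Sheet222} : ∀ (M : List (List Sheet222)) {a b : ℕ},
    a < posIn u M → posIn u M ≤ a + b → u ∈ ((M.drop a).take b).flatten
  | [], a, b, h, _ => absurd h (Nat.not_lt_zero _)
  | L :: M, a, b, h, h' => by
    rw [posIn] at h h'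
    by_cases hu : u ∈ L
    · rw [if_pos hu] at h h'
      obtain rfl : a = 0 := by omega
      obtain ⟨b, rfl⟩ : ∃ n, b = n + 1 := ⟨b - 1, by omega⟩
      simp [hu]
    · rw [if_neg hu] at h h'
      by_cases h0 : posIn u M = 0
      · rw [if_pos h0] at h
        omega
      · rw [if_neg h0] at h h'
        rcases a with _ | a
        · obtain ⟨b, rfl⟩ : ∃ n, b = n + 1 := ⟨b - 1, by omega⟩
          have := mem_flatten_take_drop M (u := u) (a := 0) (b := b) (by omega) (by omega)
          simp only [List.drop_zero] at this ⊢
          simp [hu, this]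
        · exact mem_flatten_take_drop M (by omega) (by omega)

theorem mem_between {c : Cell K0 K1 K2} {s t u : Sheet222} (h : Over c s t)
    (hs : s = u ∨ Over c s u) (ht : u = t ∨ Over c u t) : u ∈ between c s t := by
  rw [over_iff_pos] at *
  refine mem_flatten_take_drop _ ?_ ?_ <;> rcases hs with rfl | hs <;> rcases ht with rfl | ht <;>
    omega

theorem nodup_between (c : Cell K0 K1 K2) (s t : Sheet222) : (between c s t).Nodup :=
  List.Nodup.sublist ((List.take_sublist _ _).trans (List.drop_sublist _ _)).flatten
    (front222_isConsistent.nodup c)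

/-- Two sheets meet in a cusp edge over the vertex `v` and are present over the cell `c`. -/
abbrev CuspIn (v : K0) (c : Cell K0 K1 K2) (s t : Sheet222) : Prop :=
  (s, t) ∈ cusp222 (.vert v) ∧ s ∈ (stack222 c).flatten ∧ t ∈ (stack222 c).flatten

/-- The formal version of `Front.matA`. -/
def formalA (v : K0) (c : Cell K0 K1 K2) : Mat Sheet222 Letter222 := fun s t =>
  if Over (.vert v) s t then [[Sum.inr (.vert v, s, t)]]
  else if CuspIn v c s t then
    [[Sum.inl s.1]]
  else []

/-- The formal version of `Front.matB`. -/
def formalB (k : K1) : Mat Sheet222 Letter222 := fun s t =>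
  if Over (.edge k) s t then [[Sum.inr (.edge k, s, t)]] else []

/-- The formal version of `Front.matC`. -/
def formalC (f : K2) : Mat Sheet222 Letter222 := fun s t =>
  if Over (.face f) s t then [[Sum.inr (.face f, s, t)]] else []

/-- The entries of `M` vanish off the diagonal and the pairs of sheets `s ≺ t` above `c`. -/
def IsTri {T : Type} (c : Cell K0 K1 K2) (M : Mat Sheet222 T) : Prop :=
  ∀ s t, s ≠ t → ¬ Over c s t → M s t = []

/-- The formal product of triangular matrices. -/
def fmul {T : Type} (c : Cell K0 K1 K2) (M N : Mat Sheet222 T) : Mat Sheet222 T := fun s t =>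
  if Over c s t then (between c s t).flatMap fun u => mul (M s u) (N u t)
  else if s = t then mul (M s s) (N s s) else []

theorem IsTri.fmul {T : Type} {c : Cell K0 K1 K2} (M N : Mat Sheet222 T) : IsTri c (fmul c M N) :=
  fun s t h h' => by rw [CellDGA.fmul, if_neg h', if_neg h]

theorem IsTri.add {T : Type} {c : Cell K0 K1 K2} {M N : Mat Sheet222 T} (hM : IsTri c M)
    (hN : IsTri c N) : IsTri c (matAdd M N) := fun s t h h' => by
  rw [matAdd, hM s t h h', hN s t h h', List.append_nil]

theorem IsTri.one {T : Type} {c : Cell K0 K1 K2} : IsTri c (matOne : Mat Sheet222 T) :=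
  fun _ _ h _ => if_neg h

/-- In a product of triangular matrices only the sheets between `s` and `t` contribute to the entry.
The formal product therefore sums over the short list `between c s t`. -/
theorem evalMat_fmul {T : Type} {R : Type*} [Ring R] (f : T → R) {c : Cell K0 K1 K2}
    {M N : Mat Sheet222 T} (hM : IsTri c M) (hN : IsTri c N) :
    evalMat f (CellDGA.fmul c M N) = evalMat f M * evalMat f N := by
  have hM' : ∀ s u, ¬ (s = u ∨ Over c s u) → M s u = [] := fun s u h => by
    rw [not_or] at h; exact hM s u h.1 h.2
  have hN' : ∀ s u, ¬ (s = u ∨ Over c s u) → N s u = [] := fun s u h => by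
    rw [not_or] at h; exact hN s u h.1 h.2
  ext s t
  rw [evalMat_apply, CellDGA.fmul, Matrix.mul_apply]
  simp only [evalMat_apply]
  have h0 : ∀ u, ¬ ((s = u ∨ Over c s u) ∧ (u = t ∨ Over c u t)) →
      eval f (M s u) * eval f (N u t) = 0 := by
    intro u hu
    by_cases h : s = u ∨ Over c s u
    · rw [hN' u t fun h' => hu ⟨h, h'⟩, eval_nil, mul_zero]
    · rw [hM' s u h, eval_nil, zero_mul]
  split_ifs with h1 h2
  · rw [eval_flatMap_mul, ← List.sum_toFinset _ (nodup_between c s t)]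
    refine Finset.sum_subset (Finset.subset_univ _) fun u _ hu => h0 u fun h => hu ?_
    exact List.mem_toFinset.2 (mem_between h1 h.1 h.2)
  · subst h2
    rw [eval_mul, Finset.sum_eq_single s (fun u _ hu => h0 u ?_) (by simp)]
    rintro ⟨h | h, h' | h'⟩
    · exact hu h.symm
    · exact hu h.symm
    · exact hu h'
    · exact (h.trans h').ne rfl
  · rw [Finset.sum_eq_zero fun u _ => h0 u ?_, eval_nil]
    rintro ⟨rfl | h, rfl | h'⟩
    · exact h2 rfl
    · exact h1 h'
    · exact h1 h
    · exact h1 (h.trans h')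

/-- The sum of the powers `B ^ i`, `i ≤ n`. -/
def formalGeom (c : Cell K0 K1 K2) (k : K1) : ℕ → Mat Sheet222 Letter222
  | 0 => matOne
  | n + 1 => matAdd matOne (fmul c (formalB k) (formalGeom c k n))

/-- The formal version of `Front.holonomy`. -/
def formalHolonomy (c : Cell K0 K1 K2) : List (K1 × Bool) → Mat Sheet222 Letter222
  | [] => matOne
  | (k, true) :: l => fmul c (formalHolonomy c l) (matAdd matOne (formalB k))
  -- Edges are passed backwards only in the boundary of `f3`. There are six sheets above it, so that
  -- `B ^ 6 = 0` and the powers up to `5` sum to the inverse of `1 + B` modulo 2.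
  | (k, false) :: l => fmul c (formalHolonomy c l) (formalGeom c k 5)

theorem isTri_formalGeom (c : Cell K0 K1 K2) (k : K1) (n : ℕ) : IsTri c (formalGeom c k n) := by
  cases n
  · exact IsTri.one
  · exact IsTri.one.add (IsTri.fmul _ _)

theorem isTri_formalHolonomy (c : Cell K0 K1 K2) (l : List (K1 × Bool)) :
    IsTri c (formalHolonomy c l) := by
  rcases l with _ | ⟨⟨k, _ | _⟩, l⟩
  · exact IsTri.one
  · exact IsTri.fmul _ _
  · exact IsTri.fmul _ _

/-- The formal version of `A₊ (E + B) + (E + B) A₋`. -/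
def formalEdgeDiff (c : Cell K0 K1 K2) (k : K1) : Mat Sheet222 Letter222 :=
  matAdd (fmul c (formalA (ends222 k).2 c) (matAdd matOne (formalB k)))
    (fmul c (matAdd matOne (formalB k)) (formalA (ends222 k).1 c))

/-- The formal version of `Front.cellDiff` for a 2-cell. -/
def formalFaceDiff (f : K2) : Mat Sheet222 Letter222 :=
  matAdd (matAdd (matAdd (fmul (.face f) (formalA (boundary222 f).1.2 (.face f)) (formalC f))
    (fmul (.face f) (formalC f) (formalA (boundary222 f).1.1 (.face f))))
    (formalHolonomy (.face f) (boundary222 f).2.1)) (formalHolonomy (.face f) (boundary222 f).2.2)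

/-- The formal version of `Front.cellDiff`. -/
def formalDiff : Label222 → NCPoly Letter222
  | (.vert v, s, t) => fmul (.vert v) (formalA v (.vert v)) (formalA v (.vert v)) s t
  | (.edge k, s, t) => formalEdgeDiff (.edge k) k s t
  | (.face f, s, t) => formalFaceDiff f s t

/-- A property holds for all labels of generators. -/
def forallLabels (p : Label222 → Bool) : Bool :=
  cells222.all fun c => sheets222.all fun s => sheets222.all fun t =>
    !decide (Over c s t) || p (c, s, t)

theorem forallLabels_iff {p : Label222 → Bool} (h : forallLabels p = true) (r : Label222)
    (hr : Over r.1 r.2.1 r.2.2) : p r = true := by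
  have := List.all_eq_true.1 (List.all_eq_true.1 (List.all_eq_true.1 h r.1 (mem_cells222 _))
    r.2.1 (mem_sheets222 _)) r.2.2 (mem_sheets222 _)
  simpa [hr] using this

/-- Source of a label. -/
abbrev labelSrc (r : Label222) : Comp222 := r.2.1.1
/-- Target of a label. -/
abbrev labelTgt (r : Label222) : Comp222 := r.2.2.1

end CellDGA

/-! ### Comparison of the formal matrices with those of the cellular dg algebra. -/

namespace CellDGA

open NCPoly SemiFree Comp222 K0 K1 K2

variable {V : Type} [Fintype V] (π : Comp222 → V)

/-- The degree of a label. -/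
def labelDeg : Label222 → ℤ
  | (.vert _, s, t) => maslov222 t - maslov222 s + 1
  | (.edge _, s, t) => maslov222 t - maslov222 s
  | (.face _, s, t) => maslov222 t - maslov222 s - 1

/-- The element of `𝒞(Λ_{2,2,2})` with a given label. -/
noncomputable def labelVal (r : Label222) : (C222 π).Alg :=
  if h : Over r.1 r.2.1 r.2.2 then (C222 π).x ⟨r, h⟩ else 0

/-- The element of `𝒞(Λ_{2,2,2})` that is represented by a letter. -/
noncomputable abbrev letterVal : Letter222 → (C222 π).Alg :=
  Sum.elim (fun i => (C222 π).e (π i)) (labelVal π)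

/-- `Front.matA` as a matrix over `𝒞(Λ_{2,2,2})`. -/
noncomputable def cellA (v : K0) (c : Cell K0 K1 K2) : Matrix Sheet222 Sheet222 (C222 π).Alg :=
  Matrix.of fun s t => if h : Over (.vert v) s t then (C222 π).x ⟨(.vert v, s, t), h⟩
    else if CuspIn v c s t then (C222 π).e (π s.1) else 0

/-- `Front.matB` as a matrix over `𝒞(Λ_{2,2,2})`. -/
noncomputable def cellB (k : K1) : Matrix Sheet222 Sheet222 (C222 π).Alg :=
  Matrix.of fun s t => if h : Over (.edge k) s t then (C222 π).x ⟨(.edge k, s, t), h⟩ else 0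

/-- `Front.matC` as a matrix over `𝒞(Λ_{2,2,2})`. -/
noncomputable def cellC (f : K2) : Matrix Sheet222 Sheet222 (C222 π).Alg :=
  Matrix.of fun s t => if h : Over (.face f) s t then (C222 π).x ⟨(.face f, s, t), h⟩ else 0

/-- `Front.holonomy` as a matrix over `𝒞(Λ_{2,2,2})`. -/
noncomputable def cellHolonomy : List (K1 × Bool) → Matrix Sheet222 Sheet222 (C222 π).Alg
  | [] => 1
  | (k, true) :: l => cellHolonomy l * (1 + cellB π k)
  | (k, false) :: l => cellHolonomy l * Ring.inverse (1 + cellB π k)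

theorem evalMat_formalA (v : K0) (c : Cell K0 K1 K2) :
    evalMat (letterVal π) (formalA v c) = cellA π v c := by
  ext s t
  rw [evalMat_apply, formalA, cellA, Matrix.of_apply]
  split_ifs with h <;> simp only [eval_cons, eval_nil, List.map_cons, List.map_nil,
    List.prod_cons, List.prod_nil, mul_one, add_zero, Sum.elim_inl, Sum.elim_inr, labelVal, h]
  · rfl

theorem evalMat_formalB (k : K1) :
    evalMat (letterVal π) (formalB k) = cellB π k := by
  ext s t
  rw [evalMat_apply, formalB, cellB, Matrix.of_apply]
  split_ifs with h <;> simp only [eval_cons, eval_nil, List.map_cons, List.map_nil,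
    List.prod_cons, List.prod_nil, mul_one, add_zero, Sum.elim_inr, labelVal, h]
  · rfl

theorem evalMat_formalC (f : K2) :
    evalMat (letterVal π) (formalC f) = cellC π f := by
  ext s t
  rw [evalMat_apply, formalC, cellC, Matrix.of_apply]
  split_ifs with h <;> simp only [eval_cons, eval_nil, List.map_cons, List.map_nil,
    List.prod_cons, List.prod_nil, mul_one, add_zero, Sum.elim_inr, labelVal, h]
  · rfl

/-- `Presentation.eval_normal` cannot be used yet: the presentation of `𝒞(Λ)` contains the formula
for the differential, whose proof needs normalization for the inverses `(1 + B)⁻¹`. -/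
theorem letterVal_eval_normal (p : NCPoly Letter222) :
    eval (letterVal π) (normal labelSrc labelTgt p) = eval (letterVal π) p := by
  have hc : ∀ r : Label222, labelVal π r ∈ (C222 π).corner (π (labelSrc r)) (π (labelTgt r)) := by
    intro r
    rw [labelVal]
    split_ifs with h
    · exact x_mem_corner (A := C222 π) ⟨r, h⟩
    · exact zero_mem _
  exact NCPoly.eval_normal labelSrc labelTgt ZModModule.add_self (letterVal π)
    (fun _ => idem_mul_self _ _ _) (fun g => e_mul_of_mem_corner (hc g))
    (fun g => mul_e_of_mem_corner (hc g)) p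

/-- Order relations over the vertex `v`, regarded from `c`, hold over `c`. -/
def VertIn (v : K0) (c : Cell K0 K1 K2) : Prop :=
  ∀ s t, Over (.vert v) s t ∨ CuspIn v c s t → Over c s t

/-- Order relations over the edge `k` hold over `c`. -/
def EdgeIn (k : K1) (c : Cell K0 K1 K2) : Prop := ∀ s t, Over (.edge k) s t → Over c s t

theorem vertIn_self (v : K0) : VertIn v (.vert v) := by
  rintro s t (h | h)
  · exact h
  · exact ((front222_isConsistent.cusp_absent (.vert v) (s, t) h.1).1 h.2.1).elim

theorem edgeIn_self (k : K1) : EdgeIn k (.edge k) := fun _ _ h => h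

theorem vertIn_of_fits {v : K0} {c : Cell K0 K1 K2} (h : front222.Fits (.vert v) c) :
    VertIn v c := by
  rintro s t (h' | h')
  · exact h.2.2.2 s t h'
  · exact ((h.2.2.1 (s, t) h'.1).2 h'.2.1).1

theorem vertIn_ini (k : K1) : VertIn (ends222 k).1 (.edge k) :=
  vertIn_of_fits (front222_isConsistent.fits_ini k)

theorem vertIn_ter (k : K1) : VertIn (ends222 k).2 (.edge k) :=
  vertIn_of_fits (front222_isConsistent.fits_ter k)

theorem vertIn_faceIni (f : K2) : VertIn (boundary222 f).1.1 (.face f) :=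
  vertIn_of_fits (front222_isConsistent.fits_faceIni f)

theorem vertIn_faceTer (f : K2) : VertIn (boundary222 f).1.2 (.face f) :=
  vertIn_of_fits (front222_isConsistent.fits_faceTer f)

/-- The edges in the boundary of a 2-cell. -/
def boundaryPaths (f : K2) : List (K1 × Bool) := (boundary222 f).2.1 ++ (boundary222 f).2.2

theorem edgeIn_face {f : K2} {q : K1 × Bool} (h : q ∈ boundaryPaths f) : EdgeIn q.1 (.face f) :=
  (front222_isConsistent.fits_edge f q h).2.2.2

/-- Consistency of the front speaks only of the initial and the terminal vertex of a 2-cell. The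
Leibniz rule along a boundary arc involves the vertices in between as well. -/
theorem vertIn_boundary : ∀ f, ∀ q ∈ boundaryPaths f,
    VertIn (ends222 q.1).1 (.face f) ∧ VertIn (ends222 q.1).2 (.face f) := by
  have key : ∀ f, ∀ q ∈ boundaryPaths f, front222.Fits (.vert (ends222 q.1).1) (.face f) ∧
      front222.Fits (.vert (ends222 q.1).2) (.face f) := by
    intro f
    cases f <;> decide +kernel
  exact fun f q hq => ⟨vertIn_of_fits (key f q hq).1, vertIn_of_fits (key f q hq).2⟩

theorem isTri_formalA {v : K0} {c : Cell K0 K1 K2} (h : VertIn v c) : IsTri c (formalA v c) :=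
  fun s t _ h' => (if_neg fun h1 => h' (h s t (Or.inl h1))).trans
    (if_neg fun h1 => h' (h s t (Or.inr h1)))

theorem isTri_formalB {k : K1} {c : Cell K0 K1 K2} (h : EdgeIn k c) : IsTri c (formalB k) :=
  fun s t _ h' => if_neg fun h1 => h' (h s t h1)

theorem isTri_formalC (f : K2) : IsTri (.face f) (formalC f) := fun _ _ _ h' => if_neg h'

theorem isTri_one_add_formalB {k : K1} {c : Cell K0 K1 K2} (h : EdgeIn k c) :
    IsTri c (matAdd matOne (formalB k)) := IsTri.one.add (isTri_formalB h)

/-- Two triangular matrices of polynomials have equal entries up to normalization. -/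
def matEqv (c : Cell K0 K1 K2) (M N : Mat Sheet222 Letter222) : Bool :=
  sheets222.all fun s => sheets222.all fun t =>
    (!decide (Over c s t) && !decide (s = t)) ||
      (normal labelSrc labelTgt (M s t ++ N s t)).isEmpty

theorem evalMat_eq_of_matEqv {c : Cell K0 K1 K2} {M N : Mat Sheet222 Letter222} (hM : IsTri c M)
    (hN : IsTri c N) (h : matEqv c M N = true) :
    evalMat (letterVal π) M = evalMat (letterVal π) N := by
  ext s t
  have := List.all_eq_true.1 (List.all_eq_true.1 h s (mem_sheets222 s)) t (mem_sheets222 t)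
  rw [Bool.or_eq_true, Bool.and_eq_true, Bool.not_eq_true', Bool.not_eq_true',
    decide_eq_false_iff_not, decide_eq_false_iff_not] at this
  rcases this with ⟨h1, h2⟩ | h1
  · rw [evalMat_apply, evalMat_apply, hM s t h2 h1, hN s t h2 h1]
  · have h' := letterVal_eval_normal π (M s t ++ N s t)
    rw [List.isEmpty_iff.1 h1, eval_nil, eval_append] at h'
    exact sub_eq_zero.1 (by rw [ZModModule.sub_eq_add]; exact h'.symm)

/-- Formal inverses. -/
def checkInverse (c : Cell K0 K1 K2) (k : K1) : Bool :=
  matEqv c (fmul c (matAdd matOne (formalB k)) (formalGeom c k 5)) matOne &&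
    matEqv c (fmul c (formalGeom c k 5) (matAdd matOne (formalB k))) matOne

theorem checkInverse_boundary : ∀ f, ((boundaryPaths f).all fun q =>
    q.2 || checkInverse (.face f) q.1) = true := by
  intro f
  cases f <;> decide +kernel

theorem evalMat_one_add_formalB (k : K1) :
    evalMat (letterVal π) (matAdd matOne (formalB k)) = 1 + cellB π k := by
  rw [evalMat_add, evalMat_one, evalMat_formalB]

/-- `Ring.inverse` has a meaningful value only at units, so the formal geometric sum is shown to be
a two-sided inverse. -/
theorem exists_unit {k : K1} {f : K2} (hk : (k, false) ∈ boundaryPaths f) :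
    ∃ u : (Matrix Sheet222 Sheet222 (C222 π).Alg)ˣ, (u : Matrix _ _ _) = 1 + cellB π k ∧
      ((u⁻¹ : (Matrix Sheet222 Sheet222 (C222 π).Alg)ˣ) : Matrix _ _ _) =
        evalMat (letterVal π) (formalGeom (.face f) k 5) := by
  have h := List.all_eq_true.1 (checkInverse_boundary f) _ hk
  rw [Bool.false_or, checkInverse, Bool.and_eq_true] at h
  have hB := isTri_one_add_formalB (edgeIn_face hk)
  have h1 := evalMat_eq_of_matEqv π (IsTri.fmul _ _) IsTri.one h.1
  have h2 := evalMat_eq_of_matEqv π (IsTri.fmul _ _) IsTri.one h.2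
  rw [evalMat_fmul _ hB (isTri_formalGeom _ _ _), evalMat_one_add_formalB, evalMat_one] at h1
  rw [evalMat_fmul _ (isTri_formalGeom _ _ _) hB, evalMat_one_add_formalB, evalMat_one] at h2
  exact ⟨⟨_, _, h1, h2⟩, rfl, rfl⟩

theorem evalMat_formalHolonomy (f : K2) (l : List (K1 × Bool)) (h : ∀ q ∈ l, q ∈ boundaryPaths f) :
    evalMat (letterVal π) (formalHolonomy (.face f) l) = cellHolonomy π l := by
  induction l with
  | nil => exact evalMat_one _
  | cons q l ih =>
    have ih := ih fun q hq => h q (List.mem_cons_of_mem _ hq)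
    have hq := h q List.mem_cons_self
    obtain ⟨k, _ | _⟩ := q
    · obtain ⟨u, hu, hu'⟩ := exists_unit π hq
      rw [formalHolonomy, evalMat_fmul _ (isTri_formalHolonomy _ _) (isTri_formalGeom _ _ _), ih,
        ← hu', ← Ring.inverse_unit, hu]
      rfl
    · rw [formalHolonomy, evalMat_fmul _ (isTri_formalHolonomy _ _)
        (isTri_one_add_formalB (edgeIn_face hq)), ih, evalMat_one_add_formalB]
      rfl

theorem evalMat_formalEdgeDiff {c : Cell K0 K1 K2} {k : K1} (hk : EdgeIn k c)
    (h1 : VertIn (ends222 k).1 c) (h2 : VertIn (ends222 k).2 c) :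
    evalMat (letterVal π) (formalEdgeDiff c k) =
      cellA π (ends222 k).2 c * (1 + cellB π k) + (1 + cellB π k) * cellA π (ends222 k).1 c := by
  rw [formalEdgeDiff, evalMat_add, evalMat_fmul _ (isTri_formalA h2) (isTri_one_add_formalB hk),
    evalMat_fmul _ (isTri_one_add_formalB hk) (isTri_formalA h1), evalMat_one_add_formalB,
    evalMat_formalA, evalMat_formalA]

theorem evalMat_formalFaceDiff (f : K2) :
    evalMat (letterVal π) (formalFaceDiff f) =
      cellA π (boundary222 f).1.2 (.face f) * cellC π f +
      cellC π f * cellA π (boundary222 f).1.1 (.face f) +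
      cellHolonomy π (boundary222 f).2.1 + cellHolonomy π (boundary222 f).2.2 := by
  rw [formalFaceDiff, evalMat_add, evalMat_add, evalMat_add,
    evalMat_fmul _ (isTri_formalA (vertIn_faceTer f)) (isTri_formalC f),
    evalMat_fmul _ (isTri_formalC f) (isTri_formalA (vertIn_faceIni f)),
    evalMat_formalA, evalMat_formalA, evalMat_formalC,
    evalMat_formalHolonomy π f _ fun q hq => List.mem_append_left _ hq,
    evalMat_formalHolonomy π f _ fun q hq => List.mem_append_right _ hq]

/-- The two matrices differ only in the procedures that decide the order of the sheets. -/
theorem cellA_eq (v : K0) (c : Cell K0 K1 K2) : cellA π v c = front222.matA π v c := by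
  ext s t
  by_cases h1 : Over (.vert v) s t
  · refine (dif_pos h1).trans (Eq.symm ?_)
    exact dif_pos h1
  · refine (dif_neg h1).trans (Eq.symm ?_)
    refine (dif_neg h1).trans ?_
    by_cases h2 : CuspIn v c s t
    · refine Eq.trans ?_ (if_pos h2).symm
      exact if_pos h2
    · refine Eq.trans ?_ (if_neg h2).symm
      exact if_neg h2

theorem cellB_eq (k : K1) : cellB π k = front222.matB π k := by
  ext s t
  by_cases h1 : Over (.edge k) s t
  · refine (dif_pos h1).trans (Eq.symm ?_)
    exact dif_pos h1
  · refine (dif_neg h1).trans (Eq.symm ?_)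
    exact dif_neg h1

theorem cellC_eq (f : K2) : cellC π f = front222.matC π f := by
  ext s t
  by_cases h1 : Over (.face f) s t
  · refine (dif_pos h1).trans (Eq.symm ?_)
    exact dif_pos h1
  · refine (dif_neg h1).trans (Eq.symm ?_)
    exact dif_neg h1

theorem cellHolonomy_eq (l : List (K1 × Bool)) : cellHolonomy π l = front222.holonomy π l := by
  induction l with
  | nil => rfl
  | cons q l ih =>
    obtain ⟨k, _ | _⟩ := q
    · rw [cellHolonomy, ih, cellB_eq]
      rfl
    · rw [cellHolonomy, ih, cellB_eq]
      rfl

theorem diff_vert (v : K0) (s t : Sheet222) (h : Over (.vert v) s t) :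
    (C222 π).diff ⟨(.vert v, s, t), h⟩ = (cellA π v (.vert v) * cellA π v (.vert v)) s t := by
  simp only [cellA_eq]
  rfl

theorem diff_edge (k : K1) (s t : Sheet222) (h : Over (.edge k) s t) :
    (C222 π).diff ⟨(.edge k, s, t), h⟩ = (cellA π (ends222 k).2 (.edge k) * (1 + cellB π k) +
        (1 + cellB π k) * cellA π (ends222 k).1 (.edge k)) s t := by
  simp only [cellA_eq, cellB_eq]
  rfl

theorem diff_face (f : K2) (s t : Sheet222) (h : Over (.face f) s t) :
    (C222 π).diff ⟨(.face f, s, t), h⟩ =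
      (cellA π (boundary222 f).1.2 (.face f) * cellC π f +
      cellC π f * cellA π (boundary222 f).1.1 (.face f) +
      cellHolonomy π (boundary222 f).2.1 + cellHolonomy π (boundary222 f).2.2) s t := by
  simp only [cellHolonomy_eq, cellA_eq, cellC_eq]
  rfl

theorem eval_formalDiff : ∀ (c : Cell K0 K1 K2) (s t : Sheet222) (h : Over c s t),
    (C222 π).diff ⟨(c, s, t), h⟩ = eval (letterVal π) (formalDiff (c, s, t))
  | .vert v, s, t, h => by
    have hv := isTri_formalA (vertIn_self v)
    have := evalMat_fmul (letterVal π) hv hv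
    rw [evalMat_formalA] at this
    exact (diff_vert π v s t h).trans (congrFun (congrFun this s) t).symm
  | .edge k, s, t, h => (diff_edge π k s t h).trans (congrFun (congrFun
      (evalMat_formalEdgeDiff π (edgeIn_self k) (vertIn_ini k) (vertIn_ter k)) s) t).symm
  | .face f, s, t, h =>
    (diff_face π f s t h).trans (congrFun (congrFun (evalMat_formalFaceDiff π f) s) t).symm

/-- The presentation of `𝒞(Λ_{2,2,2})`. -/
noncomputable def presentation222 : Presentation (C222 π) π Label222 where
  mem r := Over r.1 r.2.1 r.2.2
  src := labelSrc
  tgt := labelTgt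
  deg := labelDeg
  diff := formalDiff
  label := Subtype.val
  val := labelVal π
  label_injective := Subtype.val_injective
  mem_iff r := ⟨fun h => ⟨⟨r, h⟩, rfl⟩, by rintro ⟨g, rfl⟩; exact g.2⟩
  val_label g := dif_pos g.2
  val_of_not_mem _ h := dif_neg h
  src_label _ := rfl
  tgt_label _ := rfl
  deg_label g := by obtain ⟨⟨v | k | f, s, t⟩, h⟩ := g <;> rfl
  diff_label g := eval_formalDiff π g.1.1 g.1.2.1 g.1.2.2 g.2

end CellDGA

namespace CellDGA

open NCPoly SemiFree Comp222 K0 K1 K2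

/-! ## `𝒞(Λ_{2,2,2})` is a semi-free dg algebra -/

/-- The difference of the positions of two sheets above a cell. -/
def blockDist (c : Cell K0 K1 K2) (s t : Sheet222) : ℕ :=
  posIn t (stack222 c) - posIn s (stack222 c)

/-- An ordering of the generators for which the differential is triangular. -/
def cellRank : Label222 → ℕ
  | (.vert v, s, t) => blockDist (.vert v) s t
  | (.edge k, s, t) => 16 + blockDist (.edge k) s t
  | (.face f, s, t) => 32 + blockDist (.face f) s t

theorem formalDiff_spec : forallLabels (fun r =>
    ((formalDiff r).all fun w => IsPathWord labelSrc labelTgt (labelSrc r) (labelTgt r) w &&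
      decide ((w.map (Sum.elim (fun _ => 0) labelDeg)).sum = labelDeg r + 1)) &&
    Presentation.IsBelow cellRank (cellRank r) (formalDiff r)) = true := by
  decide +kernel

/-- The formal differential on letters. -/
def letterDiff : Letter222 → NCPoly Letter222 :=
  Sum.elim (fun _ => []) fun r => if Over r.1 r.2.1 r.2.2 then formalDiff r else []

/-- The formal differential of a matrix. -/
def formalD (M : Mat Sheet222 Letter222) : Mat Sheet222 Letter222 := fun s t =>
  der letterDiff (M s t)

/-- The formal version of `dA = A²`, for the vertex `v` in the closure of the cell `c`. -/
def checkA (v : K0) (c : Cell K0 K1 K2) : Bool :=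
  matEqv c (formalD (formalA v c)) (fmul c (formalA v c) (formalA v c))

/-- The formal version of `dB = A₊ (E + B) + (E + B) A₋`, for the 1-cell `k` in the closure of the
cell `c`. -/
def checkB (k : K1) (c : Cell K0 K1 K2) : Bool :=
  matEqv c (formalD (formalB k)) (formalEdgeDiff c k)

theorem checkA_vert : ∀ v, checkA v (.vert v) = true := by
  intro v
  cases v <;> decide +kernel

theorem checkA_ini : ∀ k, checkA (ends222 k).1 (.edge k) = true := by
  intro k
  cases k <;> decide +kernel

theorem checkA_ter : ∀ k, checkA (ends222 k).2 (.edge k) = true := by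
  intro k
  cases k <;> decide +kernel

theorem checkB_self : ∀ k, checkB k (.edge k) = true := by
  intro k
  cases k <;> decide +kernel

/-- On the diagonal the units of the two holonomies cancel. Hence the formula for `dC` holds for the
whole matrix, including entries that are not generators. -/
theorem check_diagonal : ∀ f, (sheets222.all fun s =>
    (normal labelSrc labelTgt (formalFaceDiff f s s)).isEmpty) = true := by
  intro f
  cases f <;> decide +kernel

/-- Seen from a 2-cell, the matrix of a vertex also contains the constant cusp blocks. That `dA =
A²` persists reflects that these blocks square to zero and do not interact with the other entries.
-/
theorem checkA_faceIni : ∀ f, checkA (boundary222 f).1.1 (.face f) = true := by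
  intro f
  cases f <;> decide +kernel

theorem checkA_faceTer : ∀ f, checkA (boundary222 f).1.2 (.face f) = true := by
  intro f
  cases f <;> decide +kernel

theorem checkB_face : ∀ f, ((boundaryPaths f).all fun q => checkB q.1 (.face f)) = true := by
  intro f
  cases f <;> decide +kernel

/-! ### The vanishing of `d²` from matrix identities. -/

section Square

variable {V : Type} [Fintype V] (π : Comp222 → V)

theorem mem_corner_diff222 (g : (C222 π).Gen) :
    (C222 π).diff g ∈ (C222 π).corner ((C222 π).src g) ((C222 π).tgt g) := by
  have := forallLabels_iff formalDiff_spec g.1 g.2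
  simp only [Bool.and_eq_true, List.all_eq_true] at this
  rw [(presentation222 π).diff_label, (presentation222 π).src_label, (presentation222 π).tgt_label]
  exact (presentation222 π).eval_mem_corner fun w hw => (this.1 w hw).1

/-- The differential of a matrix. -/
noncomputable def matD (M : Matrix Sheet222 Sheet222 (C222 π).Alg) :
    Matrix Sheet222 Sheet222 (C222 π).Alg := M.map (C222 π).d

theorem matD_add (M N : Matrix Sheet222 Sheet222 (C222 π).Alg) :
    matD π (M + N) = matD π M + matD π N := by
  ext s t
  exact (C222 π).d.map_add _ _

theorem matD_mul (M N : Matrix Sheet222 Sheet222 (C222 π).Alg) :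
    matD π (M * N) = matD π M * N + M * matD π N := by
  ext s t
  simp only [matD, Matrix.map_apply, Matrix.mul_apply, Matrix.add_apply, map_sum, d_mul,
    Finset.sum_add_distrib]

theorem matD_one : matD π 1 = 0 := by
  ext s t
  rw [matD, Matrix.map_apply, Matrix.one_apply, Matrix.zero_apply]
  split_ifs
  · exact d_one _
  · exact map_zero _

/-- The kernel checks on formal matrices become identities in `𝒞(Λ)` through this. -/
theorem matD_evalMat (M : Mat Sheet222 Letter222) :
    matD π (evalMat (letterVal π) M) = evalMat (letterVal π) (formalD M) := by
  ext s t
  refine (eval_der (letterVal π) letterDiff (C222 π).d.toAddMonoidHom (d_one _)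
    (fun a b => d_mul _ a b) ?_ _).symm
  rintro (i | ⟨c, s, t⟩)
  · exact d_e _ _
  · change (C222 π).d (labelVal π (c, s, t)) =
      eval (letterVal π) (if Over c s t then formalDiff (c, s, t) else [])
    by_cases h : Over c s t
    · have hx : labelVal π (c, s, t) = (C222 π).x ⟨(c, s, t), h⟩ := dif_pos h
      rw [if_pos h, hx, ← eval_formalDiff π c s t h]
      exact d_x (mem_corner_diff222 π _)
    · have hx : labelVal π (c, s, t) = 0 := dif_neg h
      rw [if_neg h, hx, map_zero, eval_nil]

theorem isTri_formalD {c : Cell K0 K1 K2} {M : Mat Sheet222 Letter222} (h : IsTri c M) :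
    IsTri c (formalD M) := fun s t h1 h2 => by
  rw [formalD, h s t h1 h2]
  rfl

theorem matD_cellA {v : K0} {c : Cell K0 K1 K2} (h : VertIn v c) (hc : checkA v c = true) :
    matD π (cellA π v c) = cellA π v c * cellA π v c := by
  have hA := isTri_formalA h
  have := evalMat_eq_of_matEqv π (isTri_formalD hA) (IsTri.fmul _ _) hc
  rwa [← matD_evalMat, evalMat_fmul _ hA hA, evalMat_formalA] at this

theorem matD_cellB {k : K1} {c : Cell K0 K1 K2} (hk : EdgeIn k c) (h1 : VertIn (ends222 k).1 c)
    (h2 : VertIn (ends222 k).2 c) (hc : checkB k c = true) :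
    matD π (1 + cellB π k) = cellA π (ends222 k).2 c * (1 + cellB π k) +
      (1 + cellB π k) * cellA π (ends222 k).1 c := by
  have hA := isTri_formalB hk
  have := evalMat_eq_of_matEqv π (isTri_formalD hA) ((IsTri.fmul _ _).add (IsTri.fmul _ _)) hc
  rw [← matD_evalMat, evalMat_formalB] at this
  rw [matD_add, matD_one, zero_add, this]
  exact evalMat_formalEdgeDiff π hk h1 h2

theorem matD_cellC (f : K2) : matD π (cellC π f) =
    cellA π (boundary222 f).1.2 (.face f) * cellC π f +
      cellC π f * cellA π (boundary222 f).1.1 (.face f) +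
      cellHolonomy π (boundary222 f).2.1 + cellHolonomy π (boundary222 f).2.2 := by
  ext s t
  by_cases h : Over (.face f) s t
  · have hx : cellC π f s t = (C222 π).x ⟨(.face f, s, t), h⟩ := dif_pos h
    rw [matD, Matrix.map_apply, hx, ← diff_face π f s t h]
    exact d_x (mem_corner_diff222 π _)
  · have hx : cellC π f s t = 0 := dif_neg h
    rw [matD, Matrix.map_apply, hx, map_zero, ← evalMat_formalFaceDiff, evalMat_apply]
    by_cases hs : s = t
    · subst hs
      rw [← letterVal_eval_normal, List.isEmpty_iff.1
        (List.all_eq_true.1 (check_diagonal f) s (mem_sheets222 s)), eval_nil]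
    · have ht : IsTri (.face f) (formalFaceDiff f) :=
        (((IsTri.fmul _ _).add (IsTri.fmul _ _)).add (isTri_formalHolonomy _ _)).add
          (isTri_formalHolonomy _ _)
      rw [ht s t hs h, eval_nil]

/-- With `dA = A²` the Leibniz rule gives `A³ + A³ = 0`. -/
theorem matD_vert (v : K0) : matD π (cellA π v (.vert v) * cellA π v (.vert v)) = 0 := by
  rw [matD_mul, matD_cellA π (vertIn_self v) (checkA_vert v), mul_assoc, ZModModule.add_self]

theorem matD_edge (k : K1) : matD π (cellA π (ends222 k).2 (.edge k) * (1 + cellB π k) +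
    (1 + cellB π k) * cellA π (ends222 k).1 (.edge k)) = 0 := by
  rw [matD_add, matD_mul, matD_mul, matD_cellA π (vertIn_ini k) (checkA_ini k),
    matD_cellA π (vertIn_ter k) (checkA_ter k),
    matD_cellB π (edgeIn_self k) (vertIn_ini k) (vertIn_ter k) (checkB_self k)]
  generalize cellA π (ends222 k).2 (.edge k) = X
  generalize cellA π (ends222 k).1 (.edge k) = Y
  generalize 1 + cellB π k = Z
  have : X * X * Z + X * (X * Z + Z * Y) + ((X * Z + Z * Y) * Y + Z * (Y * Y)) =
      (X * X * Z + X * X * Z) + ((X * Z * Y + X * Z * Y) + (Z * Y * Y + Z * Y * Y)) := by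
    noncomm_ring
  rw [this, ZModModule.add_self, ZModModule.add_self, ZModModule.add_self, add_zero, add_zero]

/-- The holonomy along a path in the boundary of a 2-cell intertwines the matrices of its ends. -/
theorem matD_cellHolonomy (f : K2) : ∀ (l : List (K1 × Bool)) (v w : K0),
    (∀ q ∈ l, q ∈ boundaryPaths f) → front222.IsPath v w l →
    matD π (cellHolonomy π l) = cellA π w (.face f) * cellHolonomy π l +
      cellHolonomy π l * cellA π v (.face f)
  | [], v, w, _, h => by
    obtain rfl : v = w := h
    rw [cellHolonomy, matD_one, mul_one, one_mul, ZModModule.add_self]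
  | (k, true) :: l, v, w, hl, h => by
    obtain ⟨rfl, h⟩ : (ends222 k).1 = v ∧ front222.IsPath (ends222 k).2 w l := h
    have hk := hl _ List.mem_cons_self
    rw [cellHolonomy, matD_mul, matD_cellHolonomy f l _ w
      (fun q hq => hl q (List.mem_cons_of_mem _ hq)) h,
      matD_cellB π (edgeIn_face hk) (vertIn_boundary f _ hk).1 (vertIn_boundary f _ hk).2
        (List.all_eq_true.1 (checkB_face f) _ hk)]
    generalize cellA π (ends222 k).2 (.face f) = X
    generalize cellA π (ends222 k).1 (.face f) = Y
    generalize cellA π w (.face f) = W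
    generalize 1 + cellB π k = Z
    generalize cellHolonomy π l = H
    have : (W * H + H * X) * Z + H * (X * Z + Z * Y) =
        (W * (H * Z) + H * Z * Y) + (H * X * Z + H * X * Z) := by
      noncomm_ring
    rw [this, ZModModule.add_self, add_zero]
  | (k, false) :: l, v, w, hl, h => by
    obtain ⟨rfl, h⟩ : (ends222 k).2 = v ∧ front222.IsPath (ends222 k).1 w l := h
    have hk := hl _ List.mem_cons_self
    obtain ⟨u, hu, -⟩ := exists_unit π hk
    have hB := matD_cellB π (edgeIn_face hk) (vertIn_boundary f _ hk).1 (vertIn_boundary f _ hk).2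
      (List.all_eq_true.1 (checkB_face f) _ hk)
    rw [cellHolonomy, ← hu, Ring.inverse_unit, matD_mul, matD_cellHolonomy f l _ w
      (fun q hq => hl q (List.mem_cons_of_mem _ hq)) h]
    rw [← hu] at hB
    generalize cellA π (ends222 k).2 (.face f) = X at *
    generalize cellA π (ends222 k).1 (.face f) = Y at *
    generalize cellA π w (.face f) = W
    generalize cellHolonomy π l = H
    -- Differentiating `u u⁻¹ = 1` determines `d(u⁻¹)`. It obeys the rule for `u` with the end
    -- vertices exchanged, as expected of an edge passed backwards.
    have h1 : matD π ((u : Matrix Sheet222 Sheet222 (C222 π).Alg) * (u⁻¹ : _ˣ)) = 0 := by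
      rw [Units.mul_inv, matD_one]
    rw [matD_mul, hB] at h1
    have h2 : matD π ((u⁻¹ : _ˣ) : Matrix Sheet222 Sheet222 (C222 π).Alg) =
        (u⁻¹ : _ˣ) * X + Y * (u⁻¹ : _ˣ) := by
      have h3 := congrArg (fun M => ((u⁻¹ : _ˣ) : Matrix Sheet222 Sheet222 (C222 π).Alg) * M) h1
      simp only [add_mul, mul_add, mul_zero, ← mul_assoc, Units.inv_mul, one_mul] at h3
      rw [mul_assoc _ (u : Matrix Sheet222 Sheet222 (C222 π).Alg), Units.mul_inv, mul_one] at h3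
      exact (sub_eq_zero.1 (by rw [ZModModule.sub_eq_add]; exact h3)).symm
    rw [h2]
    generalize ((u⁻¹ : _ˣ) : Matrix Sheet222 Sheet222 (C222 π).Alg) = Z
    have : (W * H + H * Y) * Z + H * (Z * X + Y * Z) =
        (W * (H * Z) + H * Z * X) + (H * Y * Z + H * Y * Z) := by
      noncomm_ring
    rw [this, ZModModule.add_self, add_zero]

/-- Both boundary arcs join the same two vertices. The terms `A₊ H + H A₋` of their holonomies
therefore cancel against those produced by inserting `dC` into `A₊ C + C A₋`. -/
theorem matD_face (f : K2) : matD π (cellA π (boundary222 f).1.2 (.face f) * cellC π f +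
      cellC π f * cellA π (boundary222 f).1.1 (.face f) +
      cellHolonomy π (boundary222 f).2.1 + cellHolonomy π (boundary222 f).2.2) = 0 := by
  rw [matD_add, matD_add, matD_add, matD_mul, matD_mul,
    matD_cellHolonomy π f _ _ _ (fun q hq => List.mem_append_left _ hq)
      (front222_isConsistent.path_one f),
    matD_cellHolonomy π f _ _ _ (fun q hq => List.mem_append_right _ hq)
      (front222_isConsistent.path_two f),
    matD_cellA π (vertIn_faceIni f) (checkA_faceIni f),
    matD_cellA π (vertIn_faceTer f) (checkA_faceTer f), matD_cellC]
  change _ + (cellA π (boundary222 f).1.2 _ * _ + _ * cellA π (boundary222 f).1.1 _) +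
    (cellA π (boundary222 f).1.2 _ * _ + _ * cellA π (boundary222 f).1.1 _) = 0
  generalize cellA π (boundary222 f).1.2 (.face f) = X
  generalize cellA π (boundary222 f).1.1 (.face f) = Y
  generalize cellC π f = C
  generalize cellHolonomy π (boundary222 f).2.1 = H
  generalize cellHolonomy π (boundary222 f).2.2 = G
  have : X * X * C + X * (X * C + C * Y + H + G) + ((X * C + C * Y + H + G) * Y + C * (Y * Y)) +
      (X * H + H * Y) + (X * G + G * Y) =
      (X * X * C + X * X * C) + (X * C * Y + X * C * Y) + (C * Y * Y + C * Y * Y) +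
        (X * H + X * H) + (H * Y + H * Y) + (X * G + X * G) + (G * Y + G * Y) := by
    noncomm_ring
  rw [this]
  simp only [ZModModule.add_self]

theorem d_diff222 (g : (C222 π).Gen) : (C222 π).d ((C222 π).diff g) = 0 := by
  obtain ⟨⟨v | k | f, s, t⟩, h⟩ := g
  · refine (congrArg (C222 π).d (diff_vert π v s t h)).trans ?_
    exact congrFun (congrFun (matD_vert π v) s) t
  · refine (congrArg (C222 π).d (diff_edge π k s t h)).trans ?_
    exact congrFun (congrFun (matD_edge π k) s) t
  · refine (congrArg (C222 π).d (diff_face π f s t h)).trans ?_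
    exact congrFun (congrFun (matD_face π f) s) t

theorem isSemiFreeDG222 : (C222 π).IsSemiFreeDG := by
  have spec := fun (r : Label222) hr => forallLabels_iff formalDiff_spec r hr
  simp only [Bool.and_eq_true, List.all_eq_true, decide_eq_true_eq] at spec
  exact (presentation222 π).isSemiFreeDG (rank := cellRank)
    (fun r hr w hw => ((spec r hr).1 w hw).1) (fun r hr w hw => ((spec r hr).1 w hw).2)
    (fun r hr => (spec r hr).2) (fun _ => d_diff222 π)

end Square

end CellDGA

namespace CellDGA

open NCPoly SemiFree Comp222 K0 K1 K2

/-! ## Cancellation of the vertices -/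

/-- The edge of the spanning tree that ends at a vertex. -/
def treeEdge : K0 → K1
  -- This value is immaterial, since `v1` carries no generators.
  | v1 => e0
  | v2 => e2
  | v3 => e3
  | v4 => e4
  | v5 => e5
  | v6 => e6
  | v7 => e7
  -- The edge `e20` runs from `v8` to `v3`, so here it is the initial vertex that is cancelled.
  -- Orientation does not matter: `dB` contains both `A₊` and `A₋` linearly.
  | v8 => e20
  | v9 => e9
  | v10 => e10
  | v11 => e11
  | v12 => e12

/-- The vertex at which an edge of the spanning tree ends. -/
def treeVertex : K1 → Option K0
  | e2 => some v2
  | e3 => some v3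
  | e4 => some v4
  | e5 => some v5
  | e6 => some v6
  | e7 => some v7
  | e20 => some v8
  | e9 => some v9
  | e10 => some v10
  | e11 => some v11
  | e12 => some v12
  | _ => none

/-- The distance of a vertex from the root of the spanning tree. -/
def treeLevel : K0 → ℕ
  | v1 => 0
  | v2 => 1
  | v3 => 2
  | v4 | v8 => 3
  | v5 | v9 => 4
  | v6 | v10 => 5
  | v7 | v11 => 6
  | v12 => 7

/-- The generators of the vertices are cancelled against generators of the tree edges. -/
def treeStatus : Label222 → Status
  | (.vert _, _, _) => .lo
  | (.edge k, s, t) =>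
    match treeVertex k with
    -- Sheets that cross above `v` have no generator there to cancel with. Their generators on the
    -- tree edges are the eight `b` that survive.
    | some v => if Over (.vert v) s t then .hi else .keep
    | none => .keep
  | (.face _, _, _) => .keep

/-- The generator with which a generator of a vertex is cancelled. -/
def treeUp : Label222 → Label222
  | (.vert v, s, t) => (.edge (treeEdge v), s, t)
  | r => r

/-- The generator of a vertex that is cancelled with a generator of a tree edge. -/
def treeDown : Label222 → Label222
  | (.edge k, s, t) => (.vert ((treeVertex k).getD v1), s, t)
  | r => r

/-- An ordering of the generators that is compatible with the cancellation of the vertices. -/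
def treeRank : Label222 → ℕ
  | (.vert v, s, t) => 16 * treeLevel v + blockDist (.edge (treeEdge v)) s t
  | (.edge k, s, t) =>
    match treeVertex k with
    | some v => 16 * treeLevel v + blockDist (.edge k) s t
    -- Differences of positions are below `16` and levels below `20`, so circles come after the
    -- whole tree and 2-cells after the circles.
    | none => 16 * 20 + blockDist (.edge k) s t
  | (.face f, s, t) => 16 * 21 + blockDist (.face f) s t

/-- The generator of the edge `k` for two sheets that cross above the end of `k`. -/
abbrev crossLetter (k : K1) (X Y : Comp222) : Letter222 := Sum.inr (.edge k, L X, U Y)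

abbrev β2 : Letter222 := crossLetter e2 R A
abbrev β3 : Letter222 := crossLetter e3 B R
abbrev β5 : Letter222 := crossLetter e5 P A
abbrev β6 : Letter222 := crossLetter e6 B P
abbrev β7 : Letter222 := crossLetter e7 B A
abbrev β10 : Letter222 := crossLetter e10 Q A
abbrev β11 : Letter222 := crossLetter e11 B Q
abbrev β12 : Letter222 := crossLetter e12 B A

/-- The common image of the generators of a vertex for the sheets `U X`, `U Y` and for the sheets
`L X`, `L Y`. -/
def vertexPoly (v : K0) : Comp222 → Comp222 → NCPoly Letter222
  | R, A => [[β2]]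
  | B, R => if v = v2 then [] else [[β3]]
  | B, A =>
    match v with
    | v7 => [[β7]]
    | v12 => [[β12]]
    | _ => []
  | P, A => [[β5]]
  | B, P => if v = v6 ∨ v = v7 then [[β6]] else []
  | Q, A => [[β10]]
  | B, Q => if v = v11 ∨ v = v12 then [[β11]] else []
  | _, _ => []

/-- The image of the generator of a vertex for the sheets `L B` and `U A`. -/
def vertexPolyBA : K0 → NCPoly Letter222
  | v2 | v7 | v12 => []
  -- This is the differential of the surviving generator `β7`: its two sheets cross at `v7`, so only
  -- the entry at `v6` contributes. The same happens at `v11` for `β12`.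
  | v6 => [[β3, β2], [β6, β5]]
  | v11 => [[β3, β2], [β11, β10]]
  | _ => [[β3, β2]]

/-- The image of the matrix of a vertex under the cancellation of the vertices. -/
def vertexValue (v : K0) : Sheet222 → Sheet222 → NCPoly Letter222
  | (X, true), (Y, true) => vertexPoly v X Y
  | (X, false), (Y, false) => vertexPoly v X Y
  | (X, true), (Y, false) => if X = Y then [[Sum.inl X]] else []
  | (X, false), (Y, true) => if X = B ∧ Y = A then vertexPolyBA v else []

/-- The images of the generators under the cancellation of the vertices. -/
def treeValue (r : Label222) : NCPoly Letter222 :=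
  if Over r.1 r.2.1 r.2.2 then
    match r with
    | (.vert v, s, t) => vertexValue v s t
    | r => if treeStatus r = .keep then [[Sum.inr r]] else []
  else []

/-- Substitution of values for the generators. -/
abbrev substLabel {G G' : Type} (value : G → NCPoly (Comp222 ⊕ G')) :
    NCPoly (Comp222 ⊕ G) → NCPoly (Comp222 ⊕ G') :=
  subst (Sum.elim (fun i => [[Sum.inl i]]) value)

/-- The differential after the cancellation of the vertices. -/
def treeDiff (r : Label222) : NCPoly Letter222 :=
  normal labelSrc labelTgt (substLabel treeValue (formalDiff r))

/-- For a tree edge `dB = 0` after cancellation of the upper generators, where `B` retains only the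
crossing generator `β`. At its two ends the matrices are thus conjugate by `1 + B`. Starting from
the cusp blocks at `v1`, this yields the entries listed in `vertexValue`; the emptiness of
`treeDiff` on upper generators confirms them. -/
theorem treeMatching_spec : forallLabels (fun r =>
    match treeStatus r with
    | .lo => decide (Over (treeUp r).1 (treeUp r).2.1 (treeUp r).2.2) &&
        decide (treeStatus (treeUp r) = .hi) && decide (treeDown (treeUp r) = r) &&
        decide (labelDeg r = labelDeg (treeUp r) + 1) && decide (treeRank (treeUp r) = treeRank r) &&
        Presentation.IsBelow treeRank (treeRank r) (formalDiff r) &&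
        Presentation.IsBelow treeRank (treeRank r)
          (normal labelSrc labelTgt ([Sum.inr r] :: formalDiff (treeUp r)))
    | .hi => decide (Over (treeDown r).1 (treeDown r).2.1 (treeDown r).2.2) &&
        decide (treeStatus (treeDown r) = .lo) && decide (treeUp (treeDown r) = r) &&
        (treeDiff r).isEmpty
    | .keep => Presentation.IsBelow treeRank (treeRank r) (formalDiff r)) = true := by
  decide +kernel

theorem treeValue_path : forallLabels (fun r => (treeValue r).all fun w =>
    IsPathWord labelSrc labelTgt (labelSrc r) (labelTgt r) w) = true := by
  decide +kernel

/-- The labels of the generators that remain after the cancellation of the vertices. -/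
def TreeKeep (r : Label222) : Prop := Over r.1 r.2.1 r.2.2 ∧ treeStatus r = .keep

instance (r : Label222) : Decidable (TreeKeep r) := inferInstanceAs (Decidable (_ ∧ _))

section

variable {V : Type} [Fintype V] (π : Comp222 → V)

/-- The generator with a given label in the dg algebra without vertices. -/
def reducedVal (r : Label222) : PathAlg (fun g : {r // TreeKeep r} => π (labelSrc g.1))
    (fun g => π (labelTgt g.1)) :=
  if h : TreeKeep r then gen _ _ ⟨r, h⟩ else 0

/-- The dg algebra that is obtained from `𝒞(Λ_{2,2,2})` by the cancellation of the vertices. -/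
noncomputable def reduced222 : SemiFree V where
  Gen := {r // TreeKeep r}
  src g := π (labelSrc g.1)
  tgt g := π (labelTgt g.1)
  deg g := labelDeg g.1
  diff g := eval (Sum.elim (fun i => idem _ _ (π i)) (reducedVal π)) (treeDiff g.1)

/-- The presentation of the dg algebra without vertices. -/
noncomputable def reducedPresentation : Presentation (reduced222 π) π Label222 where
  mem := TreeKeep
  src := labelSrc
  tgt := labelTgt
  deg := labelDeg
  diff := treeDiff
  label := Subtype.val
  val := reducedVal π
  label_injective := Subtype.val_injective
  mem_iff r := ⟨fun h => ⟨⟨r, h⟩, rfl⟩, by rintro ⟨g, rfl⟩; exact g.2⟩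
  val_label g := dif_pos g.2
  val_of_not_mem _ h := dif_neg h
  src_label _ := rfl
  tgt_label _ := rfl
  deg_label _ := rfl
  diff_label _ := rfl

/-- The cancellation of the vertices. -/
noncomputable def treeMatching : Matching (presentation222 π) (reducedPresentation π) where
  status := treeStatus
  up := treeUp
  down := treeDown
  kept := id
  name := id
  rank := treeRank
  lo_spec r hr h := by
    have := forallLabels_iff treeMatching_spec r hr
    simp only [h, Bool.and_eq_true, decide_eq_true_eq] at this
    obtain ⟨⟨⟨⟨⟨⟨h1, h2⟩, h3⟩, h4⟩, h5⟩, -⟩, -⟩ := this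
    refine ⟨h1, h2, h3, ?_, ?_, h4, h5⟩ <;> obtain ⟨_ | _ | _, s, t⟩ := r <;> rfl
  hi_spec r hr h := by
    have := forallLabels_iff treeMatching_spec r hr
    simp only [h, Bool.and_eq_true, decide_eq_true_eq] at this
    exact ⟨this.1.1.1, this.1.1.2, this.1.2⟩
  kept_spec _ h := ⟨h.1, h.2, rfl, rfl, rfl, rfl⟩
  name_spec _ hr h := ⟨⟨hr, h⟩, rfl⟩
  diff_below r hr h := by
    have := forallLabels_iff treeMatching_spec r hr
    rcases h' : treeStatus r with _ | _ | _
    · simp only [h'] at this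
      exact this
    · exact absurd h' h
    · simp only [h', Bool.and_eq_true] at this
      exact this.1.2
  diff_up r hr h := by
    have := forallLabels_iff treeMatching_spec r hr
    simp only [h, Bool.and_eq_true] at this
    exact this.2

theorem treeMatching_isValue : (treeMatching π).IsValue treeValue where
  not_mem _ h := if_neg h
  path r hr := List.all_eq_true.1 (forallLabels_iff treeValue_path r hr)
  keep r hr h := by
    obtain ⟨v | k | f, s, t⟩ := r
    · cases h
    · exact (if_pos hr).trans (if_pos h)
    · exact (if_pos hr).trans (if_pos h)
  hi r hr h := by
    have h' : ¬ treeStatus r = .keep := by rw [show treeStatus r = .hi from h]; decide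
    obtain ⟨v | k | f, s, t⟩ := r
    · cases h
    · exact (if_pos hr).trans (if_neg h')
    · cases h
  diff_hi r hr h := by
    have := forallLabels_iff treeMatching_spec r hr
    simp only [show treeStatus r = .hi from h, Bool.and_eq_true] at this
    exact List.isEmpty_iff.1 this.2
  -- The reduced differential is this substitution by definition, up to normalization.
  diff_keep r _ _ := ((reducedPresentation π).eval_normal _).symm

end

end CellDGA

namespace CellDGA

open NCPoly SemiFree Comp222 K0 K1 K2 Gen21

/-! ## Cancellation of the circles -/

/-- The circle that bounds an annulus or disc from outside. -/
def outerCircle : K2 → K1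
  | f1 => e0
  | f2 => e21
  | f3 => e19
  | f4 => e15
  | f5 => e14
  | f6 => e13
  | f7 => e1
  | f8 => e18
  | f9 => e17
  | f10 => e16
  | f11 => e8

/-- The circle that bounds an annulus from inside. -/
def innerCircle : K2 → K1
  | f1 => e21
  | f2 => e19
  | f3 => e15
  | f4 => e14
  | f5 => e13
  | f6 => e1
  | f8 => e17
  | f9 => e16
  | f10 => e8
  | _ => e0

/-- The 2-cells outside and inside a circle. -/
def circleFaces : K1 → K2 × K2
  | e21 => (f1, f2)
  | e19 => (f2, f3)
  | e15 => (f3, f4)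
  | e14 => (f4, f5)
  | e13 => (f5, f6)
  | e1 => (f6, f7)
  | e18 => (f3, f8)
  | e17 => (f8, f9)
  | e16 => (f9, f10)
  | e8 => (f10, f11)
  | _ => (f1, f1)

/-- The depth of a 2-cell. -/
def faceDepth : K2 → ℕ
  | f1 => 1
  | f2 => 2
  | f3 => 3
  | f4 | f8 => 4
  | f5 | f9 => 5
  | f6 | f10 => 6
  | f7 | f11 => 7

/-- The components `Λ_P` and `Λ_Q`. -/
def isPQ : Comp222 → Bool
  | P | Q => true
  | _ => false

/-- The 2-cell inside the front of `Λ_Q`. -/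
def isQFace : K2 → Bool
  | f8 | f9 | f10 | f11 => true
  | _ => false

/-- The depth at which the generator of a 2-cell is not cancelled with a generator of a circle. -/
def pairDepth : Sheet222 → Sheet222 → ℕ
  -- A pair that becomes disordered at a crossing is left over above the innermost 2-cell before
  -- that crossing. Its partner under `faceDown` or `faceUp` must be left over above the same
  -- 2-cell, hence the common values.
  | (B, false), (R, true) | (B, true), (R, true) => 2
  | (R, false), (A, true) | (R, false), (A, false) => 1
  | (B, false), (A, true) | (B, true), (A, true) => 6
  | (B, _), (X, true) => if isPQ X then 5 else 7
  | (X, false), (A, _) => if isPQ X then 4 else 7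
  | _, _ => 7

/-- The generators of a 2-cell that are cancelled with another generator of the same 2-cell. -/
def faceDown : Sheet222 → Sheet222 → Option (Sheet222 × Sheet222)
  | (B, true), (X, b) => if X = B then none else some (L B, (X, b))
  | (A, true), (A, false) | (B, false), (A, false) => none
  | s, (A, false) => some (s, U A)
  | (X, true), (R, false) => if isPQ X then some (L X, L R) else none
  | (R, true), (X, false) => if isPQ X then some (U R, U X) else none
  | _, _ => none

/-- The inverse of `faceDown`. -/
def faceUp : Sheet222 → Sheet222 → Sheet222 × Sheet222
  | (B, false), t => (U B, t)
  | s, (A, true) => (s, L A)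
  | (X, false), (R, false) => (U X, L R)
  | (R, true), (X, true) => (U R, L X)
  | s, t => (s, t)

/-- The generator of a 2-cell is cancelled with a generator of the outer circle. -/
def isOuter (f : K2) (s t : Sheet222) : Bool :=
  Nat.blt (pairDepth s t) (faceDepth f) ||
    -- For sheets outside `Λ_Q` the branch around `Λ_P` supplies the leftover 2-cell, so all 2-cells
    -- around `Λ_Q` cancel with their outer circles. The pair `A⁺`, `B⁻` is ordered this way only
    -- above the two innermost discs and above no circle, so both of its generators stay.
    (isQFace f && s.1 != Q && t.1 != Q && !(s == U A && t == L B))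

/-- The generators that are kept. -/
def keptLabel : Gen21 → Label222
  | b2 => (.edge e2, L R, U A)
  | b3 => (.edge e3, L B, U R)
  | b5 => (.edge e5, L P, U A)
  | b6 => (.edge e6, L B, U P)
  | b7 => (.edge e7, L B, U A)
  | b10 => (.edge e10, L Q, U A)
  | b11 => (.edge e11, L B, U Q)
  | b12 => (.edge e12, L B, U A)
  | c7_45 => (.face f7, U A, L B)
  | c7_35 => (.face f7, U P, L B)
  | s25 => (.face f7, U R, L B)
  | c7_46 => (.face f7, U A, L P)
  | s47 => (.face f7, U A, L R)
  | s48 => (.face f7, U A, L A)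
  | s15 => (.face f7, U B, L B)
  | c7_36 => (.face f7, U P, L P)
  | s27 => (.face f7, U R, L R)
  | c11_45 => (.face f11, U A, L B)
  | c11_35 => (.face f11, U Q, L B)
  | c11_46 => (.face f11, U A, L Q)
  | c11_36 => (.face f11, U Q, L Q)

/-- The inverse of `keptLabel`. -/
def keptName : Label222 → Gen21
  | (.edge e2, _, _) => b2
  | (.edge e3, _, _) => b3
  | (.edge e5, _, _) => b5
  | (.edge e6, _, _) => b6
  | (.edge e7, _, _) => b7
  | (.edge e10, _, _) => b10
  | (.edge e11, _, _) => b11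
  | (.edge _, _, _) => b12
  | (.face f, (A, _), (B, _)) => if f = f7 then c7_45 else c11_45
  | (_, (P, _), (B, _)) => c7_35
  | (_, (R, _), (B, _)) => s25
  | (_, (A, _), (P, _)) => c7_46
  | (_, (A, _), (R, _)) => s47
  | (_, (A, _), (A, _)) => s48
  | (_, (B, _), (B, _)) => s15
  | (_, (P, _), (P, _)) => c7_36
  | (_, (R, _), (R, _)) => s27
  | (_, (Q, _), (B, _)) => c11_35
  | (_, (A, _), (Q, _)) => c11_46
  | _ => c11_36

/-- The roles of the generators in the cancellation of the circles. -/
def circleStatus : Label222 → Status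
  | (.vert _, _, _) => .lo
  | (.edge k, _, _) => if (treeVertex k).isSome then .keep else .lo
  | (.face f, s, t) =>
    if isOuter f s t || Nat.blt (faceDepth f) (pairDepth s t) then .hi
    else if (faceDown s t).isSome then .hi
    else if s.2 && !t.2 then .keep
    else .lo

/-- The generator with which a boundary is cancelled. -/
def circleUp : Label222 → Label222
  | (.edge k, s, t) =>
    (.face (if isOuter (circleFaces k).2 s t then (circleFaces k).2 else (circleFaces k).1), s, t)
  | (.face f, s, t) => (.face f, faceUp s t)
  | r => r

/-- The generator that is cancelled with a given generator of a 2-cell. -/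
def circleDown : Label222 → Label222
  | (.face f, s, t) =>
    if isOuter f s t then (.edge (outerCircle f), s, t)
    else if Nat.blt (faceDepth f) (pairDepth s t) then (.edge (innerCircle f), s, t)
    else (.face f, (faceDown s t).getD (s, t))
  | r => r

/-- The contribution of the sheets to the ordering of the generators; `Λ_P` and `Λ_Q` play the same
role. -/
def pairRank (s t : Sheet222) : ℕ :=
  match (if s.1 = Q then (P, s.2) else s), (if t.1 = Q then (P, t.2) else t) with
  | (A, true), (P, false) | (P, true), (B, false) => 1
  | (P, true), (P, false) => 2
  | (B, true), (R, true) => 11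
  | (P, false), (R, false) => 12
  | (A, true), (R, false) | (R, true), (B, false) => 13
  | (A, true), (A, false) | (B, true), (B, false) | (P, true), (R, false)
  | (R, true), (P, true) => 14
  | (R, true), (P, false) => 15
  | (P, false), (A, false) | (R, true), (R, false) => 27
  | (B, true), (P, true) | (R, true), (A, true) => 28
  | (R, true), (A, false) => 29
  | (B, false), (P, false) | (P, true), (A, true) => 30
  | (B, true), (P, false) | (P, true), (A, false) => 31
  | (B, false), (R, false) => 36
  | (B, false), (A, true) => 37
  | (B, true), (R, false) => 43
  | (B, true), (A, true) => 44
  | (B, false), (A, false) => 45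
  | (B, true), (A, false) => 46
  | _, _ => 0

/-- The position in the ordering of a generator of a 2-cell that is not cancelled as a boundary. -/
def faceRank (f : K2) (s t : Sheet222) : ℕ :=
  pairRank s t +
    if isOuter f s t then 10 - faceDepth f
    else if Nat.blt (faceDepth f) (pairDepth s t) then 2 + 2 * faceDepth f
    else if (faceDown s t).isSome then 8 + faceDepth f
    else 15

/-- An ordering of the generators that is compatible with the cancellation of the circles. -/
def circleRank (r : Label222) : ℕ :=
  -- The rank of a cancelled boundary is read off its partner, which makes the two ranks equal.
  match (if circleStatus r = .lo then circleUp r else r) with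
  | (.vert _, _, _) => 0
  | (.edge k, _, _) => if k = e7 ∨ k = e12 then 1 else 0
  | (.face f, s, t) => faceRank f s t

/-- The images of the generators of the circles from `e13` to `e18` for the sheets that are not in
`Λ_P` and `Λ_Q`, except for those of the sheets `L B` and `U A`. -/
def circleValue : Sheet222 → Sheet222 → List (List Gen21)
  | (A, true), (A, false) => [[c11_45, b12], [c11_46, b10]]
  | (A, true), (R, false) => [[c11_45, b3]]
  | (B, false), (A, false) => [[b11, c11_36, b10], [b12, c11_45, b12]]
  | (B, false), (R, false) => [[b11, c11_35, b3], [b12, c11_45, b3]]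
  | (B, true), (A, true) => [[b11, c11_36, b10], [b12, c11_45, b12]]
  | (B, true), (B, false) => [[b11, c11_35], [b12, c11_45]]
  | (R, true), (A, true) => [[b2, c11_45, b12], [b2, c11_46, b10]]
  | (R, true), (B, false) => [[b2, c11_45]]
  | _, _ => []

/-- The images of the generators of the circles for the sheets in one of `Λ_P`, `Λ_Q` and another
component. -/
def crossingValue : Sheet222 → Sheet222 → List (List Gen21)
  | (P, false), (A, false) => [[b5, s47, b2], [c7_35, b3, b2]]
  | (P, false), (R, false) => [[b5, c11_45, b3]]
  | (P, true), (A, true) => [[b5, c11_45, b12], [b5, c11_46, b10], [b5, s47, b2], [c7_35, b3, b2]]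
  | (B, false), (P, false) => [[b11, c11_35, b6], [b12, c11_45, b6], [b3, b2, c7_46], [b3, s25, b6]]
  | (B, true), (P, true) => [[b3, b2, c7_46], [b3, s25, b6]]
  | (R, true), (P, true) => [[b2, c11_45, b6]]
  | (Q, false), (A, false) => [[c11_35, b3, b2]]
  | (Q, false), (R, false) => [[b10, c11_45, b3]]
  | (Q, true), (A, true) => [[b10, c11_45, b12], [b10, c11_46, b10], [c11_35, b3, b2]]
  | (B, false), (Q, false) => [[b11, c11_35, b11], [b12, c11_45, b11], [b3, b2, c11_46]]
  | (B, true), (Q, true) => [[b3, b2, c11_46]]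
  | (R, true), (Q, true) => [[b2, c11_45, b11]]
  | _, _ => []

/-- The images of the generators of the boundary of the innermost disc in the front of `Λ_P`, for the
sheets that are not in `Λ_P`. -/
def discValueP : Sheet222 → Sheet222 → List (List Gen21)
  | (A, true), (A, false) => [[c11_45, b12], [c11_46, b10]]
  | (A, true), (R, false) => [[c11_45, b3]]
  | (B, false), (A, false) =>
    [[b11, c11_35, b7], [b12, c11_45, b7], [b3, b2, s48], [b3, s25, b7], [b3, s27, b2],
      [b6, b5, s48], [b6, c7_35, b7], [b6, c7_36, b5], [b7, c11_45, b12], [b7, c11_46, b10]]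
  | (B, false), (R, false) => [[b11, c11_35, b3], [b12, c11_45, b3], [b7, c11_45, b3]]
  | (B, true), (A, true) =>
    [[b3, b2, s48], [b3, s25, b7], [b3, s27, b2], [b6, b5, s48], [b6, c7_35, b7], [b6, c7_36, b5]]
  | (B, true), (B, false) => [[b11, c11_35], [b12, c11_45]]
  | (R, true), (A, true) => [[b2, c11_45, b12], [b2, c11_45, b7], [b2, c11_46, b10]]
  | (R, true), (B, false) => [[b2, c11_45]]
  | _, _ => []

/-- The images of the generators of the boundary of the innermost disc in the front of `Λ_Q`, for the
sheets that are not in `Λ_Q`. -/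
def discValueQ : Sheet222 → Sheet222 → List (List Gen21)
  | (A, true), (A, false) => [[c11_45, b12], [c11_46, b10]]
  | (A, true), (R, false) => [[c11_45, b3]]
  | (B, false), (A, false) => [[b11, c11_36, b10], [b12, c11_46, b10]]
  | (B, false), (R, false) => [[b11, c11_35, b3]]
  | (B, true), (A, true) => [[b11, c11_35, b12], [b11, c11_36, b10]]
  | (B, true), (B, false) => [[b11, c11_35], [b12, c11_45]]
  | (R, true), (A, true) => [[b2, c11_46, b10]]
  | (R, true), (B, false) => [[b2, c11_45]]
  | _, _ => []

/-- The images of the generators of the innermost disc in the front of `Λ_P`. -/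
def faceValueP : Sheet222 → Sheet222 → List (List Gen21)
  | (B, false), (A, false) => [[b7, s48], [s15, b7]]
  | (B, false), (P, false) => [[b6, c7_36], [b7, c7_46], [s15, b6]]
  | (B, false), (R, false) => [[b3, s27], [b7, s47], [s15, b3]]
  | (P, false), (R, false) => [[b5, s47], [c7_35, b3]]
  | (P, true), (A, true) => [[b5, s48], [c7_35, b7], [c7_36, b5]]
  | (R, true), (A, true) => [[b2, s48], [s25, b7], [s27, b2]]
  | (R, true), (P, true) => [[b2, c7_46], [s25, b6]]
  | _, _ => []

/-- The images of the generators of the innermost disc in the front of `Λ_Q`. -/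
def faceValueQ : Sheet222 → Sheet222 → List (List Gen21)
  | (B, false), (Q, false) => [[b11, c11_36], [b12, c11_46]]
  | (Q, false), (R, false) => [[c11_35, b3]]
  | (Q, true), (A, true) => [[c11_35, b12], [c11_36, b10]]
  | (R, true), (Q, true) => [[b2, c11_46]]
  | _, _ => []

/-- The images of the generators of the circles for the sheets `L B` and `U A`. -/
def crossingValueBA : K1 → List (List Gen21)
  | e16 => []
  | e13 =>
    [[b11, b10, c11_45, b12], [b11, b10, c11_46, b10], [b11, c11_35, b11, b10],
      [b11, c11_35, b3, b2], [b11, c11_35, b6, b5], [b12, c11_45, b11, b10],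
      [b12, c11_45, b6, b5], [b3, b2, c7_46, b5], [b3, b2, c11_46, b10], [b3, s25, b6, b5],
      [b6, b5, c11_45, b12], [b6, b5, c11_46, b10], [b6, b5, s47, b2], [b6, c7_35, b3, b2]]
  | _ =>
    [[b11, b10, c11_45, b12], [b11, b10, c11_46, b10], [b11, c11_35, b11, b10],
      [b11, c11_35, b3, b2], [b12, c11_45, b11, b10], [b3, b2, c11_46, b10]]

/-- The images of the generators of the circles. -/
def edgeValue (k : K1) (s t : Sheet222) : List (List Gen21) :=
  if isPQ s.1 || isPQ t.1 then
    if isPQ s.1 || !(k == e14 || k == e17) then crossingValue s t else []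
  else
    match k with
    | e19 | e21 => []
    | e1 => discValueP s t
    | e8 => discValueQ s t
    | k => if s == L B && t == U A then crossingValueBA k else circleValue s t

/-- The images of the generators of the 2-cells that are cancelled as boundaries. -/
def faceValue : K2 → Sheet222 → Sheet222 → List (List Gen21)
  | f4, (X, _), t | f8, (X, _), t => crossingValue (U X) t
  | f5, s, (X, _) | f9, s, (X, _) => crossingValue s (L X)
  | f6, _, _ =>
    [[b11, c11_35, b7], [b11, c11_36, b10], [b12, c11_45, b12], [b12, c11_45, b7], [b3, b2, s48],
      [b3, s25, b7], [b3, s27, b2], [b6, b5, s48], [b6, c7_35, b7], [b6, c7_36, b5]]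
  | f7, s, t => faceValueP s t
  | f11, s, t => faceValueQ s t
  | _, _, _ => []

/-- The image of a generator under the cancellation of the circles. -/
def circleValueWords (r : Label222) : List (List Gen21) :=
  match circleStatus r with
  | .keep => [[keptName r]]
  | .hi => []
  | .lo =>
    match r with
    | (.vert _, _, _) => []
    | (.edge k, s, t) => edgeValue k s t
    | (.face f, s, t) => faceValue f s t

/-- Words in the generators as words in letters. -/
def ofWords : List (List Gen21) → NCPoly (Comp222 ⊕ Gen21) := List.map (List.map Sum.inr)

/-- The images of the generators under the cancellation of the circles. -/
def reducedValue (r : Label222) : NCPoly (Comp222 ⊕ Gen21) :=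
  if TreeKeep r then ofWords (circleValueWords r) else []

/-- The differentials of the generators of `𝒞'(Λ_{2,2,2})`. -/
def differentialWords : Gen21 → List (List Gen21)
  | b7 => [[b6, b5], [b3, b2]]
  | b12 => [[b11, b10], [b3, b2]]
  | c7_35 => [[b5, c7_45]]
  | c11_35 => [[b10, c11_45]]
  | s25 => [[b2, c11_45], [b2, c7_45]]
  | c7_46 => [[c7_45, b6]]
  | c11_46 => [[c11_45, b11]]
  | s47 => [[c11_45, b3], [c7_45, b3]]
  | s48 => [[c11_45, b12], [c7_45, b7], [c7_46, b5], [c11_46, b10], [s47, b2]]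
  | s15 => [[b6, c7_35], [b11, c11_35], [b3, s25], [b12, c11_45], [b7, c7_45]]
  | c7_36 => [[b5, c7_46], [c7_35, b6]]
  | c11_36 => [[b10, c11_46], [c11_35, b11]]
  | s27 => [[b2, s47], [s25, b3]]
  | _ => []

theorem eval_differentialWords {T : Type} [Ring T] (e : Comp222 → T) (x : Gen21 → T) (k : Gen21) :
    Gen21.differential x k = eval (Sum.elim e x) (ofWords (differentialWords k)) := by
  cases k <;> simp [Gen21.differential, differentialWords, ofWords, add_assoc]

/-- Source of a generator. -/
abbrev genSrc (g : Gen21) : Comp222 := g.ends.1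

/-- Target of a generator. -/
abbrev genTgt (g : Gen21) : Comp222 := g.ends.2

/-- The image of the differential of a generator under the cancellation of the circles. -/
def circleDiff (r : Label222) : NCPoly (Comp222 ⊕ Gen21) := substLabel reducedValue (treeDiff r)

/-- For a 2-cell between two circles, `dc` contains the generators of both linearly, for sheets
ordered over both circles, and may be cancelled with either one. Above a leftover 2-cell, the cusp
entries `e_v` make `dc` for one sheet of a component contain the generator for its other sheet, as
in `d c^{B⁺,t} = c^{B⁻,t} + ⋯`. The tables behind `reducedValue` solve `φ (d hi) = 0`; they are
justified by the emptiness required in the second case, and the third case identifies the resulting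
differential. -/
theorem circleMatching_spec : forallLabels (fun r => !decide (treeStatus r = .keep) ||
    match circleStatus r with
    | .lo => decide (TreeKeep (circleUp r)) && decide (circleStatus (circleUp r) = .hi) &&
        decide (circleDown (circleUp r) = r) && decide (labelSrc (circleUp r) = labelSrc r) &&
        decide (labelTgt (circleUp r) = labelTgt r) &&
        decide (labelDeg r = labelDeg (circleUp r) + 1) &&
        decide (circleRank (circleUp r) = circleRank r) &&
        Presentation.IsBelow circleRank (circleRank r) (treeDiff r) &&
        Presentation.IsBelow circleRank (circleRank r)
          (normal labelSrc labelTgt ([Sum.inr r] :: treeDiff (circleUp r)))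
    | .hi => decide (TreeKeep (circleDown r)) && decide (circleStatus (circleDown r) = .lo) &&
        decide (circleUp (circleDown r) = r) &&
        (normal genSrc genTgt (circleDiff r)).isEmpty
    | .keep => decide (keptLabel (keptName r) = r) &&
        Presentation.IsBelow circleRank (circleRank r) (treeDiff r) &&
        (normal genSrc genTgt (circleDiff r ++ ofWords (differentialWords (keptName r)))).isEmpty) =
      true := by
  decide +kernel

theorem reducedValue_path : forallLabels (fun r => (reducedValue r).all fun w =>
    IsPathWord genSrc genTgt (labelSrc r) (labelTgt r) w) = true := by
  decide +kernel

theorem keptLabel_spec : ∀ k, TreeKeep (keptLabel k) ∧ circleStatus (keptLabel k) = .keep ∧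
    keptName (keptLabel k) = k ∧ labelSrc (keptLabel k) = genSrc k ∧
    labelTgt (keptLabel k) = genTgt k ∧ labelDeg (keptLabel k) = k.degree := by
  intro k
  cases k <;> decide +kernel

section

variable {V : Type} [Fintype V] (π : Comp222 → V)

/-- The presentation of `𝒞'(Λ_{2,2,2})`. -/
noncomputable def presentation222' : Presentation (C222' π) π Gen21 where
  mem _ := True
  src := genSrc
  tgt := genTgt
  deg := Gen21.degree
  diff k := ofWords (differentialWords k)
  label := id
  val := (C222' π).x
  label_injective := Function.injective_id
  mem_iff r := ⟨fun _ => ⟨r, rfl⟩, fun _ => trivial⟩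
  val_label _ := rfl
  val_of_not_mem _ h := absurd trivial h
  src_label _ := rfl
  tgt_label _ := rfl
  deg_label _ := rfl
  diff_label k := eval_differentialWords _ (C222' π).x k

/-- The cancellation of the circles. -/
noncomputable def circleMatching : Matching (reducedPresentation π) (presentation222' π) where
  status := circleStatus
  up := circleUp
  down := circleDown
  kept := keptLabel
  name := keptName
  rank := circleRank
  lo_spec r hr h := by
    have := forallLabels_iff circleMatching_spec r hr.1
    simp only [h, hr.2, decide_true, Bool.not_true, Bool.false_or, Bool.and_eq_true,
      decide_eq_true_eq] at this
    obtain ⟨⟨⟨⟨⟨⟨⟨⟨h1, h2⟩, h3⟩, h4⟩, h5⟩, h6⟩, h7⟩, -⟩, -⟩ := this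
    exact ⟨h1, h2, h3, h4, h5, h6, h7⟩
  hi_spec r hr h := by
    have := forallLabels_iff circleMatching_spec r hr.1
    simp only [h, hr.2, decide_true, Bool.not_true, Bool.false_or, Bool.and_eq_true,
      decide_eq_true_eq] at this
    exact ⟨this.1.1.1, this.1.1.2, this.1.2⟩
  kept_spec k _ := keptLabel_spec k
  name_spec r hr h := by
    have := forallLabels_iff circleMatching_spec r hr.1
    simp only [h, hr.2, decide_true, Bool.not_true, Bool.false_or, Bool.and_eq_true,
      decide_eq_true_eq] at this
    exact ⟨trivial, this.1.1⟩
  diff_below r hr h := by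
    have := forallLabels_iff circleMatching_spec r hr.1
    rcases h' : circleStatus r with _ | _ | _
    · simp only [h', hr.2, decide_true, Bool.not_true, Bool.false_or, Bool.and_eq_true] at this
      exact this.1.2
    · exact absurd h' h
    · simp only [h', hr.2, decide_true, Bool.not_true, Bool.false_or, Bool.and_eq_true] at this
      exact this.1.2
  diff_up r hr h := by
    have := forallLabels_iff circleMatching_spec r hr.1
    simp only [h, hr.2, decide_true, Bool.not_true, Bool.false_or, Bool.and_eq_true] at this
    exact this.2

theorem circleMatching_isValue : (circleMatching π).IsValue reducedValue where
  not_mem _ h := if_neg h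
  path r hr := List.all_eq_true.1 (forallLabels_iff reducedValue_path r hr.1)
  keep r hr h := by
    refine (if_pos hr).trans ?_
    rw [circleValueWords.eq_def, show circleStatus r = .keep from h]
    rfl
  hi r hr h := by
    refine (if_pos hr).trans ?_
    rw [circleValueWords.eq_def, show circleStatus r = .hi from h]
    rfl
  diff_hi r hr h := by
    have := forallLabels_iff circleMatching_spec r hr.1
    simp only [show circleStatus r = .hi from h, hr.2, decide_true, Bool.not_true, Bool.false_or,
      Bool.and_eq_true] at this
    exact List.isEmpty_iff.1 this.2
  diff_keep r hr h := by
    have := forallLabels_iff circleMatching_spec r hr.1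
    simp only [show circleStatus r = .keep from h, hr.2, decide_true, Bool.not_true, Bool.false_or,
      Bool.and_eq_true] at this
    exact (presentation222' π).eval_eq_of_normal (List.isEmpty_iff.1 this.2)

end

end CellDGA

/-! ### The composite of the two cancellations. -/

namespace CellDGA

open NCPoly SemiFree Comp222 K0 K1 K2

theorem finite_labels (p : Label222 → Prop) : Finite {r // p r} := by
  have : Finite (Cell K0 K1 K2) :=
    Set.finite_univ_iff.1 (cells222.finite_toSet.subset fun c _ => mem_cells222 c)
  infer_instance

variable {V : Type} [Fintype V] (π : Comp222 → V)

instance : Finite (C222 π).Gen := finite_labels _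

instance : Finite (reduced222 π).Gen := finite_labels _

/-- The quasi-isomorphism from `𝒞(Λ_{2,2,2})` to `𝒞'(Λ_{2,2,2})`, with its values on all
generators. -/
theorem exists_quasiIso222 : (C222' π).IsSemiFreeDG ∧ StableTameIso (C222 π) (C222' π) ∧
    ∃ φ : (C222 π).Alg →ₐ[ZMod 2] (C222' π).Alg, IsQuasiIso (C222 π) (C222' π) φ ∧
      ∀ r, φ (labelVal π r) =
        eval (presentation222' π).letter (substLabel reducedValue (treeValue r)) := by
  have hA := isSemiFreeDG222 π
  obtain ⟨φ, hφ, hd, hv⟩ := (treeMatching_isValue π).exists_quotientMap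
  obtain ⟨ψ, hψ, hd', hv'⟩ := (circleMatching_isValue π).exists_quotientMap
  have hB := (treeMatching π).cancellation.isSemiFreeDG hφ hA hd
  refine ⟨(circleMatching π).cancellation.isSemiFreeDG hψ hB hd',
    Cancellation.stableTameIso_of_two _ _ hφ hψ hA hd hd', ψ.comp φ,
    ((treeMatching π).cancellation.isQuasiIso hφ hA hd).comp
      ((circleMatching π).cancellation.isQuasiIso hψ hB hd'), fun r => ?_⟩
  -- On letters the second quotient map is substitution of `reducedValue`, so the composite is
  -- computed by substituting the tables successively.
  have he : ψ.toRingHom ∘ (reducedPresentation π).letter = fun a =>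
      eval (presentation222' π).letter (Sum.elim (fun i => [[Sum.inl i]]) reducedValue a) := by
    funext a
    rcases a with i | r
    · exact (hψ.map_e _).trans (by simp)
    · exact hv' r
  rw [AlgHom.comp_apply, eval_subst, ← he]
  exact (congrArg ψ (hv r)).trans (map_eval ψ.toRingHom _ _)

end CellDGA

open CellDGA CellDGA.K1 CellDGA.K2 in
theorem proposition6 {V : Type} [Fintype V] (π : Comp222 → V) :
    (C222 π).IsSemiFreeDG ∧ (C222' π).IsSemiFreeDG ∧
    SemiFree.StableTameIso (C222 π) (C222' π) ∧
    ∃ φ : (C222 π).Alg →ₐ[ZMod 2] (C222' π).Alg,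
      SemiFree.IsQuasiIso (C222 π) (C222' π) φ ∧
      φ (cgen π (.edge e2) 4 5 (by decide)) = (C222' π).x .b2 ∧
      φ (cgen π (.edge e3) 2 3 (by decide)) = (C222' π).x .b3 ∧
      φ (cgen π (.edge e5) 5 6 (by decide)) = (C222' π).x .b5 ∧
      φ (cgen π (.edge e6) 3 4 (by decide)) = (C222' π).x .b6 ∧
      φ (cgen π (.edge e7) 4 5 (by decide)) = (C222' π).x .b7 ∧
      φ (cgen π (.edge e10) 5 6 (by decide)) = (C222' π).x .b10 ∧
      φ (cgen π (.edge e11) 3 4 (by decide)) = (C222' π).x .b11 ∧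
      φ (cgen π (.edge e12) 4 5 (by decide)) = (C222' π).x .b12 ∧
      φ (cgen π (.face f7) 4 5 (by decide)) = (C222' π).x .c7_45 ∧
      φ (cgen π (.face f11) 4 5 (by decide)) = (C222' π).x .c11_45 ∧
      φ (cgen π (.face f7) 3 5 (by decide)) = (C222' π).x .c7_35 ∧
      φ (cgen π (.face f11) 3 5 (by decide)) = (C222' π).x .c11_35 ∧
      φ (cgen π (.face f7) 2 5 (by decide) + cgen π (.face f11) 2 5 (by decide)) =
        (C222' π).x .s25 ∧
      φ (cgen π (.face f7) 4 6 (by decide)) = (C222' π).x .c7_46 ∧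
      φ (cgen π (.face f11) 4 6 (by decide)) = (C222' π).x .c11_46 ∧
      φ (cgen π (.face f7) 4 7 (by decide) + cgen π (.face f11) 4 7 (by decide)) =
        (C222' π).x .s47 ∧
      φ (cgen π (.face f7) 4 8 (by decide) + cgen π (.face f11) 4 8 (by decide)) =
        (C222' π).x .s48 ∧
      φ (cgen π (.face f7) 1 5 (by decide) + cgen π (.face f11) 1 5 (by decide)) =
        (C222' π).x .s15 ∧
      φ (cgen π (.face f7) 3 6 (by decide)) = (C222' π).x .c7_36 ∧
      φ (cgen π (.face f11) 3 6 (by decide)) = (C222' π).x .c11_36 ∧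
      φ (cgen π (.face f7) 2 7 (by decide) + cgen π (.face f11) 2 7 (by decide)) =
        (C222' π).x .s27 := by
  obtain ⟨hC, hst, φ, hφ, hv⟩ := exists_quasiIso222 π
  have key : ∀ (c : Cell K0 K1 K2) (m n : ℕ) (h : front222.Prec c (nthSheet c m) (nthSheet c n))
      (p : NCPoly (Comp222 ⊕ Gen21)),
      NCPoly.subst (Sum.elim (fun i => [[Sum.inl i]]) reducedValue)
        (treeValue (c, nthSheet c m, nthSheet c n)) = p →
      φ (cgen π c m n h) = NCPoly.eval (presentation222' π).letter p := by
    intro c m n h p hp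
    rw [← hp, ← hv, labelVal, dif_pos (show Over c _ _ from h)]
    rfl
  have hx : ∀ g, NCPoly.eval (presentation222' π).letter [[Sum.inr g]] = (C222' π).x g := by
    intro g
    simp only [NCPoly.eval_cons, NCPoly.eval_nil, List.map_cons, List.map_nil, List.prod_cons,
      List.prod_nil, mul_one, add_zero]
    rfl
  have key1 : ∀ (c : Cell K0 K1 K2) (m n : ℕ) (h : front222.Prec c (nthSheet c m) (nthSheet c n))
      (g : Gen21), NCPoly.subst (Sum.elim (fun i => [[Sum.inl i]]) reducedValue)
        (treeValue (c, nthSheet c m, nthSheet c n)) = [[Sum.inr g]] →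
      φ (cgen π c m n h) = (C222' π).x g := fun c m n h g hg => (key c m n h _ hg).trans (hx g)
  -- In each sum the summand over `f11` was cancelled with a generator of the outer circle `e8` and
  -- goes to zero. The summand over `f7` is the one that was kept.
  have key2 : ∀ (c c' : Cell K0 K1 K2) (m n : ℕ)
      (h : front222.Prec c (nthSheet c m) (nthSheet c n))
      (h' : front222.Prec c' (nthSheet c' m) (nthSheet c' n)) (g : Gen21),
      NCPoly.subst (Sum.elim (fun i => [[Sum.inl i]]) reducedValue)
        (treeValue (c, nthSheet c m, nthSheet c n)) = [[Sum.inr g]] →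
      NCPoly.subst (Sum.elim (fun i => [[Sum.inl i]]) reducedValue)
        (treeValue (c', nthSheet c' m, nthSheet c' n)) = [] →
      φ (cgen π c m n h + cgen π c' m n h') = (C222' π).x g := by
    intro c c' m n h h' g hg hg'
    rw [map_add, key1 c m n h g hg, key c' m n h' _ hg', NCPoly.eval_nil, add_zero]
  refine ⟨isSemiFreeDG222 π, hC, hst, φ, hφ, ?_⟩
  refine ⟨key1 _ _ _ _ _ ?_, key1 _ _ _ _ _ ?_, key1 _ _ _ _ _ ?_, key1 _ _ _ _ _ ?_,
    key1 _ _ _ _ _ ?_, key1 _ _ _ _ _ ?_, key1 _ _ _ _ _ ?_, key1 _ _ _ _ _ ?_,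
    key1 _ _ _ _ _ ?_, key1 _ _ _ _ _ ?_, key1 _ _ _ _ _ ?_, key1 _ _ _ _ _ ?_,
    key2 _ _ _ _ _ _ _ ?_ ?_, key1 _ _ _ _ _ ?_, key1 _ _ _ _ _ ?_, key2 _ _ _ _ _ _ _ ?_ ?_,
    key2 _ _ _ _ _ _ _ ?_ ?_, key2 _ _ _ _ _ _ _ ?_ ?_, key1 _ _ _ _ _ ?_, key1 _ _ _ _ _ ?_,
    key2 _ _ _ _ _ _ _ ?_ ?_⟩ <;> decide +kernel
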